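/- Let $B$ be a connected smooth $n$-dimensional manifold (Hausdorff and second countable). A \emph{Lagrangian fibration} over $B$ is a smooth locally trivial fibre bundle $F \hookrightarrow M \xrightarrow{\pi} B$ whose fibre $F$ is a compact connected smooth manifold and whose total space is a $2n$-dimensional symplectic manifold $(M,\omega)$ such that $\omega|_{\pi^{-1}(b)} = 0$ for all $b \in B$. The manifold $B$ is an \emph{integral affine manifold} if it has an open cover $\{U_\alpha\}$ by the domains of smooth coordinate charts $\varphi_\alpha : U_\alpha \to \mathbb{R}^n$ such that each transition function $\varphi_\beta \circ \varphi_\alpha^{-1} : \varphi_\alpha(U_\alpha \cap U_\beta) \to \varphi_\beta(U_\alpha \cap U_\beta)$ is the restriction of an element of $\mathrm{GL}(n,\mathbb{Z}) \ltimes \mathbb{R}^n$, i.e. of a map $x \mapsto Ax + c$ with $A \in \mathrm{GL}(n,\mathbb{Z})$ and $c \in \mathbb{R}^n$. Then $B$ is the base space of some Lagrangian fibration if and only if $B$ is an integral affine manifold. -/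

import Mathlib

open scoped Manifold ContDiff

universe u

section IntegralAffine

/-- The integral affine transformation `x ↦ A x + c` of `ℝⁿ` given by the element `(A, c)` of
`GL(n, ℤ) ⋉ ℝⁿ`. -/
noncomputable def integralAffineMap {n : ℕ} (A : Matrix.GeneralLinearGroup (Fin n) ℤ)
    (c : EuclideanSpace ℝ (Fin n)) (x : EuclideanSpace ℝ (Fin n)) : EuclideanSpace ℝ (Fin n) :=
  WithLp.toLp 2 ((A.val.map (Int.cast : ℤ → ℝ)).mulVec (WithLp.ofLp x)) + c

/-- A smooth `n`-manifold `B` is an integral affine manifold if it is covered by the domains of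
a family of coordinate charts (charts of its smooth structure) such that all transition functions
between members of the family are restrictions of elements of `GL(n, ℤ) ⋉ ℝⁿ`. -/
def IsIntegralAffineManifold (n : ℕ) (B : Type*) [TopologicalSpace B]
    [ChartedSpace (EuclideanSpace ℝ (Fin n)) B] : Prop :=
  ∃ 𝒜 : Set (OpenPartialHomeomorph B (EuclideanSpace ℝ (Fin n))),
    𝒜 ⊆ IsManifold.maximalAtlas (𝓡 n) ∞ B ∧
    (∀ b : B, ∃ e ∈ 𝒜, b ∈ e.source) ∧
    ∀ e ∈ 𝒜, ∀ e' ∈ 𝒜, ∃ (A : Matrix.GeneralLinearGroup (Fin n) ℤ)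
      (c : EuclideanSpace ℝ (Fin n)),
      ∀ x ∈ (e.symm.trans e').source, e.symm.trans e' x = integralAffineMap A c x

end IntegralAffine

section Symplectic

/-- A (not necessarily smooth) differential 2-form on an `m`-manifold. -/
abbrev TwoForm (m : ℕ) (M : Type*) [TopologicalSpace M]
    [ChartedSpace (EuclideanSpace ℝ (Fin m)) M] : Type _ :=
  ∀ x : M, TangentSpace (𝓡 m) x [⋀^Fin 2]→L[ℝ] ℝ

/-- The coordinate expression of the 2-form `σ` in the preferred chart at `p`: the pullback of `σ`
under the inverse of that chart. It is meaningful on the target of the chart. -/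
noncomputable def TwoForm.inChart {m : ℕ} {M : Type*} [TopologicalSpace M]
    [ChartedSpace (EuclideanSpace ℝ (Fin m)) M] (σ : TwoForm m M) (p : M)
    (y : EuclideanSpace ℝ (Fin m)) : EuclideanSpace ℝ (Fin m) [⋀^Fin 2]→L[ℝ] ℝ :=
  (σ ((extChartAt (𝓡 m) p).symm y)).compContinuousLinearMap
    (mfderiv (𝓡 m) (𝓡 m) (extChartAt (𝓡 m) p).symm y)

/-- A symplectic form: a smooth, closed, non-degenerate 2-form. Smoothness and closedness are
expressed in the charts of the manifold. -/
structure IsSymplecticForm {m : ℕ} {M : Type*} [TopologicalSpace M]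
    [ChartedSpace (EuclideanSpace ℝ (Fin m)) M] (σ : TwoForm m M) : Prop where
  smooth : ∀ p : M, ContDiffOn ℝ ∞ (σ.inChart p) (extChartAt (𝓡 m) p).target
  closed : ∀ p : M, ∀ y ∈ (extChartAt (𝓡 m) p).target, extDeriv (σ.inChart p) y = 0
  nondegenerate : ∀ (x : M) (v : TangentSpace (𝓡 m) x),
    (∀ w : TangentSpace (𝓡 m) x, σ x ![v, w] = 0) → v = 0

end Symplectic

section LagrangianFibration

/-- `π : M → B` is a Lagrangian fibration with fibre `F` with respect to the 2-form `σ` on the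
`2n`-manifold `M`: a smooth locally trivial fibre bundle with compact connected fibre `F`, such
that `σ` is symplectic and restricts to zero on each fibre. -/
structure IsLagrangianFibration {n : ℕ} {B M F : Type*}
    [TopologicalSpace B] [ChartedSpace (EuclideanSpace ℝ (Fin n)) B]
    [TopologicalSpace M] [ChartedSpace (EuclideanSpace ℝ (Fin (2 * n))) M]
    [TopologicalSpace F] [ChartedSpace (EuclideanSpace ℝ (Fin n)) F]
    (σ : TwoForm (2 * n) M) (π : M → B) : Prop where
  symplectic : IsSymplecticForm σ
  compact_fibre : CompactSpace F
  connected_fibre : ConnectedSpace F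
  smooth : ContMDiff (𝓡 (2 * n)) (𝓡 n) ∞ π
  /-- Around each point of `B` there is a local trivialization `π⁻¹(U) ≅ U × F` over `U` that is a
  diffeomorphism. -/
  locallyTrivial : ∀ b : B, ∃ e : Bundle.Trivialization F π, b ∈ e.baseSet ∧
    ContMDiffOn (𝓡 (2 * n)) ((𝓡 n).prod (𝓡 n)) ∞ e e.source ∧
    ContMDiffOn ((𝓡 n).prod (𝓡 n)) (𝓡 (2 * n)) ∞ e.toOpenPartialHomeomorph.symm e.target
  /-- `σ` vanishes on each fibre; the tangent space at `x` of the fibre through `x` is the kernel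
  of the differential of `π` at `x`. -/
  lagrangian : ∀ (x : M) (v w : TangentSpace (𝓡 (2 * n)) x),
    mfderiv (𝓡 (2 * n)) (𝓡 n) π x v = 0 → mfderiv (𝓡 (2 * n)) (𝓡 n) π x w = 0 →
      σ x ![v, w] = 0

/-- The smooth `n`-manifold `B` is the base space of some Lagrangian fibration `F ↪ M → B`, where
`M` is a smooth `2n`-manifold and `F` a smooth `n`-manifold (both Hausdorff and second
countable). -/
def IsBaseOfLagrangianFibration (n : ℕ) (B : Type u) [TopologicalSpace B]
    [ChartedSpace (EuclideanSpace ℝ (Fin n)) B] : Prop :=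
  ∃ (M : Type u) (_ : TopologicalSpace M) (_ : ChartedSpace (EuclideanSpace ℝ (Fin (2 * n))) M)
    (F : Type u) (_ : TopologicalSpace F) (_ : ChartedSpace (EuclideanSpace ℝ (Fin n)) F),
    (IsManifold (𝓡 (2 * n)) ∞ M ∧ T2Space M ∧ SecondCountableTopology M) ∧
    (IsManifold (𝓡 n) ∞ F ∧ T2Space F ∧ SecondCountableTopology F) ∧
    ∃ (σ : TwoForm (2 * n) M) (π : M → B), IsLagrangianFibration (F := F) σ π

end LagrangianFibration

/-! From a fibration to an atlas. Over a base chart `φ` and a local trivialization, contracting `σ`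
with vertical vectors gives, on each fibre, a 1-form with values in the dual `W` of `ℝⁿ`
(`fibreForm`). Nondegeneracy, the Lagrangian condition and equality of dimensions make it an
isomorphism at each point (`fibreForm_bijective`); closedness of `σ` makes it closed along the fibre
(`fderiv_pullbackForm_symm`). It is therefore locally the differential of a diffeomorphism into `W`
(`isFlatCoframe_fibreForm`). On a compact fibre the local translations of `W` integrate to a global
action (`exists_isCoframeAction`), transitive because the fibre is connected, whose stabilizer is a
full lattice in `W`: the period lattice.

The lattice varies smoothly with the base point. Loops representing a basis at one point are kept
fixed in the typical fibre, and the form is integrated over them. The resulting 1-forms on the base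
are smooth, closed because `σ` is closed, and still generate the lattice (`exists_period_forms`).
Their primitives are the action coordinates, in which the lattice is `ℤⁿ` (`exists_action_chart`).
Membership in the lattice can be phrased through closed Hamiltonian orbits, with no reference to
charts (`IsPeriodCovector`, `isPeriodCovector_iff`), so two action charts differ by a map with
differential in `GL(n, ℤ)`. Such a differential is locally constant. Since one affine map has to
serve on the whole, possibly disconnected, overlap of two charts, the atlas is finally shrunk
(`isIntegralAffineManifold_of_fderiv`).

From an atlas to a fibration. The differentials of the affine coordinates span a lattice bundle `Λ`
in `T*B`, and the total space is `T*B / Λ`, glued from products with a torus by transposed integer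
matrices (`bundleCore`). In affine base coordinates and linear fibre coordinates the changes of
chart are, up to constants, `A` on the base and its inverse transpose on the fibre
(`totalChart_param_eventuallyEq`). These preserve the standard symplectic form, which therefore
descends, and the torus fibres are Lagrangian for it. -/

section ParametricIntegral

/-! ### Smooth dependence of integrals on parameters. -/

open Set Filter Topology MeasureTheory

variable {X G : Type} [NormedAddCommGroup X] [NormedSpace ℝ X] [FiniteDimensional ℝ X]
  [NormedAddCommGroup G] [NormedSpace ℝ G]

/-- Differentiation under the integral sign for a function that is `C^1` near `D × ℝ`. -/
theorem hasFDerivAt_integral_unitInterval {D : Set X} (hD : IsOpen D) {f : X × ℝ → G}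
    (hf : ContDiffOn ℝ 1 f (D ×ˢ univ)) {z : X} (hz : z ∈ D) :
    HasFDerivAt (fun z => ∫ t in (0 : ℝ)..1, f (z, t))
      (∫ t in (0 : ℝ)..1, (fderiv ℝ f (z, t)).comp (ContinuousLinearMap.inl ℝ X ℝ)) z := by
  have : ProperSpace X := FiniteDimensional.proper ℝ X
  have hDo : IsOpen (D ×ˢ (univ : Set ℝ)) := hD.prod isOpen_univ
  obtain ⟨r, hr, hrD⟩ := Metric.nhds_basis_closedBall.mem_iff.1 (hD.mem_nhds hz)
  have hc : ContinuousOn (fun p => (fderiv ℝ f p).comp (ContinuousLinearMap.inl ℝ X ℝ))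
      (D ×ˢ univ) :=
    (hf.continuousOn_fderiv_of_isOpen hDo le_rfl).clm_comp continuousOn_const
  have hsub : Metric.closedBall z r ×ˢ Icc (0 : ℝ) 1 ⊆ D ×ˢ univ :=
    prod_mono hrD (subset_univ _)
  obtain ⟨C, hC⟩ := ((isCompact_closedBall z r).prod isCompact_Icc).exists_bound_of_continuousOn
    (hc.mono hsub)
  have hslice {H : Type} [TopologicalSpace H] {g : X × ℝ → H} (hg : ContinuousOn g (D ×ˢ univ))
      {y : X} (hy : y ∈ D) : Continuous fun t => g (y, t) :=
    hg.comp_continuous (by fun_prop) (fun t => ⟨hy, mem_univ _⟩)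
  refine intervalIntegral.hasFDerivAt_integral_of_dominated_of_fderiv_le
    (F := fun z t => f (z, t))
    (F' := fun z t => (fderiv ℝ f (z, t)).comp (ContinuousLinearMap.inl ℝ X ℝ))
    (bound := fun _ => C) (Metric.closedBall_mem_nhds z hr) ?_ ?_ ?_ ?_ ?_ ?_
  · filter_upwards [hD.mem_nhds hz] with y hy
    exact (hslice hf.continuousOn hy).aestronglyMeasurable
  · exact (hslice hf.continuousOn hz).intervalIntegrable _ _
  · exact (hslice hc hz).aestronglyMeasurable
  · refine Eventually.of_forall fun t ht y hy => hC (y, t) ⟨hy, ?_⟩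
    rw [uIoc_of_le zero_le_one] at ht
    exact Ioc_subset_Icc_self ht
  · exact intervalIntegrable_const
  · refine Eventually.of_forall fun t ht y hy => ?_
    have h1 : HasFDerivAt f (fderiv ℝ f (y, t)) (y, t) :=
      ((hf.contDiffAt (hDo.mem_nhds ⟨hrD hy, mem_univ _⟩)).differentiableAt
        one_ne_zero).hasFDerivAt
    exact h1.comp y (hasFDerivAt_prodMk_left y t)

theorem fderiv_integral_unitInterval_apply [CompleteSpace G] {D : Set X} (hD : IsOpen D)
    {f : X × ℝ → G} (hf : ContDiffOn ℝ 1 f (D ×ˢ univ)) {z : X} (hz : z ∈ D) (a : X) :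
    fderiv ℝ (fun z => ∫ t in (0 : ℝ)..1, f (z, t)) z a =
      ∫ t in (0 : ℝ)..1, fderiv ℝ f (z, t) (a, 0) := by
  have hDo : IsOpen (D ×ˢ (univ : Set ℝ)) := hD.prod isOpen_univ
  have hc : Continuous fun t : ℝ => (fderiv ℝ f (z, t)).comp (ContinuousLinearMap.inl ℝ X ℝ) :=
    ((hf.continuousOn_fderiv_of_isOpen hDo le_rfl).comp_continuous (by fun_prop)
      fun t => ⟨hz, mem_univ t⟩).clm_comp continuous_const
  rw [(hasFDerivAt_integral_unitInterval hD hf hz).fderiv,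
    ContinuousLinearMap.intervalIntegral_apply (hc.intervalIntegrable _ _)]
  rfl

theorem fderiv_clm_comp_apply {A C Z : Type*} [NormedAddCommGroup A] [NormedSpace ℝ A]
    [NormedAddCommGroup C] [NormedSpace ℝ C] [NormedAddCommGroup Z] [NormedSpace ℝ Z]
    (L : A →L[ℝ] C) {f : Z → A} {z : Z} (hf : DifferentiableAt ℝ f z) (a : Z) :
    fderiv ℝ (fun z => L (f z)) z a = L (fderiv ℝ f z a) := by
  have h : HasFDerivAt (fun z => L (f z)) (L.comp (fderiv ℝ f z)) z :=
    L.hasFDerivAt.comp z hf.hasFDerivAt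
  rw [h.fderiv]
  rfl

/-- Serves to read derivatives of the fibre form along a fibre as derivatives of a 2-form on a
product in the directions `(0, a)`. -/
theorem fderiv_clm_slice_apply {A C Z Y : Type*} [NormedAddCommGroup A] [NormedSpace ℝ A]
    [NormedAddCommGroup C] [NormedSpace ℝ C] [NormedAddCommGroup Z] [NormedSpace ℝ Z]
    [NormedAddCommGroup Y] [NormedSpace ℝ Y]
    (L : A →L[ℝ] C) {f : Z × Y → A} {z : Z} {p : Y} (hf : DifferentiableAt ℝ f (z, p))
    {g : Y → C} (hg : g =ᶠ[𝓝 p] fun p => L (f (z, p))) (a : Y) :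
    fderiv ℝ g p a = L (fderiv ℝ f (z, p) (0, a)) := by
  have h : HasFDerivAt (fun p => f (z, p))
      ((fderiv ℝ f (z, p)).comp (ContinuousLinearMap.inr ℝ Z Y)) p :=
    hf.hasFDerivAt.comp p (hasFDerivAt_prodMk_right z p)
  rw [hg.fderiv_eq, fderiv_clm_comp_apply L h.differentiableAt, h.fderiv]
  rfl

theorem fderiv_integral_clm_apply {A Y : Type} [NormedAddCommGroup A] [NormedSpace ℝ A]
    [NormedAddCommGroup Y] [NormedSpace ℝ Y] (L : A →L[ℝ] Y →L[ℝ] ℝ) {D : Set X}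
    (hD : IsOpen D) {f : X × ℝ → A} (hf : ContDiffOn ℝ 1 f (D ×ˢ univ)) {z : X} (hz : z ∈ D)
    (a : X) (b : Y) :
    fderiv ℝ (fun z => ∫ t in (0 : ℝ)..1, L (f (z, t))) z a b =
      ∫ t in (0 : ℝ)..1, L (fderiv ℝ f (z, t) (a, 0)) b := by
  have hDo : IsOpen (D ×ˢ (univ : Set ℝ)) := hD.prod isOpen_univ
  have hc : Continuous fun t : ℝ => fderiv ℝ f (z, t) :=
    (hf.continuousOn_fderiv_of_isOpen hDo le_rfl).comp_continuous (by fun_prop)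
      fun t => ⟨hz, mem_univ t⟩
  have hd : ∀ t, DifferentiableAt ℝ f (z, t) := fun t =>
    (hf.contDiffAt (hDo.mem_nhds ⟨hz, mem_univ t⟩)).differentiableAt one_ne_zero
  have hL : ContDiffOn ℝ 1 (fun q => L (f q)) (D ×ˢ univ) := L.contDiff.comp_contDiffOn hf
  have hc' : Continuous fun t => L (fderiv ℝ f (z, t) (a, 0)) :=
    L.continuous.comp (hc.clm_apply continuous_const)
  rw [fderiv_integral_unitInterval_apply hD hL hz]
  simp only [fun t => fderiv_clm_comp_apply L (hd t) (a, 0)]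
  exact ContinuousLinearMap.intervalIntegral_apply (hc'.intervalIntegrable _ _) b

/-- The derivative of the integral is again an integral of a smooth function, now valued in linear
maps; hence an induction on the order with the codomain left free. -/
theorem contDiffOn_integral_unitInterval {D : Set X} (hD : IsOpen D) {f : X × ℝ → G}
    (hf : ContDiffOn ℝ ∞ f (D ×ˢ univ)) :
    ContDiffOn ℝ ∞ (fun z => ∫ t in (0 : ℝ)..1, f (z, t)) D := by
  rw [contDiffOn_infty]
  intro k
  induction k generalizing G with
  | zero =>
    refine contDiffOn_zero.2 fun z hz => ?_
    exact (hasFDerivAt_integral_unitInterval hD (hf.of_le (by exact_mod_cast le_top))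
      hz).continuousAt.continuousWithinAt
  | succ k ih =>
    have hDo : IsOpen (D ×ˢ (univ : Set ℝ)) := hD.prod isOpen_univ
    push_cast
    refine (contDiffOn_succ_iff_fderiv_of_isOpen hD).2 ⟨fun z hz => ?_, by simp, ?_⟩
    · exact (hasFDerivAt_integral_unitInterval hD (hf.of_le (by exact_mod_cast le_top))
        hz).differentiableAt.differentiableWithinAt
    · refine (ih (f := fun p => (fderiv ℝ f p).comp (ContinuousLinearMap.inl ℝ X ℝ)) ?_).congr
        fun z hz => ?_
      · exact (hf.fderiv_of_isOpen hDo (by simp)).clm_comp contDiffOn_const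
      · exact (hasFDerivAt_integral_unitInterval hD (hf.of_le (by exact_mod_cast le_top)) hz).fderiv

end ParametricIntegral

/-! ### Smoothness of the pullback of alternating maps. -/

section AlternatingMaps

variable {ι X Y G : Type*} [Fintype ι] [DecidableEq ι] [NormedAddCommGroup X] [NormedSpace ℝ X]
  [NormedAddCommGroup Y] [NormedSpace ℝ Y] [NormedAddCommGroup G] [NormedSpace ℝ G]

/-- Alternatization of continuous multilinear maps, as a continuous linear map. -/
noncomputable def ContinuousMultilinearMap.alternatizationCLM :
    ContinuousMultilinearMap ℝ (fun _ : ι => X) G →L[ℝ] X [⋀^ι]→L[ℝ] G :=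
  LinearMap.mkContinuous
    { toFun := ContinuousMultilinearMap.alternatization
      map_add' := map_add _
      map_smul' := fun c f => by
        ext v
        simp only [ContinuousMultilinearMap.alternatization_apply_apply,
          smul_apply, ContinuousAlternatingMap.smul_apply,
          Finset.smul_sum, RingHom.id_apply]
        exact Finset.sum_congr rfl fun τ _ => smul_comm _ _ _ }
    (Fintype.card (Equiv.Perm ι)) fun f => by
      refine ContinuousAlternatingMap.opNorm_le_bound _ (by positivity) fun v => ?_
      simp only [LinearMap.coe_mk, AddHom.coe_mk,
        ContinuousMultilinearMap.alternatization_apply_apply]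
      refine (norm_sum_le _ _).trans ?_
      rw [mul_assoc, ← nsmul_eq_mul, ← Finset.card_univ]
      refine Finset.sum_le_card_nsmul _ _ _ fun τ _ => ?_
      have h1 : ‖Equiv.Perm.sign τ • f (v ∘ τ)‖ = ‖f (v ∘ τ)‖ := by
        rcases Int.units_eq_one_or (Equiv.Perm.sign τ) with h | h <;> simp [h]
      rw [h1]
      refine (f.le_opNorm _).trans_eq ?_
      congr 1
      exact Equiv.prod_comp τ fun i => ‖v i‖

/-- All summands of the alternatization coincide. Dividing by their number gives a continuous linear
left inverse of the inclusion into multilinear maps. -/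
theorem ContinuousMultilinearMap.alternatizationCLM_coe (f : X [⋀^ι]→L[ℝ] G) :
    alternatizationCLM f.toContinuousMultilinearMap = (Fintype.card (Equiv.Perm ι) : ℝ) • f := by
  ext v
  simp only [alternatizationCLM, LinearMap.mkContinuous_apply, LinearMap.coe_mk, AddHom.coe_mk,
    alternatization_apply_apply, ContinuousAlternatingMap.coe_toContinuousMultilinearMap,
    ContinuousAlternatingMap.smul_apply]
  have : ∀ τ : Equiv.Perm ι, Equiv.Perm.sign τ • f (v ∘ τ) = f v := fun τ => by
    have := f.toAlternatingMap.map_perm v τ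
    simp only [ContinuousAlternatingMap.coe_toAlternatingMap] at this
    rw [this, smul_smul, Int.units_mul_self, one_smul]
  simp [this, Finset.card_univ, Nat.cast_smul_eq_nsmul]

/-- Among multilinear maps the composition is continuous multilinear in the inner maps and linear in
the outer one, hence smooth; the normalized alternatization brings the result back to alternating
maps. -/
theorem ContDiffAt.alternating_compContinuousLinearMap {Z : Type*} [NormedAddCommGroup Z]
    [NormedSpace ℝ Z] {k : WithTop ℕ∞} {f : Z → Y [⋀^ι]→L[ℝ] G} {g : Z → X →L[ℝ] Y} {z : Z}
    (hf : ContDiffAt ℝ k f z) (hg : ContDiffAt ℝ k g z) :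
    ContDiffAt ℝ k (fun z => (f z).compContinuousLinearMap (g z)) z := by
  have h1 : ContDiffAt ℝ k (fun z =>
      ContinuousMultilinearMap.compContinuousLinearMapContinuousMultilinear ℝ
        (fun _ : ι => X) (fun _ : ι => Y) G (fun _ => g z)) z :=
    (ContinuousMultilinearMap.contDiff _).contDiffAt.comp z (contDiffAt_pi.2 fun _ => hg)
  have h2 : ContDiffAt ℝ k (fun z => (f z).toContinuousMultilinearMap) z :=
    ContDiffAt.comp (g := ContinuousAlternatingMap.toContinuousMultilinearMapCLM ℝ) z
      (ContinuousLinearMap.contDiff _).contDiffAt hf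
  have h3 := ((ContinuousMultilinearMap.alternatizationCLM (ι := ι) (X := X) (G := G)).contDiff
    (n := k)).contDiffAt.comp z (h1.clm_apply h2)
  refine (h3.const_smul ((Fintype.card (Equiv.Perm ι) : ℝ)⁻¹)).congr_of_eventuallyEq
    (Filter.Eventually.of_forall fun z => ?_)
  have h4 := ContinuousMultilinearMap.alternatizationCLM_coe
    ((f z).compContinuousLinearMap (g z))
  refine Eq.trans ?_ (congrArg (((Fintype.card (Equiv.Perm ι) : ℝ)⁻¹) • ·) h4.symm)
  simp only [smul_smul]
  rw [inv_mul_cancel₀, one_smul]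
  exact_mod_cast Fintype.card_ne_zero

end AlternatingMaps

/-! ### Pullbacks of 2-forms to normed spaces. -/

section Pullback

open Set Filter Topology

variable {m : ℕ} {M : Type*} [TopologicalSpace M] [ChartedSpace (EuclideanSpace ℝ (Fin m)) M]
  {X : Type*} [NormedAddCommGroup X] [NormedSpace ℝ X]

/-- The pullback of a 2-form under a map from a normed space. -/
noncomputable def TwoForm.pullback (σ : TwoForm m M) (G : X → M) (y : X) :
    X [⋀^Fin 2]→L[ℝ] ℝ :=
  (σ (G y)).compContinuousLinearMap (mfderiv 𝓘(ℝ, X) (𝓡 m) G y)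

theorem TwoForm.pullback_apply (σ : TwoForm m M) (G : X → M) (y : X) (v w : X) :
    σ.pullback G y ![v, w] =
      σ (G y) ![mfderiv 𝓘(ℝ, X) (𝓡 m) G y v, mfderiv 𝓘(ℝ, X) (𝓡 m) G y w] := by
  refine congrArg (σ (G y)) (funext fun i => ?_)
  fin_cases i <;> rfl

variable [IsManifold (𝓡 m) ∞ M]

/-- Passing through the single chart at `G y₀` turns the pullback into one between normed spaces,
where smoothness and the exterior derivative are available. -/
theorem TwoForm.pullback_eventuallyEq (σ : TwoForm m M) {G : X → M} {s : Set X} (hs : IsOpen s)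
    (hG : ContMDiffOn 𝓘(ℝ, X) (𝓡 m) ∞ G s) {y₀ : X} (hy₀ : y₀ ∈ s) :
    σ.pullback G =ᶠ[𝓝 y₀] fun y =>
      (σ.inChart (G y₀) (extChartAt (𝓡 m) (G y₀) (G y))).compContinuousLinearMap
        (fderiv ℝ (fun y => extChartAt (𝓡 m) (G y₀) (G y)) y) := by
  set p := G y₀
  have hGc : ContinuousAt G y₀ := hG.continuousOn.continuousAt (hs.mem_nhds hy₀)
  have hev : ∀ᶠ y in 𝓝 y₀, y ∈ s ∧ G y ∈ (chartAt (EuclideanSpace ℝ (Fin m)) p).source :=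
    Filter.Eventually.and (hs.mem_nhds hy₀)
      (hGc.preimage_mem_nhds (chart_source_mem_nhds _ p))
  filter_upwards [hev.eventually_nhds] with y hy
  obtain ⟨hys, hyc⟩ := hy.self_of_nhds
  have hGd : MDifferentiableAt 𝓘(ℝ, X) (𝓡 m) G y :=
    (hG.contMDiffAt (hs.mem_nhds hys)).mdifferentiableAt (by simp)
  have hgd : MDifferentiableAt 𝓘(ℝ, X) (𝓡 m) (fun y => extChartAt (𝓡 m) p (G y)) y :=
    (mdifferentiableAt_extChartAt hyc).comp y hGd
  have htgt : extChartAt (𝓡 m) p (G y) ∈ (extChartAt (𝓡 m) p).target :=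
    (extChartAt (𝓡 m) p).map_source (by rwa [extChartAt_source])
  have hsymm : MDifferentiableAt (𝓡 m) (𝓡 m) (extChartAt (𝓡 m) p).symm
      (extChartAt (𝓡 m) p (G y)) :=
    (contMDiffOn_extChartAt_symm (n := ∞) p).contMDiffAt
      ((isOpen_extChartAt_target p).mem_nhds htgt) |>.mdifferentiableAt (by simp)
  have heq : G =ᶠ[𝓝 y] fun y => (extChartAt (𝓡 m) p).symm (extChartAt (𝓡 m) p (G y)) := by
    filter_upwards [hy] with y' hy'
    exact ((extChartAt (𝓡 m) p).left_inv (by rw [extChartAt_source]; exact hy'.2)).symm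
  have hder : mfderiv 𝓘(ℝ, X) (𝓡 m) G y =
      (mfderiv (𝓡 m) (𝓡 m) (extChartAt (𝓡 m) p).symm (extChartAt (𝓡 m) p (G y))).comp
        (fderiv ℝ (fun y => extChartAt (𝓡 m) p (G y)) y) := by
    have hgd' : HasMFDerivAt 𝓘(ℝ, X) (𝓡 m) (fun y => extChartAt (𝓡 m) p (G y)) y
        (fderiv ℝ (fun y => extChartAt (𝓡 m) p (G y)) y) :=
      hgd.differentiableAt.hasFDerivAt.hasMFDerivAt
    exact ((hsymm.hasMFDerivAt.comp y hgd').congr_of_eventuallyEq heq).mfderiv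
  have hval : (extChartAt (𝓡 m) p).symm (extChartAt (𝓡 m) p (G y)) = G y :=
    heq.self_of_nhds.symm
  -- Forgetting that the tangent space depends on the point allows the point to be rewritten.
  let σ' : M → EuclideanSpace ℝ (Fin m) [⋀^Fin 2]→L[ℝ] ℝ := σ
  change (σ' (G y)).compContinuousLinearMap _ = ((σ' _).compContinuousLinearMap
    _).compContinuousLinearMap _
  rw [hval, hder]
  rfl

theorem IsSymplecticForm.contDiffOn_pullback {σ : TwoForm m M} (hσ : IsSymplecticForm σ)
    {G : X → M} {s : Set X} (hs : IsOpen s) (hG : ContMDiffOn 𝓘(ℝ, X) (𝓡 m) ∞ G s) :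
    ContDiffOn ℝ ∞ (σ.pullback G) s := by
  intro y₀ hy₀
  have hGa := hG.contMDiffAt (hs.mem_nhds hy₀)
  have hg : ContDiffAt ℝ ∞ (fun y => extChartAt (𝓡 m) (G y₀) (G y)) y₀ := by
    rw [← contMDiffAt_iff_contDiffAt]
    exact (contMDiffAt_extChartAt (I := 𝓡 m) (n := ∞) (x := G y₀)).comp y₀ hGa
  have hσc : ContDiffAt ℝ ∞ (σ.inChart (G y₀)) (extChartAt (𝓡 m) (G y₀) (G y₀)) :=
    (hσ.smooth (G y₀)).contDiffAt (extChartAt_target_mem_nhds _)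
  refine ContDiffAt.contDiffWithinAt ?_
  refine ContDiffAt.congr_of_eventuallyEq ?_ (σ.pullback_eventuallyEq hs hG hy₀)
  have h1 : ContDiffAt ℝ ∞ (fun y => σ.inChart (G y₀) (extChartAt (𝓡 m) (G y₀) (G y))) y₀ :=
    ContDiffAt.comp (g := σ.inChart (G y₀)) y₀ hσc hg
  have h2 := hg.fderiv_right (m := ∞) (by simp)
  exact h1.alternating_compContinuousLinearMap h2

theorem IsSymplecticForm.extDeriv_pullback {σ : TwoForm m M} (hσ : IsSymplecticForm σ)
    {G : X → M} {s : Set X} (hs : IsOpen s) (hG : ContMDiffOn 𝓘(ℝ, X) (𝓡 m) ∞ G s)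
    {y₀ : X} (hy₀ : y₀ ∈ s) : extDeriv (σ.pullback G) y₀ = 0 := by
  have hGa := hG.contMDiffAt (hs.mem_nhds hy₀)
  have hg : ContDiffAt ℝ ∞ (fun y => extChartAt (𝓡 m) (G y₀) (G y)) y₀ := by
    rw [← contMDiffAt_iff_contDiffAt]
    exact (contMDiffAt_extChartAt (I := 𝓡 m) (n := ∞) (x := G y₀)).comp y₀ hGa
  have hσc : ContDiffAt ℝ ∞ (σ.inChart (G y₀)) (extChartAt (𝓡 m) (G y₀) (G y₀)) :=
    (hσ.smooth (G y₀)).contDiffAt (extChartAt_target_mem_nhds _)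
  rw [(σ.pullback_eventuallyEq hs hG hy₀).extDeriv_eq,
    _root_.extDeriv_pullback (f := fun y => extChartAt (𝓡 m) (G y₀) (G y)) (hσc.differentiableAt (by simp)) hg 
      (minSmoothness_of_isRCLikeNormedField.trans_le 
        (WithTop.coe_le_coe.2 (le_top : (2 : ℕ∞) ≤ ⊤))),
    hσ.closed (G y₀) _ (mem_extChartAt_target (G y₀))]
  ext v
  simp

/-- Closedness of a 2-form, written out. -/
theorem fderiv_cyclic_of_extDeriv_eq_zero {τ : X → X [⋀^Fin 2]→L[ℝ] ℝ} {x : X}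
    (h0 : extDeriv τ x = 0) (a b c : X) :
    fderiv ℝ τ x a ![b, c] - fderiv ℝ τ x b ![a, c] + fderiv ℝ τ x c ![a, b] = 0 := by
  have h1 := congrArg (fun φ => φ ![a, b, c]) h0
  have h2 : ∀ i : Fin 3, Fin.removeNth i ![a, b, c] = ![![b, c], ![a, c], ![a, b]] i := by
    intro i
    fin_cases i <;> ext j <;> fin_cases j <;> rfl
  simp only [extDeriv, ContinuousAlternatingMap.alternatizeUncurryFin_apply, h2] at h1
  simp [Fin.sum_univ_succ] at h1
  linarith

end Pullback

/-! ### Flat coframes and their local translations. -/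

section Coframe

open Set Filter Topology

variable {n : ℕ} {F : Type*} [TopologicalSpace F] [ChartedSpace (EuclideanSpace ℝ (Fin n)) F]
  {W : Type*} [NormedAddCommGroup W] [NormedSpace ℝ W]
  {X : Type*} [NormedAddCommGroup X] [NormedSpace ℝ X]

/-- A vector valued 1-form is a flat coframe if it is locally the differential of a
diffeomorphism onto an open subset of the vector space. -/
def IsFlatCoframe (η : F → EuclideanSpace ℝ (Fin n) →L[ℝ] W) : Prop :=
  ∀ x, ∃ ψ : OpenPartialHomeomorph F W, x ∈ ψ.source ∧
    ContMDiffOn (𝓡 n) 𝓘(ℝ, W) ∞ ψ ψ.source ∧ ContMDiffOn 𝓘(ℝ, W) (𝓡 n) ∞ ψ.symm ψ.target ∧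
    ∀ y ∈ ψ.source, mfderiv (𝓡 n) 𝓘(ℝ, W) ψ y = η y

/-- The pullback of a vector valued 1-form. -/
noncomputable def pullbackForm (η : F → EuclideanSpace ℝ (Fin n) →L[ℝ] W) (k : X → F) (p : X) :
    X →L[ℝ] W :=
  (η (k p)).comp (mfderiv 𝓘(ℝ, X) (𝓡 n) k p)

theorem pullbackForm_congr {η : F → EuclideanSpace ℝ (Fin n) →L[ℝ] W} {k k' : X → F} {p : X}
    (h : k =ᶠ[𝓝 p] k') : pullbackForm η k p = pullbackForm η k' p := by
  have h1 : k p = k' p := h.self_of_nhds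
  have h2 : (mfderiv 𝓘(ℝ, X) (𝓡 n) k p : X →L[ℝ] EuclideanSpace ℝ (Fin n)) =
    mfderiv 𝓘(ℝ, X) (𝓡 n) k' p := h.mfderiv_eq
  change (η (k p)).comp (mfderiv 𝓘(ℝ, X) (𝓡 n) k p : X →L[ℝ] EuclideanSpace ℝ (Fin n)) = _
  rw [h1, h2]
  rfl

theorem pullbackForm_comp {Y : Type*} [NormedAddCommGroup Y] [NormedSpace ℝ Y]
    {η : F → EuclideanSpace ℝ (Fin n) →L[ℝ] W} {k : X → F} {g : Y → X} {p : Y}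
    {g' : Y →L[ℝ] X} (hk : MDifferentiableAt 𝓘(ℝ, X) (𝓡 n) k (g p)) (hg : HasFDerivAt g g' p) :
    pullbackForm η (fun y => k (g y)) p = (pullbackForm η k (g p)).comp g' := by
  have h : mfderiv 𝓘(ℝ, Y) (𝓡 n) (fun y => k (g y)) p =
      (mfderiv 𝓘(ℝ, X) (𝓡 n) k (g p)).comp g' :=
    (hk.hasMFDerivAt.comp p hg.hasMFDerivAt).mfderiv
  simp only [pullbackForm]
  rw [h]
  rfl

theorem hasFDerivAt_comp_pullbackForm {η : F → EuclideanSpace ℝ (Fin n) →L[ℝ] W}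
    {ψ : F → W} {k : X → F} {p : X} (hψ : MDifferentiableAt (𝓡 n) 𝓘(ℝ, W) ψ (k p))
    (hη : mfderiv (𝓡 n) 𝓘(ℝ, W) ψ (k p) = η (k p))
    (hk : MDifferentiableAt 𝓘(ℝ, X) (𝓡 n) k p) :
    HasFDerivAt (fun p => ψ (k p)) (pullbackForm η k p) p := by
  have h := hψ.hasMFDerivAt.comp p hk.hasMFDerivAt
  rw [hη] at h
  exact h.hasFDerivAt

namespace IsFlatCoframe

variable {η : F → EuclideanSpace ℝ (Fin n) →L[ℝ] W}

/-- Two maps pulling back a flat coframe to the same form agree if they agree at a point. -/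
theorem eqOn_of_pullbackForm_eq (hη : IsFlatCoframe η) [T2Space F] {s : Set X} (hs : IsOpen s)
    (hsc : IsPreconnected s) {k k' : X → F}
    (hk : MDifferentiableOn 𝓘(ℝ, X) (𝓡 n) k s) (hk' : MDifferentiableOn 𝓘(ℝ, X) (𝓡 n) k' s)
    (h : ∀ p ∈ s, pullbackForm η k p = pullbackForm η k' p) {p₀ : X} (hp₀ : p₀ ∈ s)
    (h0 : k p₀ = k' p₀) : EqOn k k' s := by
  have hkc := hk.continuousOn
  have hkc' := hk'.continuousOn
  -- Near a point of agreement both maps land in one domain of `ψ`, with `η = dψ`. There `ψ ∘ k` and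
  -- `ψ ∘ k'` have equal derivatives, and `ψ` is injective.
  have hopen : IsOpen {p | p ∈ s ∧ k p = k' p} := by
    rw [isOpen_iff_mem_nhds]
    rintro p ⟨hps, hp⟩
    obtain ⟨ψ, hxψ, hψ, -, hd⟩ := hη (k p)
    have hev : ∀ᶠ q in 𝓝 p, q ∈ s ∧ k q ∈ ψ.source ∧ k' q ∈ ψ.source := by
      refine Filter.Eventually.and (hs.mem_nhds hps) (Filter.Eventually.and ?_ ?_)
      · exact (hkc.continuousAt (hs.mem_nhds hps)).preimage_mem_nhds
          (ψ.open_source.mem_nhds hxψ)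
      · exact (hkc'.continuousAt (hs.mem_nhds hps)).preimage_mem_nhds
          (ψ.open_source.mem_nhds (hp ▸ hxψ))
    obtain ⟨r, hr, hball⟩ := Metric.eventually_nhds_iff_ball.1 hev
    have hder : ∀ q ∈ Metric.ball p r, HasFDerivAt (fun p => ψ (k p)) (pullbackForm η k q) q :=
      fun q hq => hasFDerivAt_comp_pullbackForm
        ((hψ.contMDiffAt (ψ.open_source.mem_nhds (hball q hq).2.1)).mdifferentiableAt (by simp))
        (hd _ (hball q hq).2.1) (hk.mdifferentiableAt (hs.mem_nhds (hball q hq).1))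
    have hder' : ∀ q ∈ Metric.ball p r,
        HasFDerivAt (fun p => ψ (k' p)) (pullbackForm η k' q) q :=
      fun q hq => hasFDerivAt_comp_pullbackForm
        ((hψ.contMDiffAt (ψ.open_source.mem_nhds (hball q hq).2.2)).mdifferentiableAt (by simp))
        (hd _ (hball q hq).2.2) (hk'.mdifferentiableAt (hs.mem_nhds (hball q hq).1))
    have heq : EqOn (fun p => ψ (k p)) (fun p => ψ (k' p)) (Metric.ball p r) := by
      refine Metric.isOpen_ball.eqOn_of_fderiv_eq (𝕜 := ℝ) (convex_ball p r).isPreconnected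
        (fun q hq => (hder q hq).differentiableAt.differentiableWithinAt)
        (fun q hq => (hder' q hq).differentiableAt.differentiableWithinAt) (fun q hq => ?_)
        (Metric.mem_ball_self hr) (congrArg ψ hp)
      rw [(hder q hq).fderiv, (hder' q hq).fderiv, h q (hball q hq).1]
    filter_upwards [Metric.ball_mem_nhds p hr] with q hq
    exact ⟨(hball q hq).1, ψ.injOn (hball q hq).2.1 (hball q hq).2.2 (heq hq)⟩
  have hsub := hsc.subset_of_closure_inter_subset hopen ⟨p₀, hp₀, hp₀, h0⟩ ?_
  · exact fun p hp => (hsub hp).2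
  · rintro p ⟨hpc, hps⟩
    refine ⟨hps, ?_⟩
    -- The coincidence set is also closed in `s`, since limits in `F` are unique.
    have : (𝓝[{p | p ∈ s ∧ k p = k' p}] p).NeBot := mem_closure_iff_nhdsWithin_neBot.1 hpc
    have hle : 𝓝[{p | p ∈ s ∧ k p = k' p}] p ≤ 𝓝 p := nhdsWithin_le_nhds
    have h1 := (hkc.continuousAt (hs.mem_nhds hps)).tendsto.mono_left hle
    have h2 := (hkc'.continuousAt (hs.mem_nhds hps)).tendsto.mono_left hle
    refine tendsto_nhds_unique (h1.congr' ?_) h2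
    filter_upwards [self_mem_nhdsWithin] with q hq using hq.2

/-- A local parametrization around `y` which pulls the coframe back to the identity. -/
structure IsSection (η : F → EuclideanSpace ℝ (Fin n) →L[ℝ] W) (ε : ℝ) (y : F) (s : W → F) :
    Prop where
  map_zero : s 0 = y
  contMDiffOn : ContMDiffOn 𝓘(ℝ, W) (𝓡 n) ∞ s (Metric.ball 0 ε)
  pullback : ∀ v ∈ Metric.ball (0 : W) ε, pullbackForm η s v = ContinuousLinearMap.id ℝ W
  injOn : InjOn s (Metric.ball 0 ε)
  nhds_le : 𝓝 y ≤ map s (𝓝 0)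

theorem IsSection.mono {ε ε' : ℝ} {y : F} {s : W → F} (h : IsSection η ε y s) (hε : ε' ≤ ε) :
    IsSection η ε' y s :=
  ⟨h.map_zero, h.contMDiffOn.mono (Metric.ball_subset_ball hε),
    fun v hv => h.pullback v (Metric.ball_subset_ball hε hv),
    h.injOn.mono (Metric.ball_subset_ball hε), h.nhds_le⟩

/-- In the coordinates `ψ` with `dψ = η` a section is the translation `v ↦ ψ y + v`. For `y` within
`r / 2` of the centre, translations of length below `r / 2` stay in the target, so one radius serves
all nearby `y`. -/
theorem exists_isSection_nhds (hη : IsFlatCoframe η) (x : F) :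
    ∃ t ∈ 𝓝 x, ∃ ε > 0, ∀ y ∈ t, ∃ s, IsSection η ε y s := by
  obtain ⟨ψ, hxψ, hψ, hψs, hd⟩ := hη x
  obtain ⟨r, hr, hball⟩ := Metric.isOpen_iff.1 ψ.open_target _ (ψ.map_source hxψ)
  refine ⟨ψ.source ∩ ψ ⁻¹' Metric.ball (ψ x) (r / 2), (ψ.continuousOn.isOpen_inter_preimage
    ψ.open_source Metric.isOpen_ball).mem_nhds ⟨hxψ, Metric.mem_ball_self (half_pos hr)⟩, r / 2,
    half_pos hr, ?_⟩
  rintro y ⟨hyψ, hy⟩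
  have hmem : ∀ v ∈ Metric.ball (0 : W) (r / 2), ψ y + v ∈ ψ.target := by
    intro v hv
    refine hball ?_
    rw [mem_ball_zero_iff] at hv
    rw [mem_preimage, mem_ball_iff_norm] at hy
    rw [mem_ball_iff_norm]
    calc ‖ψ y + v - ψ x‖ = ‖(ψ y - ψ x) + v‖ := by congr 1; abel
      _ ≤ ‖ψ y - ψ x‖ + ‖v‖ := norm_add_le _ _
      _ < r := by linarith
  have hsm : ContMDiffOn 𝓘(ℝ, W) (𝓡 n) ∞ (fun v => ψ.symm (ψ y + v))
      (Metric.ball 0 (r / 2)) :=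
    hψs.comp (contMDiff_iff_contDiff.2 (by fun_prop)).contMDiffOn hmem
  refine ⟨fun v => ψ.symm (ψ y + v), ?_, hsm, ?_, ?_, ?_⟩
  · simp [ψ.left_inv hyψ]
  · intro v hv
    have hsrc : ψ.symm (ψ y + v) ∈ ψ.source := ψ.map_target (hmem v hv)
    have h1 := hasFDerivAt_comp_pullbackForm (k := fun v => ψ.symm (ψ y + v)) (p := v)
      ((hψ.contMDiffAt (ψ.open_source.mem_nhds hsrc)).mdifferentiableAt (by simp)) (hd _ hsrc)
      ((hsm.contMDiffAt (Metric.isOpen_ball.mem_nhds hv)).mdifferentiableAt (by simp))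
    have h2 : (fun v => ψ (ψ.symm (ψ y + v))) =ᶠ[𝓝 v] fun v => ψ y + v := by
      filter_upwards [Metric.isOpen_ball.mem_nhds hv] with w hw
      exact ψ.right_inv (hmem w hw)
    exact (h1.congr_of_eventuallyEq h2.symm).unique ((hasFDerivAt_id v).const_add (ψ y))
  · intro v hv w hw h
    exact add_left_cancel (ψ.symm.injOn (hmem v hv) (hmem w hw) h)
  · have h1 : map ψ.symm (𝓝 (ψ y)) = 𝓝 y := by
      rw [ψ.symm.map_nhds_eq (ψ.map_source hyψ), ψ.left_inv hyψ]
    have h2 : map (fun v => ψ y + v) (𝓝 0) = 𝓝 (ψ y) := by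
      simp
    rw [← h1, ← h2, map_map]
    rfl

/-- The radius is locally uniform, and passes to finite unions by taking minima; compactness makes
it global. -/
theorem exists_forall_isSection [CompactSpace F] (hη : IsFlatCoframe η) :
    ∃ ε > 0, ∀ y, ∃ s, IsSection η ε y s := by
  have := isCompact_univ.induction_on (X := F) (p := fun t => ∃ ε > 0, ∀ y ∈ t, ∃ s, IsSection η ε y s)
    ⟨1, one_pos, by simp⟩
    (fun s t hst ⟨ε, hε, h⟩ => ⟨ε, hε, fun y hy => h y (hst hy)⟩)
    (fun s t ⟨ε, hε, h⟩ ⟨ε', hε', h'⟩ => ⟨min ε ε', lt_min hε hε', fun y hy =>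
      hy.elim (fun hy => (h y hy).imp fun _ hs => hs.mono (min_le_left _ _))
        (fun hy => (h' y hy).imp fun _ hs => hs.mono (min_le_right _ _))⟩)
    (fun x _ => by
      obtain ⟨t, ht, h⟩ := exists_isSection_nhds hη x
      exact ⟨t, mem_nhdsWithin_of_mem_nhds ht, h⟩)
  simpa using this

/-- The local group law satisfied by sections of a flat coframe. -/
theorem isSection_add [T2Space F] (hη : IsFlatCoframe η) {ε : ℝ} {s : F → W → F}
    (hs : ∀ y, IsSection η ε y (s y)) (y : F) {v w : W} (hv : ‖v‖ < ε) (hw : ‖w‖ < ε)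
    (hvw : ‖v + w‖ < ε) : s (s y v) w = s y (v + w) := by
  have hε : 0 < ε := (norm_nonneg v).trans_lt hv
  -- Both sides, as functions of `w`, start at `s y v` and pull `η` back to the identity on this
  -- convex set, so uniqueness applies.
  set U : Set W := Metric.ball 0 ε ∩ (fun t => v + t) ⁻¹' Metric.ball 0 ε with hU
  have hUo : IsOpen U := Metric.isOpen_ball.inter (Metric.isOpen_ball.preimage (by fun_prop))
  have hUc : Convex ℝ U :=
    (convex_ball 0 ε).inter ((convex_ball (0 : W) ε).translate_preimage_right v)
  have hshift : ContMDiffOn 𝓘(ℝ, W) (𝓡 n) ∞ (fun t => s y (v + t)) U :=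
    (hs y).contMDiffOn.comp (contMDiff_iff_contDiff.2 (by fun_prop)).contMDiffOn fun t ht => ht.2
  have h := hη.eqOn_of_pullbackForm_eq (k := s (s y v)) (k' := fun t => s y (v + t)) hUo
    hUc.isPreconnected
    (((hs _).contMDiffOn.mono inter_subset_left).mdifferentiableOn (by simp))
    (hshift.mdifferentiableOn (by simp)) (fun t ht => ?_) (p₀ := 0) (by simpa [hU, hε] using hv)
    (by simp [(hs _).map_zero])
  · exact h (show w ∈ U from ⟨mem_ball_zero_iff.2 hw, mem_ball_zero_iff.2 hvw⟩)
  · rw [(hs _).pullback t ht.1, pullbackForm_comp (g := fun t => v + t)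
      (g' := ContinuousLinearMap.id ℝ W) _ ((hasFDerivAt_id t).const_add v),
      (hs y).pullback _ ht.2]
    · rfl
    · exact ((hs y).contMDiffOn.contMDiffAt
        (Metric.isOpen_ball.mem_nhds ht.2)).mdifferentiableAt (by simp)

end IsFlatCoframe

end Coframe

/-! ### The action of the vector space and its period lattice. -/

section CoframeAction

open Set Filter Topology

variable {n : ℕ} {F : Type*} [TopologicalSpace F] [ChartedSpace (EuclideanSpace ℝ (Fin n)) F]
  {W : Type*} [NormedAddCommGroup W] [NormedSpace ℝ W]
  {η : F → EuclideanSpace ℝ (Fin n) →L[ℝ] W}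

/-- An action of `W` on `F` whose orbit maps pull the coframe `η` back to the identity. -/
structure IsCoframeAction (η : F → EuclideanSpace ℝ (Fin n) →L[ℝ] W) (act : W → F → F) :
    Prop where
  zero_act : ∀ y, act 0 y = y
  add_act : ∀ v w y, act (v + w) y = act w (act v y)
  contMDiff : ∀ y, ContMDiff 𝓘(ℝ, W) (𝓡 n) ∞ fun v => act v y
  pullback : ∀ y v, pullbackForm η (fun v => act v y) v = ContinuousLinearMap.id ℝ W
  isOpenMap : ∀ y, IsOpenMap fun v => act v y
  free : ∃ ε > 0, ∀ y v, ‖v‖ < ε → act v y = y → v = 0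

/-- A local additive action of a ball extends to a global action. -/
theorem exists_global_action {F : Type*} {ε : ℝ} (hε : 0 < ε) {s : F → W → F} (h0 : ∀ y, s y 0 = y)
    (hadd : ∀ y v w, ‖v‖ < ε → ‖w‖ < ε → ‖v + w‖ < ε → s (s y v) w = s y (v + w)) :
    ∃ act : W → F → F, (∀ y v, ‖v‖ < ε → act v y = s y v) ∧
      ∀ v w y, act (v + w) y = act w (act v y) := by
  have hiter : ∀ (v : W) (j : ℕ), ‖v‖ < ε → ‖(j : ℝ) • v‖ < ε →
      ∀ y, (fun y => s y v)^[j] y = s y ((j : ℝ) • v) := by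
    intro v j hv
    induction j with
    | zero => intro _ y; simp [h0]
    | succ j ih =>
      intro hj y
      have hj' : ‖(j : ℝ) • v‖ < ε := by
        refine lt_of_le_of_lt ?_ hj
        rw [norm_smul, norm_smul]
        gcongr
        simp only [Real.norm_natCast]
        push_cast
        linarith
      have hsum : (j : ℝ) • v + v = ((j + 1 : ℕ) : ℝ) • v := by push_cast; module
      rw [Function.iterate_succ_apply', ih hj' y, hadd y _ _ hj' hv (by rwa [hsum]), hsum]
  -- Moving by `v` in `k` small steps gives the same result as in `k * l` steps; two step counts are
  -- then compared through their product.
  have hrefine : ∀ (v : W) (k l : ℕ), ‖v‖ < k * ε → 0 < l → ∀ y,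
      (fun y => s y ((k * l : ℝ)⁻¹ • v))^[k * l] y = (fun y => s y ((k : ℝ)⁻¹ • v))^[k] y := by
    intro v k l hk hl y
    have hk0 : (0 : ℝ) < k := by
      rcases Nat.eq_zero_or_pos k with rfl | h
      · simp at hk
        exact absurd hk (not_lt.2 (norm_nonneg v))
      · exact_mod_cast h
    have hl0 : (1 : ℝ) ≤ l := by exact_mod_cast hl
    have hkv : ‖(k : ℝ)⁻¹ • v‖ < ε := by
      rw [norm_smul, norm_inv, Real.norm_natCast, inv_mul_lt_iff₀ hk0]
      exact hk
    have hlv : (l : ℝ) • ((k * l : ℝ)⁻¹ • v) = (k : ℝ)⁻¹ • v := by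
      rw [smul_smul]
      congr 1
      field_simp
    have hklv : ‖(k * l : ℝ)⁻¹ • v‖ < ε := by
      refine lt_of_le_of_lt ?_ hkv
      rw [← hlv, norm_smul (l : ℝ), Real.norm_natCast]
      exact le_mul_of_one_le_left (norm_nonneg _) hl0
    have : (fun y => s y ((k * l : ℝ)⁻¹ • v))^[l] = fun y => s y ((k : ℝ)⁻¹ • v) := by
      funext y
      rw [hiter _ l hklv (by rwa [hlv]), hlv]
    rw [mul_comm k l, Function.iterate_mul, this]
  -- A step count for which each step is shorter than `ε`; the added one makes the bound strict.
  set K : W → ℕ := fun v => ⌊‖v‖ / ε⌋₊ + 1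
  have hK : ∀ v, ‖v‖ < K v * ε := by
    intro v
    rw [← div_lt_iff₀ hε]
    simpa [K] using Nat.lt_floor_add_one (‖v‖ / ε)
  have hact : ∀ (v : W) (k : ℕ), ‖v‖ < k * ε → ∀ y,
      (fun y => s y ((K v : ℝ)⁻¹ • v))^[K v] y = (fun y => s y ((k : ℝ)⁻¹ • v))^[k] y := by
    intro v k hk y
    have hk0 : 0 < k := by
      rcases Nat.eq_zero_or_pos k with rfl | h
      · simp at hk
        exact absurd hk (not_lt.2 (norm_nonneg v))
      · exact h
    rw [← hrefine v (K v) k (hK v) hk0, ← hrefine v k (K v) hk (Nat.succ_pos _), mul_comm (K v) k,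
      mul_comm (K v : ℝ)]
  refine ⟨fun v => (fun y => s y ((K v : ℝ)⁻¹ • v))^[K v], fun y v hv => ?_, fun v w y => ?_⟩
  · have := hact v 1 (by simpa using hv) y
    simpa using this
  -- One step count fine enough for `v`, `w` and `v + w` at once; the small steps commute, so the
  -- iterates can be regrouped.
  · obtain ⟨k, hk⟩ := exists_nat_gt ((‖v‖ + ‖w‖) / ε)
    rw [div_lt_iff₀ hε] at hk
    have hk0 : (0 : ℝ) < k := by
      by_contra h
      have : (k : ℝ) * ε ≤ 0 := mul_nonpos_of_nonpos_of_nonneg (not_lt.1 h) hε.le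
      linarith [norm_nonneg v, norm_nonneg w]
    have hv : ‖v‖ < k * ε := by linarith [norm_nonneg w]
    have hw : ‖w‖ < k * ε := by linarith [norm_nonneg v]
    have hvw : ‖v + w‖ < k * ε := (norm_add_le v w).trans_lt hk
    have hsm : ∀ u : W, ‖u‖ < k * ε → ‖(k : ℝ)⁻¹ • u‖ < ε := fun u hu => by
      rw [norm_smul, norm_inv, Real.norm_natCast, inv_mul_lt_iff₀ hk0]
      exact hu
    have hsum : ‖(k : ℝ)⁻¹ • v + (k : ℝ)⁻¹ • w‖ < ε := by
      rw [← smul_add]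
      exact hsm _ hvw
    beta_reduce
    rw [hact _ k hvw, hact v k hv, hact w k hw]
    have hcomp : (fun y => s y ((k : ℝ)⁻¹ • (v + w))) =
        (fun y => s y ((k : ℝ)⁻¹ • w)) ∘ fun y => s y ((k : ℝ)⁻¹ • v) := by
      funext y
      rw [Function.comp_apply, hadd y _ _ (hsm v hv) (hsm w hw) hsum, smul_add]
    have hcomm : Function.Commute (fun y => s y ((k : ℝ)⁻¹ • w))
        fun y => s y ((k : ℝ)⁻¹ • v) := by
      intro y
      beta_reduce
      rw [hadd y _ _ (hsm v hv) (hsm w hw) hsum,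
        hadd y _ _ (hsm w hw) (hsm v hv) (by rwa [add_comm]), add_comm]
    rw [hcomp, hcomm.comp_iterate, Function.comp_apply]

theorem IsFlatCoframe.exists_isCoframeAction [CompactSpace F] [T2Space F]
    (hη : IsFlatCoframe η) : ∃ act, IsCoframeAction η act := by
  obtain ⟨ε, hε, h⟩ := hη.exists_forall_isSection
  choose s hs using h
  obtain ⟨act, hact, hadd⟩ := exists_global_action hε (fun y => (hs y).map_zero)
    (fun y v w => hη.isSection_add hs y)
  -- Near any `v` the orbit map is a translated section, so all its local properties reduce to those
  -- of a section at `0`.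
  have hloc : ∀ y v, (fun w => act w y) =ᶠ[𝓝 v] fun w => s (act v y) (w - v) := by
    intro y v
    filter_upwards [Metric.ball_mem_nhds v hε] with w hw
    rw [mem_ball_iff_norm] at hw
    rw [← hact _ _ hw, ← hadd, add_sub_cancel]
  have hsm : ∀ y v, ContMDiffAt 𝓘(ℝ, W) (𝓡 n) ∞ (s y) (v - v) := fun y v =>
    (hs y).contMDiffOn.contMDiffAt (Metric.isOpen_ball.mem_nhds (by simpa using hε))
  refine ⟨act, fun y => ?_, hadd, fun y v => ?_, fun y v => ?_, fun y => ?_, ε, hε, ?_⟩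
  · rw [hact y 0 (by simpa using hε), (hs y).map_zero]
  · refine ContMDiffAt.congr_of_eventuallyEq ?_ (hloc y v)
    exact ContMDiffAt.comp (f := fun w => w - v) v (hsm (act v y) v)
      (contMDiff_iff_contDiff.2 (by fun_prop)).contMDiffAt
  · rw [pullbackForm_congr (hloc y v), pullbackForm_comp (g := fun w => w - v)
      ((hsm _ v).mdifferentiableAt (by simp)) ((hasFDerivAt_id v).sub_const v),
      (hs _).pullback _ (by simpa using hε)]
    rfl
  · refine isOpenMap_iff_nhds_le.2 fun v => ?_
    rw [map_congr (hloc y v)]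
    refine (hs (act v y)).nhds_le.trans_eq ?_
    have h2 : map (fun w => w - v) (𝓝 v) = 𝓝 0 := by
      simp [sub_eq_add_neg]
    rw [← h2, map_map]
    rfl
  · intro y v hv hvy
    rw [hact y v hv] at hvy
    exact (hs y).injOn (by simpa using hv) (by simpa using hε) (hvy.trans (hs y).map_zero.symm)

namespace IsCoframeAction

variable {act : W → F → F}

/-- Every orbit is open, and the complement of an orbit is a union of orbits, hence open as well. -/
theorem surjective (h : IsCoframeAction η act) [ConnectedSpace F] (y : F) :
    Function.Surjective fun v => act v y := by
  rw [← range_eq_univ]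
  refine IsClopen.eq_univ ⟨?_, (h.isOpenMap y).isOpen_range⟩ (range_nonempty _)
  rw [← isOpen_compl_iff, isOpen_iff_mem_nhds]
  intro x hx
  have : range (fun v => act v x) ∈ 𝓝 x :=
    (h.isOpenMap x).isOpen_range.mem_nhds ⟨0, h.zero_act x⟩
  filter_upwards [this]
  rintro _ ⟨v, rfl⟩ ⟨w, hw⟩
  refine hx ⟨w - v, ?_⟩
  beta_reduce at hw ⊢
  rw [sub_eq_add_neg, h.add_act, hw, ← h.add_act, add_neg_cancel, h.zero_act]

theorem act_eq_iff (h : IsCoframeAction η act) (v w : W) (y : F) :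
    act v y = act w y ↔ act (v - w) y = y := by
  constructor
  · intro hvw
    rw [sub_eq_add_neg, h.add_act, hvw, ← h.add_act, add_neg_cancel, h.zero_act]
  · intro hvw
    rw [← sub_add_cancel v w, h.add_act, hvw]

/-- The acting group is abelian and transitive, so all stabilizers coincide. -/
theorem act_eq_self_iff (h : IsCoframeAction η act) [ConnectedSpace F] (v : W) (y y' : F) :
    act v y = y ↔ act v y' = y' := by
  suffices ∀ y y', act v y = y → act v y' = y' from ⟨this y y', this y' y⟩
  intro y y' hy
  obtain ⟨w, rfl⟩ := h.surjective y y'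
  beta_reduce
  rw [← h.add_act, add_comm, h.add_act, hy]

/-- The stabilizer of a point, as a `ℤ`-submodule. -/
def stabilizer (h : IsCoframeAction η act) (y : F) : Submodule ℤ W :=
  AddSubgroup.toIntSubmodule
    { carrier := {v | act v y = y}
      add_mem' := fun {v w} hv hw => by
        rw [Set.mem_ofPred_eq] at *
        rw [h.add_act, hv, hw]
      zero_mem' := h.zero_act y
      neg_mem' := fun {v} hv => by
        rw [Set.mem_ofPred_eq] at *
        nth_rw 1 [← hv]
        rw [← h.add_act, add_neg_cancel, h.zero_act] }

theorem mem_stabilizer (h : IsCoframeAction η act) {y : F} {v : W} :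
    v ∈ h.stabilizer y ↔ act v y = y := Iff.rfl

instance discreteTopology_stabilizer (h : IsCoframeAction η act) (y : F) :
    DiscreteTopology (h.stabilizer y) := by
  obtain ⟨ε, hε, hfree⟩ := h.free
  refine discreteTopology_of_isOpen_singleton_zero ?_
  rw [Metric.isOpen_singleton_iff]
  refine ⟨ε, hε, fun v hv => Subtype.ext (hfree y v ?_ v.2)⟩
  rw [dist_zero_right] at hv
  exact hv

/-- The images of the balls around `0` under the orbit map form an increasing open cover of the
compact fibre, so one ball already covers it. -/
theorem exists_bounded_representative (h : IsCoframeAction η act) [CompactSpace F]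
    [ConnectedSpace F] (y : F) : ∃ R : ℝ, ∀ v, ∃ w, ‖w‖ < R ∧ v - w ∈ h.stabilizer y := by
  obtain ⟨R, hR⟩ := isCompact_univ.elim_directed_cover
    (fun R : ℕ => (fun v => act v y) '' Metric.ball 0 (R : ℝ))
    (fun R => h.isOpenMap y _ Metric.isOpen_ball) (fun x _ => by
      obtain ⟨v, rfl⟩ := h.surjective y x
      obtain ⟨R, hR⟩ := exists_nat_gt ‖v‖
      exact mem_iUnion.2 ⟨R, v, by simpa using hR, rfl⟩)
    (Monotone.directed_le fun R R' hRR' => image_mono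
      (Metric.ball_subset_ball (by exact_mod_cast hRR')))
  refine ⟨R, fun v => ?_⟩
  obtain ⟨w, hw, hwv⟩ := hR (mem_univ (act v y))
  exact ⟨w, by simpa using hw, (h.act_eq_iff v w y).1 hwv.symm⟩

/-- If the lattice did not span, a nonzero functional would vanish on it. Its values would then be
determined by representatives in a bounded set, hence bounded, which fails on large multiples of one
vector. -/
instance isZLattice_stabilizer (h : IsCoframeAction η act) [FiniteDimensional ℝ W]
    [CompactSpace F] [ConnectedSpace F] (y : F) : IsZLattice ℝ (h.stabilizer y) := by
  refine ⟨?_⟩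
  by_contra hne
  obtain ⟨R, hR⟩ := h.exists_bounded_representative y
  obtain ⟨f, hf0, hf⟩ := Submodule.exists_le_ker_of_lt_top _ (lt_top_iff_ne_top.2 hne)
  obtain ⟨v, hv⟩ : ∃ v, f v ≠ 0 := by
    by_contra! hall
    exact hf0 (LinearMap.ext hall)
  set g : W →L[ℝ] ℝ := LinearMap.toContinuousLinearMap f
  obtain ⟨N, hN⟩ := exists_nat_gt (‖g‖ * R / |f v|)
  obtain ⟨w, hw, hmem⟩ := hR ((N : ℝ) • v)
  have h1 : f ((N : ℝ) • v - w) = 0 := hf (Submodule.subset_span hmem)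
  rw [map_sub, map_smul, sub_eq_zero] at h1
  have h2 : |f w| ≤ ‖g‖ * R := (g.le_opNorm w).trans (by gcongr)
  rw [← h1, smul_eq_mul, abs_mul, Nat.abs_cast] at h2
  rw [div_lt_iff₀ (abs_pos.2 hv)] at hN
  linarith

theorem exists_basis (h : IsCoframeAction η act) [FiniteDimensional ℝ W] [CompactSpace F]
    [ConnectedSpace F] (hn : Module.finrank ℝ W = n) (y : F) :
    ∃ b : Module.Basis (Fin n) ℝ W, Submodule.span ℤ (range b) = h.stabilizer y := by
  have := ZLattice.module_free ℝ (h.stabilizer y)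
  have := ZLattice.module_finite ℝ (h.stabilizer y)
  let b := (Module.finBasisOfFinrankEq ℤ (h.stabilizer y) ((ZLattice.rank ℝ _).trans hn))
  exact ⟨b.ofZLatticeBasis ℝ, b.ofZLatticeBasis_span ℝ⟩

end IsCoframeAction

end CoframeAction

/-! ### Comparing the period lattices of two coframes on one fibre. -/

section Comparison

open Set Filter Topology

variable {n : ℕ} {F : Type*} [TopologicalSpace F] [ChartedSpace (EuclideanSpace ℝ (Fin n)) F]
  [T2Space F] {W : Type*} [NormedAddCommGroup W] [NormedSpace ℝ W]
  {η η' : F → EuclideanSpace ℝ (Fin n) →L[ℝ] W} {act act' : W → F → F}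

namespace IsCoframeAction

omit [T2Space F] in
theorem mdifferentiable (h : IsCoframeAction η act) (y : F) :
    MDifferentiable 𝓘(ℝ, W) (𝓡 n) fun v => act v y :=
  (h.contMDiff y).mdifferentiable (by simp)

/-- A primitive of the pullback of `η'` intertwines the orbit maps for `η` and `η'`. -/
theorem act_primitive (h : IsCoframeAction η act) (h' : IsCoframeAction η' act')
    (hη' : IsFlatCoframe η') {y : F} {g : W → W} (hg0 : g 0 = 0)
    (hg : ∀ v, HasFDerivAt g (pullbackForm η' (fun v => act v y) v) v) (v : W) :
    act' (g v) y = act v y := by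
  have hgd : Differentiable ℝ g := fun v => (hg v).differentiableAt
  refine hη'.eqOn_of_pullbackForm_eq (k := fun v => act' (g v) y) (k' := fun v => act v y)
    isOpen_univ isPreconnected_univ ?_ ?_ (fun p _ => ?_) (mem_univ 0) ?_ (mem_univ v)
  · exact ((h'.mdifferentiable y).comp hgd.mdifferentiable).mdifferentiableOn
  · exact (h.mdifferentiable y).mdifferentiableOn
  · rw [pullbackForm_comp (h'.mdifferentiable y (g p)) (hg p), h'.pullback,
      ContinuousLinearMap.id_comp]
  · rw [hg0, h'.zero_act, h.zero_act]

/-- The composite leaves the orbit map unchanged. Pulling `η` back along it shows that its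
derivative is the identity, and it fixes `0`. -/
theorem primitive_leftInverse (h : IsCoframeAction η act) (h' : IsCoframeAction η' act')
    (hη : IsFlatCoframe η) (hη' : IsFlatCoframe η') {y : F} {g g' : W → W} (hg0 : g 0 = 0)
    (hg : ∀ v, HasFDerivAt g (pullbackForm η' (fun v => act v y) v) v) (hg0' : g' 0 = 0)
    (hg' : ∀ v, HasFDerivAt g' (pullbackForm η (fun v => act' v y) v) v) (v : W) :
    g' (g v) = v := by
  have hcomp : ∀ v, act (g' (g v)) y = act v y := fun v => by
    rw [h'.act_primitive h hη hg0' hg', h.act_primitive h' hη' hg0 hg]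
  have hder : ∀ v, HasFDerivAt (fun v => g' (g v)) (ContinuousLinearMap.id ℝ W) v := by
    intro v
    have h1 := (hg' (g v)).comp v (hg v)
    have h2 := pullbackForm_comp (η := η) (g := g' ∘ g) (h.mdifferentiable y (g' (g v))) h1
    rw [h.pullback, ContinuousLinearMap.id_comp] at h2
    have h3 : pullbackForm η (fun v => act (g' (g v)) y) v = ContinuousLinearMap.id ℝ W := by
      rw [funext hcomp, h.pullback]
    change HasFDerivAt (g' ∘ g) _ v
    rw [← h3]
    exact h2 ▸ h1
  have := isOpen_univ.eqOn_of_fderiv_eq (𝕜 := ℝ) isPreconnected_univ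
    (f := fun v => g' (g v)) (g := id)
    (fun v _ => (hder v).differentiableAt.differentiableWithinAt) differentiableOn_id
    (fun v _ => by rw [(hder v).fderiv, fderiv_id]) (mem_univ 0) (by simp [hg0, hg0'])
  exact this (mem_univ v)

omit [T2Space F] in
-- Translation by a period `l` does not change the orbit map, so `v ↦ g (v + l) - g l` and `g` have
-- the same derivative and the same value at `0`.
theorem primitive_add (h : IsCoframeAction η act) {y : F} {g : W → W} (hg0 : g 0 = 0)
    (hg : ∀ v, HasFDerivAt g (pullbackForm η' (fun v => act v y) v) v) {l : W}
    (hl : act l y = y) (v : W) : g (v + l) = g v + g l := by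
  have hder : ∀ v, HasFDerivAt (fun v => g (v + l) - g l)
      (pullbackForm η' (fun v => act v y) v) v := by
    intro v
    have h1 : HasFDerivAt (fun v => v + l) (ContinuousLinearMap.id ℝ W) v :=
      (hasFDerivAt_id v).add_const l
    have h2 := ((hg (v + l)).comp v h1).sub_const (g l)
    rw [← pullbackForm_comp (g := fun v => v + l) (h.mdifferentiable y (v + l)) h1] at h2
    have h3 : (fun v => act (v + l) y) = fun v => act v y := by
      funext v
      rw [add_comm, h.add_act, hl]
    rwa [h3] at h2
  have := isOpen_univ.eqOn_of_fderiv_eq (𝕜 := ℝ) isPreconnected_univ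
    (f := fun v => g (v + l) - g l) (g := g)
    (fun v _ => (hder v).differentiableAt.differentiableWithinAt)
    (fun v _ => (hg v).differentiableAt.differentiableWithinAt)
    (fun v _ => by rw [(hder v).fderiv, (hg v).fderiv]) (mem_univ 0) (by simp [hg0])
  exact sub_eq_iff_eq_add.1 (this (mem_univ v))

/-- A primitive of the pullback of `η'` transports `ℤ`-generators of the period lattice of `η` to
`ℤ`-generators of the period lattice of `η'`. -/
theorem span_primitive (h : IsCoframeAction η act) (h' : IsCoframeAction η' act')
    (hη : IsFlatCoframe η) (hη' : IsFlatCoframe η') {y : F} {g g' : W → W} (hg0 : g 0 = 0)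
    (hg : ∀ v, HasFDerivAt g (pullbackForm η' (fun v => act v y) v) v) (hg0' : g' 0 = 0)
    (hg' : ∀ v, HasFDerivAt g' (pullbackForm η (fun v => act' v y) v) v)
    {ι : Type*} {b : ι → W} (hb : Submodule.span ℤ (range b) = h.stabilizer y) :
    Submodule.span ℤ (range fun i => g (b i)) = h'.stabilizer y := by
  have hmaps : ∀ v, act' (g v) y = act v y := h.act_primitive h' hη' hg0 hg
  let f : h.stabilizer y →+ W := AddMonoidHom.mk' (fun v => g v) fun v w =>
    h.primitive_add hg0 hg w.2 v
  have hbmem : ∀ i, b i ∈ h.stabilizer y := fun i => hb ▸ Submodule.subset_span ⟨i, rfl⟩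
  apply le_antisymm
  · rw [Submodule.span_le]
    rintro _ ⟨i, rfl⟩
    exact (hmaps (b i)).trans (hbmem i)
  -- A period `w` of `η'` is `g` of the period `g' w` of `η`, and `g` is additive on periods, so
  -- integer combinations are carried along.
  · intro w hw
    have hw' : g' w ∈ h.stabilizer y := (h'.act_primitive h hη hg0' hg' w).trans hw
    rw [← h'.primitive_leftInverse h hη' hη hg0' hg' hg0 hg w]
    have hspan : ∀ v : h.stabilizer y, v ∈ Submodule.span ℤ (range fun i =>
        (⟨b i, hbmem i⟩ : h.stabilizer y)) := by
      intro v
      have : (v : W) ∈ (Submodule.span ℤ (range fun i =>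
          (⟨b i, hbmem i⟩ : h.stabilizer y))).map (h.stabilizer y).subtype := by
        rw [Submodule.map_span, ← range_comp]
        exact hb.ge v.2
      obtain ⟨v', hv', hvv⟩ := this
      rwa [← Subtype.ext hvv]
    have hle : (Submodule.span ℤ (range fun i => (⟨b i, hbmem i⟩ : h.stabilizer y))).map
        f.toIntLinearMap ≤ Submodule.span ℤ (range fun i => g (b i)) := by
      rw [Submodule.map_span, ← range_comp]
      rfl
    exact hle ⟨⟨g' w, hw'⟩, hspan _, rfl⟩

end IsCoframeAction

end Comparison

/-! ### The inverse function theorem. -/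

section InverseFunction

open Set Filter Topology

variable {X Y : Type*} [NormedAddCommGroup X] [NormedSpace ℝ X] [CompleteSpace X]
  [NormedAddCommGroup Y] [NormedSpace ℝ Y] [CompleteSpace Y]

/-- The inverse function theorem, with smoothness of the local inverse on all of its domain. -/
theorem exists_openPartialHomeomorph_of_bijective {s : Set X} (hs : IsOpen s) {g : X → Y}
    {g' : X → X →L[ℝ] Y} (hg' : ContDiffOn ℝ ∞ g' s) (hg : ∀ x ∈ s, HasFDerivAt g (g' x) x)
    (hbij : ∀ x ∈ s, Function.Bijective (g' x)) {x₀ : X} (hx₀ : x₀ ∈ s) :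
    ∃ G : OpenPartialHomeomorph X Y, x₀ ∈ G.source ∧ G.source ⊆ s ∧ ⇑G = g ∧
      ContDiffOn ℝ ∞ G G.source ∧ ContDiffOn ℝ ∞ G.symm G.target := by
  have hgs : ContDiffOn ℝ ∞ g s := by
    rw [contDiffOn_infty_iff_fderiv_of_isOpen hs]
    exact ⟨fun x hx => (hg x hx).differentiableAt.differentiableWithinAt,
      hg'.congr fun x hx => (hg x hx).fderiv⟩
  let L : ∀ x ∈ s, X ≃L[ℝ] Y := fun x hx => ContinuousLinearEquiv.ofBijective (g' x)
    (LinearMap.ker_eq_bot.2 (hbij x hx).1) (LinearMap.range_eq_top.2 (hbij x hx).2)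
  have hL : ∀ x (hx : x ∈ s), HasFDerivAt g (L x hx : X →L[ℝ] Y) x := fun x hx => by
    exact hg x hx
  let G₀ := (hgs.contDiffAt (hs.mem_nhds hx₀)).toOpenPartialHomeomorph g (hL x₀ hx₀) (by simp)
  let G := G₀.restrOpen s hs
  have hsrc : G.source ⊆ s := fun x hx => hx.2
  refine ⟨G, ⟨(hgs.contDiffAt (hs.mem_nhds hx₀)).mem_toOpenPartialHomeomorph_source (hL x₀ hx₀)
    (by simp), hx₀⟩, hsrc, rfl,
    hgs.mono hsrc, fun y hy => ?_⟩
  have hmem : G.symm y ∈ s := hsrc (G.map_target hy)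
  -- The derivative is invertible at every point of `s`, not only at `x₀`, so the inverse is smooth
  -- at each point of the target.
  exact (G.contDiffAt_symm hy (hL _ hmem) (hgs.contDiffAt (hs.mem_nhds hmem))).contDiffWithinAt

end InverseFunction

/-! ### Linear algebra of 2-forms on a product. -/

section MixedPart

variable {X Y : Type*} [NormedAddCommGroup X] [NormedSpace ℝ X]
  [NormedAddCommGroup Y] [NormedSpace ℝ Y]

/-- The bilinear map underlying an alternating 2-form. -/
noncomputable def twoFormToBilin : X [⋀^Fin 2]→L[ℝ] ℝ →L[ℝ] X →L[ℝ] X →L[ℝ] ℝ :=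
  (ContinuousLinearMap.compL ℝ X (X [⋀^Fin 1]→L[ℝ] ℝ) (X →L[ℝ] ℝ)
    ((ContinuousAlternatingMap.ofSubsingletonLIE (𝕜 := ℝ) (E := X) (F := ℝ)
      (0 : Fin 1)).symm.toContinuousLinearEquiv.toContinuousLinearMap)).comp
    (ContinuousAlternatingMap.curryLeftLI (𝕜 := ℝ) (E := X) (F := ℝ)
      (n := 1)).toContinuousLinearMap

theorem twoFormToBilin_apply (τ : X [⋀^Fin 2]→L[ℝ] ℝ) (v w : X) :
    twoFormToBilin τ v w = τ ![v, w] := by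
  change τ (Matrix.vecCons v fun _ => w) = _
  refine congrArg τ (funext fun i => ?_)
  fin_cases i <;> rfl

/-- The mixed part `w ↦ (v ↦ τ ((v, 0), (0, w)))` of a 2-form on a product. -/
noncomputable def mixedPart : (X × Y) [⋀^Fin 2]→L[ℝ] ℝ →L[ℝ] Y →L[ℝ] X →L[ℝ] ℝ :=
  (ContinuousLinearMap.flipₗᵢ ℝ X Y ℝ).toContinuousLinearEquiv.toContinuousLinearMap.comp
    ((((ContinuousLinearMap.compL ℝ X (X × Y →L[ℝ] ℝ) (Y →L[ℝ] ℝ))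
      ((ContinuousLinearMap.compL ℝ Y (X × Y) ℝ).flip (ContinuousLinearMap.inr ℝ X Y))).comp
      ((ContinuousLinearMap.compL ℝ X (X × Y) (X × Y →L[ℝ] ℝ)).flip
        (ContinuousLinearMap.inl ℝ X Y))).comp twoFormToBilin)

theorem mixedPart_apply (τ : (X × Y) [⋀^Fin 2]→L[ℝ] ℝ) (v : X) (w : Y) :
    mixedPart τ w v = τ ![(v, 0), (0, w)] :=
  twoFormToBilin_apply τ _ _

attribute [irreducible] twoFormToBilin mixedPart

end MixedPart

section BilinAt

variable {m : ℕ} {M : Type*} [TopologicalSpace M] [ChartedSpace (EuclideanSpace ℝ (Fin m)) M]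

/-- The bilinear form on the model space given by a 2-form at a point. -/
noncomputable def TwoForm.bilinAt (σ : TwoForm m M) (x : M) :
    EuclideanSpace ℝ (Fin m) →L[ℝ] EuclideanSpace ℝ (Fin m) →L[ℝ] ℝ :=
  twoFormToBilin (σ x)

theorem TwoForm.bilinAt_apply (σ : TwoForm m M) (x : M) (v w : EuclideanSpace ℝ (Fin m)) :
    σ.bilinAt x v w = σ x ![v, w] :=
  twoFormToBilin_apply (X := EuclideanSpace ℝ (Fin m)) (σ x) v w

theorem TwoForm.bilinAt_swap (σ : TwoForm m M) (x : M) (v w : EuclideanSpace ℝ (Fin m)) :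
    σ.bilinAt x v w = - σ.bilinAt x w v := by
  let τ : EuclideanSpace ℝ (Fin m) [⋀^Fin 2]→L[ℝ] ℝ := σ x
  have h1 : ∀ a b, σ.bilinAt x a b = τ ![a, b] := σ.bilinAt_apply x
  have h2 := τ.toAlternatingMap.map_swap ![w, v] (zero_ne_one (α := Fin 2))
  have h3 : ![w, v] ∘ Equiv.swap (0 : Fin 2) 1 = ![v, w] := by
    funext i
    fin_cases i <;> rfl
  rw [h3] at h2
  rw [h1, h1]
  exact h2

end BilinAt

/-! ### The fibre form of a Lagrangian fibration. -/

section LagrangianChart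

open Set Filter Topology

variable {n : ℕ} {B M F : Type*}
  [TopologicalSpace B] [ChartedSpace (EuclideanSpace ℝ (Fin n)) B]
  [TopologicalSpace M] [ChartedSpace (EuclideanSpace ℝ (Fin (2 * n))) M]
  [TopologicalSpace F] [ChartedSpace (EuclideanSpace ℝ (Fin n)) F]

/-- A smooth local trivialization of a Lagrangian fibration together with a chart of the base. -/
structure IsLagrangianChart (σ : TwoForm (2 * n) M) (π : M → B) (e : Bundle.Trivialization F π)
    (φ : OpenPartialHomeomorph B (EuclideanSpace ℝ (Fin n))) : Prop where
  fibration : IsLagrangianFibration (F := F) σ π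
  chart_mem : φ ∈ IsManifold.maximalAtlas (𝓡 n) ∞ B
  smooth_triv : ContMDiffOn (𝓡 (2 * n)) ((𝓡 n).prod (𝓡 n)) ∞ e e.source
  smooth_triv_symm : ContMDiffOn ((𝓡 n).prod (𝓡 n)) (𝓡 (2 * n)) ∞
    e.toOpenPartialHomeomorph.symm e.target

variable {π : M → B}

/-- The part of the target of the chart `φ` over which `e` trivializes. -/
def chartDomain (e : Bundle.Trivialization F π)
    (φ : OpenPartialHomeomorph B (EuclideanSpace ℝ (Fin n))) : Set (EuclideanSpace ℝ (Fin n)) :=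
  φ.target ∩ φ.symm ⁻¹' e.baseSet

/-- The parametrization of the total space by `chartDomain e φ × F`. -/
noncomputable def chartParam (e : Bundle.Trivialization F π)
    (φ : OpenPartialHomeomorph B (EuclideanSpace ℝ (Fin n)))
    (q : EuclideanSpace ℝ (Fin n) × F) : M :=
  e.toOpenPartialHomeomorph.symm (φ.symm q.1, q.2)

/-- The differential of `chartParam`. -/
noncomputable def chartParamDeriv (e : Bundle.Trivialization F π)
    (φ : OpenPartialHomeomorph B (EuclideanSpace ℝ (Fin n)))
    (q : EuclideanSpace ℝ (Fin n) × F) :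
    EuclideanSpace ℝ (Fin n) × EuclideanSpace ℝ (Fin n) →L[ℝ] EuclideanSpace ℝ (Fin (2 * n)) :=
  mfderiv ((𝓡 n).prod (𝓡 n)) (𝓡 (2 * n)) (chartParam e φ) q

/-- The form on the fibre over `φ.symm z` obtained by contracting with `σ`, with values in the
dual of the model space of the base. -/
noncomputable def fibreForm (σ : TwoForm (2 * n) M) (e : Bundle.Trivialization F π)
    (φ : OpenPartialHomeomorph B (EuclideanSpace ℝ (Fin n))) (z : EuclideanSpace ℝ (Fin n))
    (x : F) : EuclideanSpace ℝ (Fin n) →L[ℝ] EuclideanSpace ℝ (Fin n) →L[ℝ] ℝ :=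
  mixedPart (ContinuousAlternatingMap.compContinuousLinearMap
    (σ (chartParam e φ (z, x)) : EuclideanSpace ℝ (Fin (2 * n)) [⋀^Fin 2]→L[ℝ] ℝ)
    (chartParamDeriv e φ (z, x)))

variable {σ : TwoForm (2 * n) M} {e : Bundle.Trivialization F π}
  {φ : OpenPartialHomeomorph B (EuclideanSpace ℝ (Fin n))}

omit [ChartedSpace (EuclideanSpace ℝ (Fin n)) B] in
theorem fibreForm_apply (z : EuclideanSpace ℝ (Fin n)) (x : F)
    (v w : EuclideanSpace ℝ (Fin n)) :
    fibreForm σ e φ z x w v = σ.bilinAt (chartParam e φ (z, x))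
      (chartParamDeriv e φ (z, x) (v, 0)) (chartParamDeriv e φ (z, x) (0, w)) := by
  rw [fibreForm, mixedPart_apply, σ.bilinAt_apply]
  refine congrArg (σ (chartParam e φ (z, x))) (funext fun i => ?_)
  fin_cases i <;> rfl

omit [ChartedSpace (EuclideanSpace ℝ (Fin n)) B]
  [ChartedSpace (EuclideanSpace ℝ (Fin (2 * n))) M]
  [ChartedSpace (EuclideanSpace ℝ (Fin n)) F] in
theorem isOpen_chartDomain : IsOpen (chartDomain e φ) :=
  φ.symm.continuousOn.isOpen_inter_preimage φ.open_target e.open_baseSet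

omit [ChartedSpace (EuclideanSpace ℝ (Fin n)) B]
  [ChartedSpace (EuclideanSpace ℝ (Fin (2 * n))) M]
  [ChartedSpace (EuclideanSpace ℝ (Fin n)) F] in
theorem mem_target_of_mem_chartDomain {z : EuclideanSpace ℝ (Fin n)} (hz : z ∈ chartDomain e φ)
    (x : F) : (φ.symm z, x) ∈ e.target := by
  rw [e.target_eq]
  exact ⟨hz.2, mem_univ _⟩

omit [ChartedSpace (EuclideanSpace ℝ (Fin n)) B]
  [ChartedSpace (EuclideanSpace ℝ (Fin (2 * n))) M]
  [ChartedSpace (EuclideanSpace ℝ (Fin n)) F] in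
theorem proj_chartParam {z : EuclideanSpace ℝ (Fin n)} (hz : z ∈ chartDomain e φ) (x : F) :
    π (chartParam e φ (z, x)) = φ.symm z := by
  rw [chartParam, e.proj_symm_apply (mem_target_of_mem_chartDomain hz x)]

omit [ChartedSpace (EuclideanSpace ℝ (Fin n)) B]
  [ChartedSpace (EuclideanSpace ℝ (Fin (2 * n))) M]
  [ChartedSpace (EuclideanSpace ℝ (Fin n)) F] in
theorem triv_chartParam {z : EuclideanSpace ℝ (Fin n)} (hz : z ∈ chartDomain e φ) (x : F) :
    e (chartParam e φ (z, x)) = (φ.symm z, x) :=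
  e.apply_symm_apply (mem_target_of_mem_chartDomain hz x)

omit [ChartedSpace (EuclideanSpace ℝ (Fin n)) B]
  [ChartedSpace (EuclideanSpace ℝ (Fin (2 * n))) M]
  [ChartedSpace (EuclideanSpace ℝ (Fin n)) F] in
theorem chartParam_proj {m : M} (hm : m ∈ e.source) (hφ : π m ∈ φ.source) :
    chartParam e φ (φ (π m), (e m).2) = m := by
  rw [chartParam]
  dsimp only
  rw [φ.left_inv hφ, ← e.coe_fst hm, Prod.mk.eta]
  exact e.left_inv hm

namespace IsLagrangianChart

variable (h : IsLagrangianChart σ π e φ)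
include h

theorem contMDiffOn_chartParam [IsManifold (𝓡 n) ∞ B] :
    ContMDiffOn ((𝓡 n).prod (𝓡 n)) (𝓡 (2 * n)) ∞ (chartParam e φ)
      (chartDomain e φ ×ˢ univ) := by
  refine h.smooth_triv_symm.comp (t := e.target) (f := fun q : EuclideanSpace ℝ (Fin n) × F =>
    (φ.symm q.1, q.2)) (ContMDiffOn.prodMk ?_ contMDiffOn_snd)
    fun q hq => mem_target_of_mem_chartDomain hq.1 _
  exact (contMDiffOn_symm_of_mem_maximalAtlas h.chart_mem).comp contMDiffOn_fst
    fun q hq => hq.1.1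

variable [IsManifold (𝓡 n) ∞ B]

theorem hasMFDerivAt_chartParam {z : EuclideanSpace ℝ (Fin n)} (hz : z ∈ chartDomain e φ)
    (x : F) : HasMFDerivAt ((𝓡 n).prod (𝓡 n)) (𝓡 (2 * n)) (chartParam e φ) (z, x)
      (chartParamDeriv e φ (z, x)) :=
  ((h.contMDiffOn_chartParam.contMDiffAt ((isOpen_chartDomain.prod isOpen_univ).mem_nhds
    ⟨hz, mem_univ x⟩)).mdifferentiableAt (by simp)).hasMFDerivAt

theorem mfderiv_proj_chartParamDeriv {z : EuclideanSpace ℝ (Fin n)} (hz : z ∈ chartDomain e φ)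
    (x : F) (v w : EuclideanSpace ℝ (Fin n)) :
    mfderiv (𝓡 (2 * n)) (𝓡 n) π (chartParam e φ (z, x)) (chartParamDeriv e φ (z, x) (v, w)) =
      mfderiv (𝓡 n) (𝓡 n) φ.symm z v := by
  have h1 := ((h.fibration.smooth (chartParam e φ (z, x))).mdifferentiableAt
    (by simp)).hasMFDerivAt.comp (z, x) (h.hasMFDerivAt_chartParam hz x)
  have h2 : MDifferentiableAt (𝓡 n) (𝓡 n) φ.symm z :=
    (contMDiffAt_symm_of_mem_maximalAtlas h.chart_mem hz.1).mdifferentiableAt (by simp)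
  have h3 := h2.hasMFDerivAt.comp (z, x) (hasMFDerivAt_fst (I := 𝓡 n) (I' := 𝓡 n) (z, x))
  have h4 : π ∘ chartParam e φ =ᶠ[𝓝 (z, x)] φ.symm ∘ Prod.fst := by
    filter_upwards [(isOpen_chartDomain.prod isOpen_univ).mem_nhds ⟨hz, mem_univ x⟩] with q hq
    exact proj_chartParam hq.1 q.2
  have h5 := hasMFDerivAt_unique (h1.congr_of_eventuallyEq h4.symm) h3
  exact DFunLike.congr_fun h5 (v, w)

/-- The map `m ↦ (φ (π m), (e m).2)` is a smooth local inverse on both sides; the chain rule for the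
two composites gives injectivity and surjectivity. -/
theorem chartParamDeriv_bijective {z : EuclideanSpace ℝ (Fin n)} (hz : z ∈ chartDomain e φ)
    (x : F) : Function.Bijective (chartParamDeriv e φ (z, x)) := by
  have hsrc : chartParam e φ (z, x) ∈ e.source := by
    rw [e.source_eq, mem_preimage, proj_chartParam hz]
    exact hz.2
  have hφs : π (chartParam e φ (z, x)) ∈ φ.source := by
    rw [proj_chartParam hz]
    exact φ.map_target hz.1
  have hπ : ContMDiffAt (𝓡 (2 * n)) (𝓡 n) ∞ π (chartParam e φ (z, x)) := h.fibration.smooth _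
  have h1 : ContMDiffAt (𝓡 (2 * n)) ((𝓡 n).prod (𝓡 n)) ∞ (fun m => (φ (π m), (e m).2))
      (chartParam e φ (z, x)) := by
    refine ContMDiffAt.prodMk ?_ ?_
    · exact (contMDiffAt_of_mem_maximalAtlas h.chart_mem hφs).comp _ hπ
    · exact contMDiffAt_snd.comp _
        (h.smooth_triv.contMDiffAt (e.open_source.mem_nhds hsrc))
  have hR := (h1.mdifferentiableAt (by simp)).hasMFDerivAt
  have hQ := h.hasMFDerivAt_chartParam hz x
  have hval : (φ (π (chartParam e φ (z, x))), (e (chartParam e φ (z, x))).2) = (z, x) := by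
    rw [proj_chartParam hz, triv_chartParam hz, φ.right_inv hz.1]
  have h2 := hR.comp (z, x) hQ
  have h3 : (fun m => (φ (π m), (e m).2)) ∘ chartParam e φ =ᶠ[𝓝 (z, x)] id := by
    filter_upwards [(isOpen_chartDomain.prod isOpen_univ).mem_nhds ⟨hz, mem_univ x⟩] with q hq
    simp only [Function.comp_apply, id]
    rw [proj_chartParam hq.1, triv_chartParam hq.1, φ.right_inv hq.1.1]
  have h4 := hasMFDerivAt_unique (h2.congr_of_eventuallyEq h3.symm) (hasMFDerivAt_id _)
  rw [← hval] at hQ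
  have h5 := HasMFDerivAt.comp (f := fun m => (φ (π m), (e m).2)) (chartParam e φ (z, x)) hQ hR
  have h6 : chartParam e φ ∘ (fun m => (φ (π m), (e m).2)) =ᶠ[𝓝 (chartParam e φ (z, x))] id := by
    filter_upwards [e.open_source.mem_nhds hsrc,
      hπ.continuousAt.preimage_mem_nhds (φ.open_source.mem_nhds hφs)] with m hm hm'
    exact chartParam_proj hm hm'
  have h7 := hasMFDerivAt_unique (h5.congr_of_eventuallyEq h6.symm) (hasMFDerivAt_id _)
  exact ⟨Function.LeftInverse.injective fun v => DFunLike.congr_fun h4 v,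
    fun v => ⟨mfderiv (𝓡 (2 * n)) ((𝓡 n).prod (𝓡 n)) (fun m => (φ (π m), (e m).2))
      (chartParam e φ (z, x)) v, (congrArg (fun q => chartParamDeriv e φ q (mfderiv (𝓡 (2 * n))
        ((𝓡 n).prod (𝓡 n)) (fun m => (φ (π m), (e m).2)) (chartParam e φ (z, x)) v))
        hval).symm.trans (DFunLike.congr_fun h7 v)⟩⟩

/-- The vertical component `w` drops out because the fibres are Lagrangian. -/
theorem apply_vertical {z : EuclideanSpace ℝ (Fin n)} (hz : z ∈ chartDomain e φ) (x : F)
    (v w w' : EuclideanSpace ℝ (Fin n)) :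
    σ.bilinAt (chartParam e φ (z, x)) (chartParamDeriv e φ (z, x) (v, w))
      (chartParamDeriv e φ (z, x) (0, w')) = fibreForm σ e φ z x w' v := by
  have h1 : chartParamDeriv e φ (z, x) (v, w) =
      chartParamDeriv e φ (z, x) (v, 0) + chartParamDeriv e φ (z, x) (0, w) := by
    rw [← map_add]
    simp
  have h3 : σ.bilinAt (chartParam e φ (z, x)) (chartParamDeriv e φ (z, x) (0, w))
      (chartParamDeriv e φ (z, x) (0, w')) = 0 := by
    rw [σ.bilinAt_apply]
    refine h.fibration.lagrangian _ _ _ ?_ ?_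
    · exact (h.mfderiv_proj_chartParamDeriv hz x 0 w).trans (map_zero _)
    · exact (h.mfderiv_proj_chartParamDeriv hz x 0 w').trans (map_zero _)
  rw [fibreForm_apply, h1, map_add, add_apply, h3, add_zero]

/-- A vertical vector in the kernel is `σ`-orthogonal to the whole tangent space by
`apply_vertical`, so it vanishes. Source and target both have dimension `n`. -/
theorem fibreForm_bijective {z : EuclideanSpace ℝ (Fin n)} (hz : z ∈ chartDomain e φ) (x : F) :
    Function.Bijective (fibreForm σ e φ z x) := by
  have hinj : Function.Injective (fibreForm σ e φ z x) := by
    rw [injective_iff_map_eq_zero]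
    intro w hw
    have h0 : chartParamDeriv e φ (z, x) (0, w) = 0 := by
      refine h.fibration.symplectic.nondegenerate (chartParam e φ (z, x))
        (chartParamDeriv e φ (z, x) (0, w)) fun u => ?_
      obtain ⟨⟨v, w'⟩, rfl⟩ := (h.chartParamDeriv_bijective hz x).2 u
      refine (σ.bilinAt_apply _ _ _).symm.trans ?_
      rw [σ.bilinAt_swap, h.apply_vertical hz x v w' w, hw]
      simp
    have := (h.chartParamDeriv_bijective hz x).1 (h0.trans (map_zero _).symm)
    exact congrArg Prod.snd this
  refine ⟨hinj, ?_⟩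
  have hdim : Module.finrank ℝ (EuclideanSpace ℝ (Fin n)) =
      Module.finrank ℝ (EuclideanSpace ℝ (Fin n) →L[ℝ] ℝ) := by
    rw [← (LinearMap.toContinuousLinearMap (𝕜 := ℝ) (E := EuclideanSpace ℝ (Fin n))
      (F' := ℝ)).finrank_eq]
    exact (Subspace.dual_finrank_eq).symm
  exact (LinearMap.injective_iff_surjective_of_finrank_eq_finrank hdim
    (f := (fibreForm σ e φ z x).toLinearMap)).1 hinj

end IsLagrangianChart

end LagrangianChart

/-! ### Closedness of the fibre form and of its loop integrals. -/

section LagrangianChartClosed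

open Set Filter Topology

variable {n : ℕ} {B M F : Type*}
  [TopologicalSpace B] [ChartedSpace (EuclideanSpace ℝ (Fin n)) B] [IsManifold (𝓡 n) ∞ B]
  [TopologicalSpace M] [ChartedSpace (EuclideanSpace ℝ (Fin (2 * n))) M]
  [TopologicalSpace F] [ChartedSpace (EuclideanSpace ℝ (Fin n)) F]
  {π : M → B} {σ : TwoForm (2 * n) M} {e : Bundle.Trivialization F π}
  {φ : OpenPartialHomeomorph B (EuclideanSpace ℝ (Fin n))}
  {X : Type*} [NormedAddCommGroup X] [NormedSpace ℝ X]

namespace IsLagrangianChart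

variable (h : IsLagrangianChart σ π e φ)
include h

theorem hasMFDerivAt_chartParam_comp {z : EuclideanSpace ℝ (Fin n)} (hz : z ∈ chartDomain e φ)
    {k : X → F} {p : X} {k' : X →L[ℝ] EuclideanSpace ℝ (Fin n)}
    (hk : HasMFDerivAt 𝓘(ℝ, X) (𝓡 n) k p k') :
    HasMFDerivAt 𝓘(ℝ, EuclideanSpace ℝ (Fin n) × X) (𝓡 (2 * n))
      (fun q => chartParam e φ (q.1, k q.2)) (z, p)
      ((chartParamDeriv e φ (z, k p)).comp
        ((ContinuousLinearMap.fst ℝ (EuclideanSpace ℝ (Fin n)) X).prod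
          (k'.comp (ContinuousLinearMap.snd ℝ (EuclideanSpace ℝ (Fin n)) X)))) := by
  have h1 : HasMFDerivAt 𝓘(ℝ, EuclideanSpace ℝ (Fin n) × X) (𝓡 n)
      (fun q : EuclideanSpace ℝ (Fin n) × X => q.1) (z, p)
      (ContinuousLinearMap.fst ℝ (EuclideanSpace ℝ (Fin n)) X) :=
    hasFDerivAt_fst.hasMFDerivAt
  have h2 : HasMFDerivAt 𝓘(ℝ, EuclideanSpace ℝ (Fin n) × X) 𝓘(ℝ, X)
      (fun q : EuclideanSpace ℝ (Fin n) × X => q.2) (z, p)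
      (ContinuousLinearMap.snd ℝ (EuclideanSpace ℝ (Fin n)) X) :=
    hasFDerivAt_snd.hasMFDerivAt
  have h3 : HasMFDerivAt 𝓘(ℝ, EuclideanSpace ℝ (Fin n) × X) (𝓡 n)
      (fun q : EuclideanSpace ℝ (Fin n) × X => k q.2) (z, p)
      (k'.comp (ContinuousLinearMap.snd ℝ (EuclideanSpace ℝ (Fin n)) X)) :=
    HasMFDerivAt.comp (g := k) (z, p) hk h2
  exact HasMFDerivAt.comp (g := chartParam e φ) (z, p) (h.hasMFDerivAt_chartParam hz (k p))
    (h1.prodMk h3)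

theorem contMDiffOn_chartParam_comp {k : X → F} {s : Set X}
    (hk : ContMDiffOn 𝓘(ℝ, X) (𝓡 n) ∞ k s) :
    ContMDiffOn 𝓘(ℝ, EuclideanSpace ℝ (Fin n) × X) (𝓡 (2 * n)) ∞
      (fun q => chartParam e φ (q.1, k q.2)) (chartDomain e φ ×ˢ s) := by
  have h2 : ContMDiff 𝓘(ℝ, EuclideanSpace ℝ (Fin n) × X) 𝓘(ℝ, X) ∞
      (fun q : EuclideanSpace ℝ (Fin n) × X => q.2) :=
    contMDiff_iff_contDiff.2 contDiff_snd
  refine h.contMDiffOn_chartParam.comp (t := chartDomain e φ ×ˢ univ)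
    (f := fun q : EuclideanSpace ℝ (Fin n) × X => (q.1, k q.2))
    (ContMDiffOn.prodMk ?_ (hk.comp h2.contMDiffOn fun q hq => hq.2))
    fun q hq => ⟨hq.1, mem_univ _⟩
  exact (contMDiff_iff_contDiff.2 contDiff_fst).contMDiffOn

theorem pullback_chartParam_comp_apply {z : EuclideanSpace ℝ (Fin n)}
    (hz : z ∈ chartDomain e φ) {k : X → F} {p : X} {k' : X →L[ℝ] EuclideanSpace ℝ (Fin n)}
    (hk : HasMFDerivAt 𝓘(ℝ, X) (𝓡 n) k p k') (v v' : EuclideanSpace ℝ (Fin n)) (w w' : X) :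
    σ.pullback (fun q => chartParam e φ (q.1, k q.2)) (z, p) ![(v, w), (v', w')] =
      σ.bilinAt (chartParam e φ (z, k p))
        (chartParamDeriv e φ (z, k p) (v, k' w))
        (chartParamDeriv e φ (z, k p) (v', k' w')) := by
  rw [σ.pullback_apply, (h.hasMFDerivAt_chartParam_comp hz hk).mfderiv,
    σ.bilinAt_apply]
  rfl

/-- Makes the fibre form a fixed continuous linear function of a 2-form on a normed space, so that
it inherits smoothness and the consequences of `dσ = 0`. -/
theorem pullbackForm_eq_mixedPart {z : EuclideanSpace ℝ (Fin n)} (hz : z ∈ chartDomain e φ)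
    {k : X → F} {p : X} (hk : MDifferentiableAt 𝓘(ℝ, X) (𝓡 n) k p) :
    pullbackForm (fibreForm σ e φ z) k p =
      mixedPart (σ.pullback (fun q => chartParam e φ (q.1, k q.2)) (z, p)) := by
  let k' : X →L[ℝ] EuclideanSpace ℝ (Fin n) := mfderiv 𝓘(ℝ, X) (𝓡 n) k p
  have hk' : HasMFDerivAt 𝓘(ℝ, X) (𝓡 n) k p k' := hk.hasMFDerivAt
  ext w v
  rw [mixedPart_apply, h.pullback_chartParam_comp_apply hz hk', map_zero]
  exact fibreForm_apply _ _ _ _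

variable [IsManifold (𝓡 (2 * n)) ∞ M]

theorem contDiffOn_pullback_chartParam {k : X → F} {s : Set X} (hs : IsOpen s)
    (hk : ContMDiffOn 𝓘(ℝ, X) (𝓡 n) ∞ k s) :
    ContDiffOn ℝ ∞ (σ.pullback fun q : EuclideanSpace ℝ (Fin n) × X =>
      chartParam e φ (q.1, k q.2)) (chartDomain e φ ×ˢ s) :=
  h.fibration.symplectic.contDiffOn_pullback (isOpen_chartDomain.prod hs)
    (h.contMDiffOn_chartParam_comp hk)

theorem contDiffOn_pullbackForm {z : EuclideanSpace ℝ (Fin n)} (hz : z ∈ chartDomain e φ)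
    {k : X → F} {s : Set X} (hs : IsOpen s) (hk : ContMDiffOn 𝓘(ℝ, X) (𝓡 n) ∞ k s) :
    ContDiffOn ℝ ∞ (pullbackForm (fibreForm σ e φ z) k) s := by
  have h1 : ContDiffOn ℝ ∞ (fun p : X => (z, p)) s := by fun_prop
  have h2 := (h.contDiffOn_pullback_chartParam hs hk).comp h1 fun p hp => ⟨hz, hp⟩
  refine ((mixedPart (X := EuclideanSpace ℝ (Fin n)) (Y := X)).contDiff.comp_contDiffOn
    h2).congr fun p hp => ?_
  exact h.pullbackForm_eq_mixedPart hz ((hk.contMDiffAt (hs.mem_nhds hp)).mdifferentiableAt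
    (by simp))

/-- The fibre form is closed on each fibre. -/
theorem fderiv_pullbackForm_symm {z : EuclideanSpace ℝ (Fin n)} (hz : z ∈ chartDomain e φ)
    {k : X → F} {s : Set X} (hs : IsOpen s) (hk : ContMDiffOn 𝓘(ℝ, X) (𝓡 n) ∞ k s) {p : X}
    (hp : p ∈ s) (w w' : X) :
    fderiv ℝ (pullbackForm (fibreForm σ e φ z) k) p w w' =
      fderiv ℝ (pullbackForm (fibreForm σ e φ z) k) p w' w := by
  set Ω := σ.pullback fun q : EuclideanSpace ℝ (Fin n) × X => chartParam e φ (q.1, k q.2) with hΩ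
  have hopen : IsOpen (chartDomain e φ ×ˢ s) := isOpen_chartDomain.prod hs
  have hmd : ∀ p ∈ s, MDifferentiableAt 𝓘(ℝ, X) (𝓡 n) k p := fun p hp =>
    (hk.contMDiffAt (hs.mem_nhds hp)).mdifferentiableAt (by simp)
  have hΩd : DifferentiableAt ℝ Ω (z, p) :=
    ((h.contDiffOn_pullback_chartParam hs hk).contDiffAt
      (hopen.mem_nhds ⟨hz, hp⟩)).differentiableAt (by simp)
  have hev : pullbackForm (fibreForm σ e φ z) k =ᶠ[𝓝 p] fun p => mixedPart (Ω (z, p)) := by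
    filter_upwards [hs.mem_nhds hp] with p' hp'
    exact h.pullbackForm_eq_mixedPart hz (hmd p' hp')
  have happ : ∀ (a b : X) (v : EuclideanSpace ℝ (Fin n)),
      fderiv ℝ (pullbackForm (fibreForm σ e φ z) k) p a b v =
        fderiv ℝ Ω (z, p) (0, a) ![(v, 0), (0, b)] := fun a b v => by
    rw [fderiv_clm_slice_apply mixedPart hΩd hev, mixedPart_apply]
  ext v
  rw [happ, happ]
  have hcyc := fderiv_cyclic_of_extDeriv_eq_zero (h.fibration.symplectic.extDeriv_pullback hopen
    (h.contMDiffOn_chartParam_comp hk) (show (z, p) ∈ chartDomain e φ ×ˢ s from ⟨hz, hp⟩))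
    (v, (0 : X)) ((0 : EuclideanSpace ℝ (Fin n)), w) ((0 : EuclideanSpace ℝ (Fin n)), w')
  -- In the cyclic identity the base derivative of `σ` on two vertical vectors disappears, as that
  -- function is identically zero.
  have hvert : fderiv ℝ Ω (z, p) (v, 0) ![(0, w), (0, w')] = 0 := by
    have h1 := hΩd.hasFDerivAt.continuousAlternatingMap_apply_const
      ![((0 : EuclideanSpace ℝ (Fin n)), w), (0, w')]
    have h2 : (fun q => Ω q ![(0, w), (0, w')]) =ᶠ[𝓝 (z, p)] fun _ => (0 : ℝ) := by
      filter_upwards [hopen.mem_nhds ⟨hz, hp⟩] with q hq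
      obtain ⟨z', p'⟩ := q
      let k' : X →L[ℝ] EuclideanSpace ℝ (Fin n) := mfderiv 𝓘(ℝ, X) (𝓡 n) k p'
      have hk' : HasMFDerivAt 𝓘(ℝ, X) (𝓡 n) k p' k' := (hmd p' hq.2).hasMFDerivAt
      rw [hΩ, h.pullback_chartParam_comp_apply hq.1 hk', h.apply_vertical hq.1, map_zero]
    have h3 := (h1.congr_of_eventuallyEq h2.symm).unique (hasFDerivAt_const (0 : ℝ) (z, p))
    exact DFunLike.congr_fun h3 (v, 0)
  rw [← hΩ] at hcyc
  linarith

/-- The integral of the fibre form over a loop in the typical fibre. -/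
theorem contDiffOn_loopIntegral {γ : ℝ → F} (hγ : ContMDiff 𝓘(ℝ, ℝ) (𝓡 n) ∞ γ) :
    ContDiffOn ℝ ∞ (fun z => ∫ t in (0 : ℝ)..1, pullbackForm (fibreForm σ e φ z) γ t 1)
      (chartDomain e φ) := by
  have h1 := h.contDiffOn_pullback_chartParam isOpen_univ hγ.contMDiffOn
  have h2 := contDiffOn_integral_unitInterval isOpen_chartDomain
    (((ContinuousLinearMap.apply ℝ (EuclideanSpace ℝ (Fin n) →L[ℝ] ℝ) (1 : ℝ)).comp
      (mixedPart (X := EuclideanSpace ℝ (Fin n)) (Y := ℝ))).contDiff.comp_contDiffOn h1)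
  refine h2.congr fun z hz => ?_
  refine intervalIntegral.integral_congr fun t _ => ?_
  exact DFunLike.congr_fun (h.pullbackForm_eq_mixedPart hz
    ((hγ t).mdifferentiableAt (by simp))) 1

/-- By closedness of `σ`, the antisymmetric part of the derivative is the integral of a
`t`-derivative of `σ` on two base directions. It vanishes because the loop closes up. -/
theorem fderiv_loopIntegral_symm {γ : ℝ → F} (hγ : ContMDiff 𝓘(ℝ, ℝ) (𝓡 n) ∞ γ)
    (hper : ∀ t, γ (t + 1) = γ t) {z : EuclideanSpace ℝ (Fin n)} (hz : z ∈ chartDomain e φ)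
    (v v' : EuclideanSpace ℝ (Fin n)) :
    fderiv ℝ (fun z => ∫ t in (0 : ℝ)..1, pullbackForm (fibreForm σ e φ z) γ t 1) z v v' =
      fderiv ℝ (fun z => ∫ t in (0 : ℝ)..1, pullbackForm (fibreForm σ e φ z) γ t 1) z v' v := by
  set G := fun q : EuclideanSpace ℝ (Fin n) × ℝ => chartParam e φ (q.1, γ q.2) with hG
  set Ω := σ.pullback G with hΩ
  have hopen : IsOpen (chartDomain e φ ×ˢ (univ : Set ℝ)) := isOpen_chartDomain.prod isOpen_univ
  have hmd : ∀ t, MDifferentiableAt 𝓘(ℝ, ℝ) (𝓡 n) γ t := fun t =>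
    (hγ t).mdifferentiableAt (by simp)
  let γ' : ℝ → ℝ →L[ℝ] EuclideanSpace ℝ (Fin n) := fun t => mfderiv 𝓘(ℝ, ℝ) (𝓡 n) γ t
  have hγ' : ∀ t, HasMFDerivAt 𝓘(ℝ, ℝ) (𝓡 n) γ t (γ' t) := fun t => (hmd t).hasMFDerivAt
  have hΩs : ContDiffOn ℝ ∞ Ω (chartDomain e φ ×ˢ univ) :=
    h.contDiffOn_pullback_chartParam isOpen_univ hγ.contMDiffOn
  have hΩd : ∀ t, DifferentiableAt ℝ Ω (z, t) := fun t =>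
    (hΩs.contDiffAt (hopen.mem_nhds ⟨hz, mem_univ t⟩)).differentiableAt (by simp)
  set L : (EuclideanSpace ℝ (Fin n) × ℝ) [⋀^Fin 2]→L[ℝ] ℝ →L[ℝ]
      (EuclideanSpace ℝ (Fin n) →L[ℝ] ℝ) :=
    (ContinuousLinearMap.apply ℝ (EuclideanSpace ℝ (Fin n) →L[ℝ] ℝ) (1 : ℝ)).comp mixedPart
    with hL
  have hLapp : ∀ τ b, L τ b = τ ![(b, 0), (0, 1)] := fun τ b => mixedPart_apply τ b 1
  clear_value L
  have heq : (fun z => ∫ t in (0 : ℝ)..1, pullbackForm (fibreForm σ e φ z) γ t 1) =ᶠ[𝓝 z]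
      fun z => ∫ t in (0 : ℝ)..1, L (Ω (z, t)) := by
    filter_upwards [isOpen_chartDomain.mem_nhds hz] with z' hz'
    refine intervalIntegral.integral_congr fun t _ => ?_
    rw [hL]
    exact DFunLike.congr_fun (h.pullbackForm_eq_mixedPart hz' (hmd t)) 1
  have hcont : Continuous fun t : ℝ => fderiv ℝ Ω (z, t) :=
    (hΩs.continuousOn_fderiv_of_isOpen hopen (by simp)).comp_continuous (by fun_prop)
      fun t => ⟨hz, mem_univ t⟩
  have happ : ∀ a b : EuclideanSpace ℝ (Fin n),
      fderiv ℝ (fun z => ∫ t in (0 : ℝ)..1, pullbackForm (fibreForm σ e φ z) γ t 1) z a b =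
        ∫ t in (0 : ℝ)..1, fderiv ℝ Ω (z, t) (a, 0) ![(b, 0), (0, 1)] := by
    intro a b
    rw [heq.fderiv_eq, fderiv_integral_clm_apply L isOpen_chartDomain
      (hΩs.of_le (by exact_mod_cast le_top)) hz]
    simp only [hLapp]
  have hev : ∀ (a b : EuclideanSpace ℝ (Fin n) × ℝ) (c : EuclideanSpace ℝ (Fin n) × ℝ),
      Continuous fun t : ℝ => fderiv ℝ Ω (z, t) c ![a, b] := fun a b c => by
    simp only [← twoFormToBilin_apply]
    exact ((twoFormToBilin.continuous.comp (hcont.clm_apply continuous_const)).clm_apply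
      continuous_const).clm_apply continuous_const
  have hcyc : ∀ t : ℝ, fderiv ℝ Ω (z, t) (v, 0) ![(v', 0), (0, 1)] -
      fderiv ℝ Ω (z, t) (v', 0) ![(v, 0), (0, 1)] =
      - fderiv ℝ Ω (z, t) (0, 1) ![(v, 0), (v', 0)] := by
    intro t
    have := fderiv_cyclic_of_extDeriv_eq_zero (h.fibration.symplectic.extDeriv_pullback hopen
      (h.contMDiffOn_chartParam_comp hγ.contMDiffOn)
      (show (z, t) ∈ chartDomain e φ ×ˢ univ from ⟨hz, mem_univ t⟩))
      (v, (0 : ℝ)) (v', (0 : ℝ)) ((0 : EuclideanSpace ℝ (Fin n)), (1 : ℝ))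
    rw [← hG, ← hΩ] at this
    linarith
  have hprim : ∀ t : ℝ, HasDerivAt (fun t : ℝ => Ω (z, t) ![(v, 0), (v', 0)])
      (fderiv ℝ Ω (z, t) (0, 1) ![(v, 0), (v', 0)]) t := by
    intro t
    have h1 := (hΩd t).hasFDerivAt.continuousAlternatingMap_apply_const
      ![(v, (0 : ℝ)), (v', (0 : ℝ))]
    exact h1.comp_hasDerivAt t ((hasDerivAt_const t z).prodMk (hasDerivAt_id t))
  -- Both vectors have zero `ℝ`-component, so the velocity of `γ` does not enter and `γ 1 = γ 0`
  -- suffices.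
  have hend : Ω (z, 1) ![(v, 0), (v', 0)] = Ω (z, 0) ![(v, 0), (v', 0)] := by
    rw [hΩ, hG, h.pullback_chartParam_comp_apply hz (hγ' 1),
      h.pullback_chartParam_comp_apply hz (hγ' 0), map_zero, map_zero]
    have : γ 1 = γ 0 := by simpa using hper 0
    rw [this]
  have h1 : ∫ t in (0 : ℝ)..1, fderiv ℝ Ω (z, t) (0, 1) ![(v, 0), (v', 0)] = 0 := by
    rw [intervalIntegral.integral_eq_sub_of_hasDerivAt (fun t _ => hprim t)
      ((hev _ _ _).intervalIntegrable _ _), hend, sub_self]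
  rw [happ, happ, ← sub_eq_zero, ← intervalIntegral.integral_sub
    ((hev _ _ _).intervalIntegrable _ _) ((hev _ _ _).intervalIntegrable _ _)]
  simp only [hcyc]
  rw [intervalIntegral.integral_neg, h1, neg_zero]

end IsLagrangianChart

end LagrangianChartClosed

/-! ### Smooth generators of the period lattice, and its chart-free description. -/

section PeriodLattice

open Set Filter Topology

variable {n : ℕ} {B M F : Type*}
  [TopologicalSpace B] [ChartedSpace (EuclideanSpace ℝ (Fin n)) B]
  [TopologicalSpace M] [ChartedSpace (EuclideanSpace ℝ (Fin (2 * n))) M]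
  [TopologicalSpace F] [ChartedSpace (EuclideanSpace ℝ (Fin n)) F]
  {π : M → B} {σ : TwoForm (2 * n) M} {e : Bundle.Trivialization F π}
  {φ : OpenPartialHomeomorph B (EuclideanSpace ℝ (Fin n))}

/-- A covector at `b` is a period if its Hamiltonian flow on the fibre over `b` has a closed orbit
of period `1`. -/
def IsPeriodCovector (σ : TwoForm (2 * n) M) (π : M → B) (b : B)
    (μ : EuclideanSpace ℝ (Fin n) →L[ℝ] ℝ) : Prop :=
  ∃ c : ℝ → M, ContMDiff 𝓘(ℝ, ℝ) (𝓡 (2 * n)) ∞ c ∧ (∀ t, π (c t) = b) ∧ c 1 = c 0 ∧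
    ∀ (t : ℝ) (u : EuclideanSpace ℝ (Fin (2 * n))),
      σ.bilinAt (c t) u (mfderiv 𝓘(ℝ, ℝ) (𝓡 (2 * n)) c t (1 : ℝ)) =
        μ (mfderiv (𝓡 (2 * n)) (𝓡 n) π (c t) u)

variable [IsManifold (𝓡 n) ∞ B] [IsManifold (𝓡 (2 * n)) ∞ M]

namespace IsLagrangianChart

variable (h : IsLagrangianChart σ π e φ)
include h

/-- The Poincaré lemma on a ball in a fibre chart gives a primitive; its derivative is bijective, so
the inverse function theorem turns it into a local diffeomorphism. -/
theorem isFlatCoframe_fibreForm [IsManifold (𝓡 n) ∞ F] {z : EuclideanSpace ℝ (Fin n)}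
    (hz : z ∈ chartDomain e φ) : IsFlatCoframe (fibreForm σ e φ z) := by
  intro x
  set c := chartAt (EuclideanSpace ℝ (Fin n)) x with hc
  have hcs : ContMDiffOn (𝓡 n) (𝓡 n) ∞ c c.source := contMDiffOn_chart
  have hcsymm : ContMDiffOn (𝓡 n) (𝓡 n) ∞ c.symm c.target := contMDiffOn_chart_symm
  have hcm : c.MDifferentiable (𝓡 n) (𝓡 n) := mdifferentiable_chart x
  have hxc : x ∈ c.source := mem_chart_source _ x
  obtain ⟨r, hr, hball⟩ := Metric.isOpen_iff.1 c.open_target _ (c.map_source hxc)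
  set ζ := pullbackForm (fibreForm σ e φ z) c.symm with hζ
  have hζs : ContDiffOn ℝ ∞ ζ c.target := h.contDiffOn_pullbackForm hz c.open_target hcsymm
  obtain ⟨g, hg⟩ := (convex_ball (c x) r).exists_forall_hasFDerivAt_of_fderiv_symmetric
    Metric.isOpen_ball ((hζs.mono hball).differentiableOn (by simp))
    (fun y hy v w => h.fderiv_pullbackForm_symm hz c.open_target hcsymm (hball hy) v w)
  have hbij : ∀ y ∈ Metric.ball (c x) r, Function.Bijective (ζ y) := fun y hy =>
    (h.fibreForm_bijective hz (c.symm y)).comp (hcm.symm.mfderiv_bijective (hball hy))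
  obtain ⟨G, hxG, hGsrc, hGg, hGs, hGsymm⟩ := exists_openPartialHomeomorph_of_bijective
    Metric.isOpen_ball (hζs.mono hball) hg hbij (Metric.mem_ball_self hr)
  refine ⟨c.trans G, ⟨hxc, hxG⟩, ?_, ?_, ?_⟩
  · exact (contMDiffOn_iff_contDiffOn.2 hGs).comp (hcs.mono fun y hy => hy.1) fun y hy => hy.2
  · exact hcsymm.comp ((contMDiffOn_iff_contDiffOn.2 hGsymm).mono fun y hy => hy.1)
      fun y hy => hy.2
  · rintro y ⟨hyc, hyG⟩
    have h1 : HasMFDerivAt (𝓡 n) 𝓘(ℝ, EuclideanSpace ℝ (Fin n) →L[ℝ] ℝ) G (c y) (ζ (c y)) := by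
      rw [hGg]
      exact (hg _ (hGsrc hyG)).hasMFDerivAt
    have h2 : HasMFDerivAt (𝓡 n) (𝓡 n) c y (mfderiv (𝓡 n) (𝓡 n) c y) :=
      (hcm.mdifferentiableAt hyc).hasMFDerivAt
    have h3 : mfderiv (𝓡 n) 𝓘(ℝ, EuclideanSpace ℝ (Fin n) →L[ℝ] ℝ) (c.trans G) y =
        (ζ (c y)).comp (mfderiv (𝓡 n) (𝓡 n) c y) := (h1.comp y h2).mfderiv
    rw [h3]
    ext v : 1
    have h4 := DFunLike.congr_fun (hcm.symm_comp_deriv hyc) v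
    have h5 : c.symm (c y) = y := c.left_inv hyc
    change fibreForm σ e φ z (c.symm (c y)) _ = _
    rw [h5]
    exact congrArg (fibreForm σ e φ z y) h4

theorem exists_primitive {z : EuclideanSpace ℝ (Fin n)} (hz : z ∈ chartDomain e φ)
    {k : (EuclideanSpace ℝ (Fin n) →L[ℝ] ℝ) → F}
    (hk : ContMDiff 𝓘(ℝ, EuclideanSpace ℝ (Fin n) →L[ℝ] ℝ) (𝓡 n) ∞ k) :
    ∃ g : (EuclideanSpace ℝ (Fin n) →L[ℝ] ℝ) → EuclideanSpace ℝ (Fin n) →L[ℝ] ℝ, g 0 = 0 ∧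
      ∀ v, HasFDerivAt g (pullbackForm (fibreForm σ e φ z) k v) v := by
  obtain ⟨g, hg⟩ := convex_univ.exists_forall_hasFDerivAt_of_fderiv_symmetric isOpen_univ
    ((h.contDiffOn_pullbackForm hz isOpen_univ hk.contMDiffOn).differentiableOn (by simp))
    (fun y _ v w => h.fderiv_pullbackForm_symm hz isOpen_univ hk.contMDiffOn (mem_univ y) v w)
  exact ⟨fun v => g v - g 0, sub_self _, fun v => (hg v (mem_univ v)).sub_const _⟩

/-- Over the domain of a Lagrangian chart, the period lattices of the fibres have a basis
consisting of closed 1-forms. -/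
theorem exists_period_forms [IsManifold (𝓡 n) ∞ F] [T2Space F] {z₀ : EuclideanSpace ℝ (Fin n)}
    (hz₀ : z₀ ∈ chartDomain e φ) :
    ∃ α : Fin n → EuclideanSpace ℝ (Fin n) → EuclideanSpace ℝ (Fin n) →L[ℝ] ℝ,
      (∀ i, ContDiffOn ℝ ∞ (α i) (chartDomain e φ)) ∧
      (∀ i, ∀ z ∈ chartDomain e φ, ∀ v w, fderiv ℝ (α i) z v w = fderiv ℝ (α i) z w v) ∧
      ∃ y : F, ∀ z ∈ chartDomain e φ, ∃ act, ∃ ha : IsCoframeAction (fibreForm σ e φ z) act,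
        Submodule.span ℤ (range fun i => α i z) = ha.stabilizer y := by
  have := h.fibration.compact_fibre
  have := h.fibration.connected_fibre
  have hflat : ∀ z ∈ chartDomain e φ, IsFlatCoframe (fibreForm σ e φ z) := fun z hz =>
    h.isFlatCoframe_fibreForm hz
  obtain ⟨act₀, ha₀⟩ := (hflat z₀ hz₀).exists_isCoframeAction
  obtain ⟨y⟩ : Nonempty F := inferInstance
  have hdim : Module.finrank ℝ (EuclideanSpace ℝ (Fin n) →L[ℝ] ℝ) = n := by
    rw [← (LinearMap.toContinuousLinearMap (𝕜 := ℝ) (E := EuclideanSpace ℝ (Fin n))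
      (F' := ℝ)).finrank_eq]
    exact Subspace.dual_finrank_eq.trans finrank_euclideanSpace_fin
  obtain ⟨b, hb⟩ := ha₀.exists_basis hdim y
  have hbi : ∀ i, act₀ (b i) y = y := fun i => by
    have : b i ∈ ha₀.stabilizer y := hb ▸ Submodule.subset_span ⟨i, rfl⟩
    exact this
  have hγ : ∀ i, ContMDiff 𝓘(ℝ, ℝ) (𝓡 n) ∞ fun t : ℝ => act₀ (t • b i) y := fun i =>
    (ha₀.contMDiff y).comp (contMDiff_iff_contDiff.2 (by fun_prop))
  -- The loops are the orbit segments from `0` to the periods `b i` at `z₀`. They stay fixed in `F`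
  -- while the form integrated over them varies with `z`.
  refine ⟨fun i z => ∫ t in (0 : ℝ)..1,
    pullbackForm (fibreForm σ e φ z) (fun t : ℝ => act₀ (t • b i) y) t 1,
    fun i => h.contDiffOn_loopIntegral (hγ i), fun i z hz v w =>
      h.fderiv_loopIntegral_symm (hγ i) (fun t => ?_) hz v w, y, fun z hz => ?_⟩
  · rw [add_smul, one_smul, add_comm, ha₀.add_act, hbi]
  · obtain ⟨act, ha⟩ := (hflat z hz).exists_isCoframeAction
    obtain ⟨g, hg0, hg⟩ := h.exists_primitive hz (ha₀.contMDiff y)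
    obtain ⟨g', hg0', hg'⟩ := h.exists_primitive hz₀ (ha.contMDiff y)
    refine ⟨act, ha, ?_⟩
    -- It remains to see that the loop integral is `g (b i)`: `g` is a primitive of the integrand
    -- along the segment and vanishes at `0`.
    rw [← ha₀.span_primitive ha (hflat z₀ hz₀) (hflat z hz) hg0 hg hg0' hg' hb]
    congr 2
    funext i
    have hline : ∀ t : ℝ, HasFDerivAt (fun t : ℝ => t • b i)
        (ContinuousLinearMap.smulRight (1 : ℝ →L[ℝ] ℝ) (b i)) t := fun t =>
      (hasDerivAt_id t).hasFDerivAt.smul_const (b i) |>.congr_fderiv (by ext; simp)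
    have hpull : ∀ t : ℝ, pullbackForm (fibreForm σ e φ z) (fun t : ℝ => act₀ (t • b i) y) t 1 =
        pullbackForm (fibreForm σ e φ z) (fun v => act₀ v y) (t • b i) (b i) := fun t => by
      rw [pullbackForm_comp (k := fun v => act₀ v y) (g := fun t : ℝ => t • b i)
        (ha₀.mdifferentiable y (t • b i)) (hline t)]
      simp
    have hder : ∀ t : ℝ, HasDerivAt (fun t : ℝ => g (t • b i))
        (pullbackForm (fibreForm σ e φ z) (fun t : ℝ => act₀ (t • b i) y) t 1) t := fun t => by
      rw [hpull]
      have h1 : HasDerivAt (fun t : ℝ => t • b i) (b i) t := by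
        simpa using (hasDerivAt_id t).smul_const (b i)
      exact (hg (t • b i)).comp_hasDerivAt t h1
    have hcont : Continuous fun t : ℝ =>
        pullbackForm (fibreForm σ e φ z) (fun t : ℝ => act₀ (t • b i) y) t 1 :=
      (continuousOn_univ.1 (h.contDiffOn_pullbackForm hz isOpen_univ
        (hγ i).contMDiffOn).continuousOn).clm_apply continuous_const
    beta_reduce
    rw [intervalIntegral.integral_eq_sub_of_hasDerivAt (fun t _ => hder t)
      (hcont.intervalIntegrable _ _)]
    simp [hg0]

/-- The Hamiltonian equation for `μ` says that the fibre component of the curve pulls the fibre form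
back to the constant `l`. By uniqueness the curve is the orbit `t ↦ act (t • l)`, which closes at
time `1` exactly when `l` is a period. -/
theorem isPeriodCovector_iff [IsManifold (𝓡 n) ∞ F] [T2Space F]
    {z : EuclideanSpace ℝ (Fin n)} (hz : z ∈ chartDomain e φ)
    {act : (EuclideanSpace ℝ (Fin n) →L[ℝ] ℝ) → F → F}
    (ha : IsCoframeAction (fibreForm σ e φ z) act) (y : F)
    (μ : EuclideanSpace ℝ (Fin n) →L[ℝ] ℝ) :
    IsPeriodCovector σ π (φ.symm z) μ ↔
      act (μ.comp (mfderiv (𝓡 n) (𝓡 n) φ.symm z)) y = y := by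
  have := h.fibration.connected_fibre
  set l : EuclideanSpace ℝ (Fin n) →L[ℝ] ℝ := μ.comp (mfderiv (𝓡 n) (𝓡 n) φ.symm z) with hl
  have hder : ∀ {k : ℝ → F} {t : ℝ} {k' : ℝ →L[ℝ] EuclideanSpace ℝ (Fin n)},
      HasMFDerivAt 𝓘(ℝ, ℝ) (𝓡 n) k t k' →
      HasMFDerivAt 𝓘(ℝ, ℝ) (𝓡 (2 * n)) (fun t => chartParam e φ (z, k t)) t
        ((chartParamDeriv e φ (z, k t)).comp
          ((0 : ℝ →L[ℝ] EuclideanSpace ℝ (Fin n)).prod k')) := by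
    intro k t k' hk
    exact HasMFDerivAt.comp (g := chartParam e φ) t (h.hasMFDerivAt_chartParam hz (k t))
      ((hasMFDerivAt_const z t).prodMk hk)
  have hline : ∀ (x : F) (t : ℝ), pullbackForm (fibreForm σ e φ z)
      (fun t : ℝ => act (t • l) x) t 1 = l := fun x t => by
    have hs : HasFDerivAt (fun t : ℝ => t • l)
        (ContinuousLinearMap.smulRight (1 : ℝ →L[ℝ] ℝ) l) t :=
      (hasDerivAt_id t).hasFDerivAt.smul_const l |>.congr_fderiv (by ext; simp)
    rw [pullbackForm_comp (k := fun v => act v x) (g := fun t : ℝ => t • l)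
      (ha.mdifferentiable x (t • l)) hs, ha.pullback]
    simp
  have hsmooth : ∀ x : F, ContMDiff 𝓘(ℝ, ℝ) (𝓡 n) ∞ fun t : ℝ => act (t • l) x := fun x =>
    (ha.contMDiff x).comp (contMDiff_iff_contDiff.2 (by fun_prop))
  constructor
  · rintro ⟨c, hc, hcπ, hc1, hcσ⟩
    have hcsrc : ∀ t, c t ∈ e.source := fun t => by
      rw [e.source_eq, mem_preimage, hcπ]
      exact hz.2
    set k : ℝ → F := fun t => (e (c t)).2 with hk
    have hks : ContMDiff 𝓘(ℝ, ℝ) (𝓡 n) ∞ k := fun t => contMDiffAt_snd.comp t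
      ((h.smooth_triv.contMDiffAt (e.open_source.mem_nhds (hcsrc t))).comp t (hc t))
    have hck : c = fun t => chartParam e φ (z, k t) := by
      funext t
      have := chartParam_proj (φ := φ) (hcsrc t) (by rw [hcπ]; exact φ.map_target hz.1)
      rw [hcπ, φ.right_inv hz.1] at this
      exact this.symm
    have hpull : ∀ t, pullbackForm (fibreForm σ e φ z) k t 1 = l := by
      intro t
      let k' : ℝ →L[ℝ] EuclideanSpace ℝ (Fin n) := mfderiv 𝓘(ℝ, ℝ) (𝓡 n) k t
      have hk' : HasMFDerivAt 𝓘(ℝ, ℝ) (𝓡 n) k t k' :=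
        ((hks t).mdifferentiableAt (by simp)).hasMFDerivAt
      ext v
      have h1 := hcσ t (chartParamDeriv e φ (z, k t) (v, 0))
      have h2 : mfderiv 𝓘(ℝ, ℝ) (𝓡 (2 * n)) c t = (chartParamDeriv e φ (z, k t)).comp
          ((0 : ℝ →L[ℝ] EuclideanSpace ℝ (Fin n)).prod k') := by
        rw [hck]
        exact (hder hk').mfderiv
      have h3 : (mfderiv 𝓘(ℝ, ℝ) (𝓡 (2 * n)) c t (1 : ℝ) : EuclideanSpace ℝ (Fin (2 * n))) =
          chartParamDeriv e φ (z, k t) (0, k' 1) := DFunLike.congr_fun h2 (1 : ℝ)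
      have h4 : c t = chartParam e φ (z, k t) := congrFun hck t
      have h5 := h.mfderiv_proj_chartParamDeriv hz (k t) v 0
      rw [h3] at h1
      have h6 : σ.bilinAt (c t) (chartParamDeriv e φ (z, k t) (v, 0))
          (chartParamDeriv e φ (z, k t) (0, k' 1)) = fibreForm σ e φ z (k t) (k' 1) v := by
        rw [h4, h.apply_vertical hz]
      have h7 : (mfderiv (𝓡 (2 * n)) (𝓡 n) π (c t) (chartParamDeriv e φ (z, k t) (v, 0)) :
          EuclideanSpace ℝ (Fin n)) = mfderiv (𝓡 n) (𝓡 n) φ.symm z v := by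
        rw [← h5, h4]
      exact (h6.symm.trans h1).trans (congrArg μ h7)
    have heq := (h.isFlatCoframe_fibreForm hz).eqOn_of_pullbackForm_eq (k := k)
      (k' := fun t : ℝ => act (t • l) (k 0)) isOpen_univ isPreconnected_univ
      (hks.mdifferentiable (by simp)).mdifferentiableOn
      ((hsmooth _).mdifferentiable (by simp)).mdifferentiableOn
      (fun t _ => ContinuousLinearMap.ext_ring ((hpull t).trans (hline _ t).symm)) (mem_univ 0)
      (by simp [ha.zero_act])
    have h1 := heq (mem_univ 1)
    simp only [one_smul] at h1
    rw [ha.act_eq_self_iff l y (k 0), ← h1]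
    exact congrArg (fun m => (e m).2) hc1
  · intro hy
    refine ⟨fun t => chartParam e φ (z, act (t • l) y), fun t => ?_, fun t =>
      proj_chartParam hz _, by simp [hy, ha.zero_act], fun t u => ?_⟩
    · exact (h.contMDiffOn_chartParam.contMDiffAt ((isOpen_chartDomain.prod isOpen_univ).mem_nhds
        ⟨hz, mem_univ _⟩)).comp t (contMDiffAt_const.prodMk (hsmooth y t))
    · let k' : ℝ →L[ℝ] EuclideanSpace ℝ (Fin n) :=
        mfderiv 𝓘(ℝ, ℝ) (𝓡 n) (fun t : ℝ => act (t • l) y) t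
      have hk' : HasMFDerivAt 𝓘(ℝ, ℝ) (𝓡 n) (fun t : ℝ => act (t • l) y) t k' :=
        ((hsmooth y t).mdifferentiableAt (by simp)).hasMFDerivAt
      obtain ⟨⟨v, w⟩, rfl⟩ := (h.chartParamDeriv_bijective hz (act (t • l) y)).2 u
      have h3 : (mfderiv 𝓘(ℝ, ℝ) (𝓡 (2 * n)) (fun t : ℝ => chartParam e φ (z, act (t • l) y)) t
          (1 : ℝ) : EuclideanSpace ℝ (Fin (2 * n))) =
          chartParamDeriv e φ (z, act (t • l) y) (0, k' 1) :=
        DFunLike.congr_fun (hder hk').mfderiv (1 : ℝ)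
      rw [h3, h.apply_vertical hz]
      refine (DFunLike.congr_fun (hline y t) v).trans ?_
      exact congrArg μ (h.mfderiv_proj_chartParamDeriv hz _ v w).symm

end IsLagrangianChart

end PeriodLattice

/-! ### Charts of the smooth structure. -/

section MaximalAtlas

open Set

variable {n : ℕ} {B : Type*} [TopologicalSpace B] [ChartedSpace (EuclideanSpace ℝ (Fin n)) B]

theorem mem_contDiffGroupoid_of_contDiffOn
    {G : OpenPartialHomeomorph (EuclideanSpace ℝ (Fin n)) (EuclideanSpace ℝ (Fin n))}
    (hG : ContDiffOn ℝ ∞ G G.source) (hG' : ContDiffOn ℝ ∞ G.symm G.target) :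
    G ∈ contDiffGroupoid ∞ (𝓡 n) := by
  rw [contDiffGroupoid, mem_groupoid_of_pregroupoid]
  simpa [contDiffPregroupoid, Function.comp_def] using ⟨hG, hG'⟩

theorem trans_mem_maximalAtlas {φ : OpenPartialHomeomorph B (EuclideanSpace ℝ (Fin n))}
    (hφ : φ ∈ IsManifold.maximalAtlas (𝓡 n) ∞ B)
    {G : OpenPartialHomeomorph (EuclideanSpace ℝ (Fin n)) (EuclideanSpace ℝ (Fin n))}
    (hG : ContDiffOn ℝ ∞ G G.source) (hG' : ContDiffOn ℝ ∞ G.symm G.target) :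
    φ.trans G ∈ IsManifold.maximalAtlas (𝓡 n) ∞ B := by
  have hGm := mem_contDiffGroupoid_of_contDiffOn hG hG'
  rw [IsManifold.maximalAtlas, mem_maximalAtlas_iff] at hφ ⊢
  intro e' he'
  constructor
  · rw [OpenPartialHomeomorph.trans_symm_eq_symm_trans_symm, OpenPartialHomeomorph.trans_assoc]
    exact (contDiffGroupoid ∞ (𝓡 n)).trans ((contDiffGroupoid ∞ (𝓡 n)).symm hGm) (hφ e' he').1
  · rw [← OpenPartialHomeomorph.trans_assoc]
    exact (contDiffGroupoid ∞ (𝓡 n)).trans (hφ e' he').2 hGm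

theorem contDiffOn_transition [IsManifold (𝓡 n) ∞ B]
    {e e' : OpenPartialHomeomorph B (EuclideanSpace ℝ (Fin n))}
    (he : e ∈ IsManifold.maximalAtlas (𝓡 n) ∞ B) (he' : e' ∈ IsManifold.maximalAtlas (𝓡 n) ∞ B) :
    ContDiffOn ℝ ∞ (e.symm.trans e') (e.symm.trans e').source := by
  rw [← contMDiffOn_iff_contDiffOn]
  exact (contMDiffOn_of_mem_maximalAtlas he').comp
    ((contMDiffOn_symm_of_mem_maximalAtlas he).mono fun x hx => hx.1) fun x hx => hx.2

end MaximalAtlas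

/-! ### Action coordinates. -/

section ActionCoordinates

open Set Filter Topology

variable {n : ℕ} {B M F : Type*}
  [TopologicalSpace B] [ChartedSpace (EuclideanSpace ℝ (Fin n)) B]
  [TopologicalSpace M] [ChartedSpace (EuclideanSpace ℝ (Fin (2 * n))) M]
  [TopologicalSpace F] [ChartedSpace (EuclideanSpace ℝ (Fin n)) F]
  {π : M → B} {σ : TwoForm (2 * n) M}

/-- Bundling `n` linear forms on `ℝⁿ` into an endomorphism. -/
noncomputable def euclideanPi (α : Fin n → EuclideanSpace ℝ (Fin n) →L[ℝ] ℝ) :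
    EuclideanSpace ℝ (Fin n) →L[ℝ] EuclideanSpace ℝ (Fin n) :=
  (EuclideanSpace.equiv (Fin n) ℝ).symm.toContinuousLinearMap.comp (ContinuousLinearMap.pi α)

theorem euclideanPi_apply (α : Fin n → EuclideanSpace ℝ (Fin n) →L[ℝ] ℝ)
    (v : EuclideanSpace ℝ (Fin n)) (i : Fin n) : euclideanPi α v i = α i v := rfl

theorem comp_euclideanPi (l : EuclideanSpace ℝ (Fin n) →L[ℝ] ℝ)
    (α : Fin n → EuclideanSpace ℝ (Fin n) →L[ℝ] ℝ) :
    l.comp (euclideanPi α) = ∑ i, l (EuclideanSpace.single i 1) • α i := by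
  ext v
  have h1 : euclideanPi α v = ∑ i, α i v • EuclideanSpace.single i (1 : ℝ) := by
    ext j
    simp [euclideanPi_apply, Pi.single_apply]
  simp only [ContinuousLinearMap.comp_apply, h1, map_sum, map_smul, smul_eq_mul,
    sum_apply, smul_apply]
  exact Finset.sum_congr rfl fun i _ => mul_comm _ _

/-- A vector killed by a spanning family of functionals is killed by its own coordinates. -/
theorem euclideanPi_bijective {α : Fin n → EuclideanSpace ℝ (Fin n) →L[ℝ] ℝ}
    (hα : ⊤ ≤ Submodule.span ℝ (range α)) : Function.Bijective (euclideanPi α) := by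
  have hinj : Function.Injective (euclideanPi α) := by
    rw [injective_iff_map_eq_zero]
    intro v hv
    have h0 : ∀ i, α i v = 0 := fun i => by
      rw [← euclideanPi_apply, hv]
      rfl
    have hall : ∀ l : EuclideanSpace ℝ (Fin n) →L[ℝ] ℝ, l v = 0 := by
      intro l
      have hl : l ∈ Submodule.span ℝ (range α) := hα Submodule.mem_top
      induction hl using Submodule.span_induction with
      | mem x hx =>
        obtain ⟨i, rfl⟩ := hx
        exact h0 i
      | zero => rfl
      | add x y _ _ hx hy => simp [hx, hy]
      | smul c x _ hx => simp [hx]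
    ext i
    exact hall (EuclideanSpace.proj i)
  exact ⟨hinj, LinearMap.injective_iff_surjective.1 hinj⟩

/-- Action coordinates: around every point of the base there is a chart in which the period
lattice is the standard one. -/
theorem IsLagrangianFibration.exists_action_chart [IsManifold (𝓡 n) ∞ B]
    [IsManifold (𝓡 (2 * n)) ∞ M] [IsManifold (𝓡 n) ∞ F] [T2Space F]
    (hL : IsLagrangianFibration (F := F) σ π) (b₀ : B) :
    ∃ ψ ∈ IsManifold.maximalAtlas (𝓡 n) ∞ B, b₀ ∈ ψ.source ∧
      ∀ b ∈ ψ.source, ∀ l : EuclideanSpace ℝ (Fin n) →L[ℝ] ℝ,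
        IsPeriodCovector σ π b (l.comp (mfderiv (𝓡 n) (𝓡 n) ψ b)) ↔
          ∀ i, ∃ k : ℤ, (k : ℝ) = l (EuclideanSpace.single i 1) := by
  obtain ⟨e, hbe, he, hes⟩ := hL.locallyTrivial b₀
  set φ := chartAt (EuclideanSpace ℝ (Fin n)) b₀ with hφ
  have hφm : φ ∈ IsManifold.maximalAtlas (𝓡 n) ∞ B := IsManifold.chart_mem_maximalAtlas b₀
  have h : IsLagrangianChart σ π e φ := ⟨hL, hφm, he, hes⟩
  have hb₀ : b₀ ∈ φ.source := mem_chart_source _ b₀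
  have hz₀ : φ b₀ ∈ chartDomain e φ := ⟨φ.map_source hb₀, by
    rw [mem_preimage, φ.left_inv hb₀]
    exact hbe⟩
  have := hL.compact_fibre
  have := hL.connected_fibre
  obtain ⟨α, hαs, hαc, y, hα⟩ := h.exists_period_forms hz₀
  have hspan : ∀ z ∈ chartDomain e φ, ⊤ ≤ Submodule.span ℝ (range fun i => α i z) := by
    intro z hz
    obtain ⟨act, ha, hst⟩ := hα z hz
    rw [← (ha.isZLattice_stabilizer y).span_top, ← hst, Submodule.span_le]
    exact Submodule.span_le_restrictScalars ℤ ℝ _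
  have hli : ∀ z ∈ chartDomain e φ, LinearIndependent ℝ fun i => α i z := by
    intro z hz
    refine linearIndependent_of_top_le_span_of_card_eq_finrank (hspan z hz) ?_
    rw [Fintype.card_fin, ← (LinearMap.toContinuousLinearMap (𝕜 := ℝ)
      (E := EuclideanSpace ℝ (Fin n)) (F' := ℝ)).finrank_eq]
    exact (Subspace.dual_finrank_eq.trans finrank_euclideanSpace_fin).symm
  obtain ⟨r, hr, hball⟩ := Metric.isOpen_iff.1 isOpen_chartDomain _ hz₀
  -- The period forms are closed, so on a ball they have primitives; these are the action
  -- coordinates, and their joint derivative is invertible since the forms span.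
  have hprim : ∀ i, ∃ a : EuclideanSpace ℝ (Fin n) → ℝ, ∀ z ∈ Metric.ball (φ b₀) r,
      HasFDerivAt a (α i z) z := fun i =>
    (convex_ball (φ b₀) r).exists_forall_hasFDerivAt_of_fderiv_symmetric Metric.isOpen_ball
      (((hαs i).mono hball).differentiableOn (by simp)) fun z hz => hαc i z (hball hz)
  choose a ha using hprim
  have hder : ∀ z ∈ Metric.ball (φ b₀) r,
      HasFDerivAt (fun z => (WithLp.toLp 2 fun i => a i z : EuclideanSpace ℝ (Fin n)))
        (euclideanPi fun i => α i z) z := fun z hz =>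
    hasFDerivWithinAt_univ.1 <| hasFDerivWithinAt_euclidean.2 fun i => (ha i z hz).hasFDerivWithinAt
  have hsm : ContDiffOn ℝ ∞ (fun z => euclideanPi fun i => α i z) (Metric.ball (φ b₀) r) :=
    contDiffOn_clm_apply.2 fun v => contDiffOn_euclidean.2 fun i =>
      ((hαs i).mono hball).clm_apply contDiffOn_const
  obtain ⟨G, hzG, hGsrc, hGeq, hGs, hGsymm⟩ := exists_openPartialHomeomorph_of_bijective
    Metric.isOpen_ball hsm hder (fun z hz => euclideanPi_bijective (hspan z (hball hz)))
    (Metric.mem_ball_self hr)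
  refine ⟨φ.trans G, trans_mem_maximalAtlas hφm hGs hGsymm, ⟨hb₀, hzG⟩, ?_⟩
  rintro b ⟨hbφ, hbG⟩ l
  have hz : φ b ∈ chartDomain e φ := hball (hGsrc hbG)
  obtain ⟨act, hact, hst⟩ := hα (φ b) hz
  have hbz : φ.symm (φ b) = b := φ.left_inv hbφ
  have hφd : MDifferentiableAt (𝓡 n) (𝓡 n) φ b :=
    (contMDiffAt_of_mem_maximalAtlas hφm hbφ).mdifferentiableAt (by simp)
  have hGd : HasMFDerivAt (𝓡 n) (𝓡 n) G (φ b) (euclideanPi fun i => α i (φ b)) := by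
    rw [hGeq]
    exact (hder _ (hGsrc hbG)).hasMFDerivAt
  have hψd : mfderiv (𝓡 n) (𝓡 n) (φ.trans G) b =
      (euclideanPi fun i => α i (φ b)).comp (mfderiv (𝓡 n) (𝓡 n) φ b) :=
    (hGd.comp b hφd.hasMFDerivAt).mfderiv
  have hφm' : φ.MDifferentiable (𝓡 n) (𝓡 n) := mdifferentiable_chart b₀
  -- Read in the chart `φ`, the covector with action coordinates `l` is the combination of the `α i`
  -- with coefficients the values of `l` on the standard basis.
  have hcomp : (l.comp (mfderiv (𝓡 n) (𝓡 n) (φ.trans G) b)).comp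
      (mfderiv (𝓡 n) (𝓡 n) φ.symm (φ b)) = l.comp (euclideanPi fun i => α i (φ b)) := by
    rw [hψd]
    ext v
    have h1 := DFunLike.congr_fun (hφm'.comp_symm_deriv (φ.map_source hbφ)) v
    have h2 : (mfderiv (𝓡 n) (𝓡 n) φ b : EuclideanSpace ℝ (Fin n) →L[ℝ] EuclideanSpace ℝ (Fin n))
        = mfderiv (𝓡 n) (𝓡 n) φ (φ.symm (φ b)) := by rw [hbz]
    have h3 : (mfderiv (𝓡 n) (𝓡 n) φ b : EuclideanSpace ℝ (Fin n) →L[ℝ] EuclideanSpace ℝ (Fin n))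
        (mfderiv (𝓡 n) (𝓡 n) φ.symm (φ b) v) = v := by
      rw [h2]
      exact h1
    exact congrArg (fun w => l (euclideanPi (fun i => α i (φ b)) w)) h3
  have hiff := h.isPeriodCovector_iff hz hact y (l.comp (mfderiv (𝓡 n) (𝓡 n) (φ.trans G) b))
  rw [hbz] at hiff
  refine hiff.trans ?_
  rw [← hact.mem_stabilizer, ← hst]
  have hc2 : (l.comp (mfderiv (𝓡 n) (𝓡 n) (φ.trans G) b)).comp
      (mfderiv (𝓡 n) (𝓡 n) φ.symm (φ b)) = ∑ i, l (EuclideanSpace.single i 1) • α i (φ b) :=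
    hcomp.trans (comp_euclideanPi l _)
  let bas := Module.Basis.mk (hli _ hz) (hspan _ hz)
  have hbas : (⇑bas) = fun i => α i (φ b) := Module.Basis.coe_mk _ _
  have hrepr : ∀ i, bas.repr (∑ i, l (EuclideanSpace.single i 1) • α i (φ b)) i =
      l (EuclideanSpace.single i 1) := by
    intro i
    have : ∑ i, l (EuclideanSpace.single i 1) • α i (φ b) =
        ∑ i, l (EuclideanSpace.single i 1) • bas i := by
      simp only [hbas]
    rw [this, bas.repr_sum_self]
  have key : (∑ i, l (EuclideanSpace.single i 1) • α i (φ b)) ∈ Submodule.span ℤ (range bas) ↔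
      ∀ i, ∃ k : ℤ, (k : ℝ) = l (EuclideanSpace.single i 1) := by
    rw [bas.mem_span_iff_repr_mem ℤ]
    simp only [hrepr]
    rfl
  rw [hbas] at key
  exact (iff_of_eq (congrArg (· ∈ Submodule.span ℤ (range fun i => α i (φ b))) hc2)).trans key

end ActionCoordinates

/-! ### Integer matrices and integral affine maps. -/

section IntegralLinear

open Set Topology

variable {n : ℕ}

/-- The endomorphism of `ℝⁿ` given by an integer matrix. -/
noncomputable def integerLinear (P : Matrix (Fin n) (Fin n) ℤ) :
    EuclideanSpace ℝ (Fin n) →L[ℝ] EuclideanSpace ℝ (Fin n) :=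
  (Matrix.toEuclideanLin (P.map (Int.cast : ℤ → ℝ))).toContinuousLinearMap

theorem integerLinear_apply (P : Matrix (Fin n) (Fin n) ℤ)
    (v : EuclideanSpace ℝ (Fin n)) (i : Fin n) :
    integerLinear P v i = ∑ j, (P i j : ℝ) * v j := rfl

/-- The linear part of an integral affine transformation. -/
noncomputable def integralLinear (A : Matrix.GeneralLinearGroup (Fin n) ℤ) :
    EuclideanSpace ℝ (Fin n) →L[ℝ] EuclideanSpace ℝ (Fin n) :=
  integerLinear A.val

theorem integralAffineMap_eq (A : Matrix.GeneralLinearGroup (Fin n) ℤ)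
    (c x : EuclideanSpace ℝ (Fin n)) : integralAffineMap A c x = integralLinear A x + c := rfl

theorem integralLinear_apply (A : Matrix.GeneralLinearGroup (Fin n) ℤ)
    (v : EuclideanSpace ℝ (Fin n)) (i : Fin n) :
    integralLinear A v i = ∑ j, (A.val i j : ℝ) * v j := rfl

theorem integralLinear_single (A : Matrix.GeneralLinearGroup (Fin n) ℤ) (i j : Fin n) :
    integralLinear A (EuclideanSpace.single i 1) j = A.val j i := by
  simp [integralLinear_apply]

theorem euclidean_clm_ext {D D' : EuclideanSpace ℝ (Fin n) →L[ℝ] EuclideanSpace ℝ (Fin n)}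
    (h : ∀ i j, D (EuclideanSpace.single i 1) j = D' (EuclideanSpace.single i 1) j) : D = D' := by
  apply ContinuousLinearMap.coe_injective
  refine (EuclideanSpace.basisFun (Fin n) ℝ).toBasis.ext fun i => ?_
  ext j
  simpa using h i j

/-- Coordinate functionals, tested directly and after composition with `D'`, show that both `D` and
`D'` have integer entries; being mutually inverse, they give an element of `GL(n, ℤ)`. -/
theorem exists_integralLinear_eq
    {D D' : EuclideanSpace ℝ (Fin n) →L[ℝ] EuclideanSpace ℝ (Fin n)}
    (h₁ : ∀ v, D (D' v) = v) (h₂ : ∀ v, D' (D v) = v)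
    (hD : ∀ l : EuclideanSpace ℝ (Fin n) →L[ℝ] ℝ,
      (∀ i, ∃ k : ℤ, (k : ℝ) = l (D (EuclideanSpace.single i 1))) ↔
        ∀ i, ∃ k : ℤ, (k : ℝ) = l (EuclideanSpace.single i 1)) :
    ∃ A : Matrix.GeneralLinearGroup (Fin n) ℤ, D = integralLinear A := by
  have hproj : ∀ j : Fin n, ∀ i, ∃ k : ℤ, (k : ℝ) =
      (EuclideanSpace.proj j : EuclideanSpace ℝ (Fin n) →L[ℝ] ℝ) (EuclideanSpace.single i 1) := by
    intro j i
    refine ⟨if j = i then 1 else 0, ?_⟩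
    simp
  have hP : ∀ j i, ∃ k : ℤ, (k : ℝ) = D (EuclideanSpace.single i 1) j := fun j =>
    (hD (EuclideanSpace.proj j)).2 (hproj j)
  have hQ : ∀ j i, ∃ k : ℤ, (k : ℝ) = D' (EuclideanSpace.single i 1) j := fun j =>
    (hD ((EuclideanSpace.proj j).comp D')).1 fun i => by
      simpa [h₂] using hproj j i
  choose P hP using hP
  choose Q hQ using hQ
  have expand : ∀ v : EuclideanSpace ℝ (Fin n), v = ∑ i, v i • EuclideanSpace.single i (1 : ℝ) := by
    intro v
    ext j
    simp [Pi.single_apply]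
  have hDv : ∀ v j, D v j = ∑ i, (P j i : ℝ) * v i := by
    intro v j
    conv_lhs => rw [expand v]
    simp [hP, mul_comm]
  have hDv' : ∀ v j, D' v j = ∑ i, (Q j i : ℝ) * v i := by
    intro v j
    conv_lhs => rw [expand v]
    simp [hQ, mul_comm]
  have hPQ : (Matrix.of P) * (Matrix.of Q) = 1 := by
    ext j i
    have := congrArg (fun w : EuclideanSpace ℝ (Fin n) => w j) (h₁ (EuclideanSpace.single i 1))
    simp only [hDv, ← hQ] at this
    have h3 : (EuclideanSpace.single i (1 : ℝ) : EuclideanSpace ℝ (Fin n)) j =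
        (((1 : Matrix (Fin n) (Fin n) ℤ) j i : ℤ) : ℝ) := by
      simp [Matrix.one_apply]
    rw [h3] at this
    simp only [Matrix.mul_apply, Matrix.of_apply]
    exact_mod_cast this
  refine ⟨⟨Matrix.of P, Matrix.of Q, hPQ, mul_eq_one_comm.1 hPQ⟩, euclidean_clm_ext fun i j => ?_⟩
  rw [integralLinear_single, ← hP]
  rfl

/-- The entries of the derivative are continuous and integer valued, hence constant on a connected
set. -/
theorem exists_integralAffineMap_eq {f : EuclideanSpace ℝ (Fin n) → EuclideanSpace ℝ (Fin n)}
    {S : Set (EuclideanSpace ℝ (Fin n))} (hS : IsOpen S) (hSc : IsPreconnected S)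
    (hf : ContDiffOn ℝ ∞ f S) (h : ∀ x ∈ S, ∃ A, fderiv ℝ f x = integralLinear A) :
    ∃ A c, ∀ x ∈ S, f x = integralAffineMap A c x := by
  rcases S.eq_empty_or_nonempty with rfl | ⟨x₀, hx₀⟩
  · exact ⟨1, 0, by simp⟩
  obtain ⟨A, hA⟩ := h x₀ hx₀
  have hc : ContinuousOn (fderiv ℝ f) S := hf.continuousOn_fderiv_of_isOpen hS (by simp)
  have hconst : ∀ x ∈ S, fderiv ℝ f x = integralLinear A := by
    intro x hx
    refine euclidean_clm_ext fun i j => ?_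
    rw [← hA]
    have hcont : ContinuousOn (fun x => fderiv ℝ f x (EuclideanSpace.single i 1) j) S :=
      (EuclideanSpace.proj j : EuclideanSpace ℝ (Fin n) →L[ℝ] ℝ).continuous.comp_continuousOn
        (hc.clm_apply continuousOn_const)
    refine hSc.constant_of_mapsTo (T := range ((↑) : ℤ → ℝ)) ?_ hcont ?_ hx hx₀
    · exact Int.isClosedEmbedding_coe_real.isEmbedding.isDiscrete_range
    · intro y hy
      obtain ⟨A', hA'⟩ := h y hy
      exact ⟨A'.val j i, by simp only [hA', integralLinear_single]⟩
  refine ⟨A, f x₀ - integralLinear A x₀, fun x hx => ?_⟩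
  refine hS.eqOn_of_fderiv_eq (𝕜 := ℝ) (g := integralAffineMap A (f x₀ - integralLinear A x₀)) hSc
    (hf.differentiableOn (by simp)) ?_ ?_ hx₀ ?_ hx
  · exact ((integralLinear A).differentiable.add_const _).differentiableOn
  · intro y hy
    rw [hconst y hy]
    exact (((integralLinear A).hasFDerivAt (x := y)).add_const _).fderiv.symm
  · simp [integralAffineMap_eq]

end IntegralLinear

/-! ### Refining an atlas until each overlap carries one affine map. -/

section Refinement

open Set Topology

variable {n : ℕ} {B : Type*} [TopologicalSpace B] [ChartedSpace (EuclideanSpace ℝ (Fin n)) B]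

/-- An atlas whose transition functions have differentials in `GL(n, ℤ)` can be refined to one whose
transition functions are restrictions of integral affine maps. -/
theorem isIntegralAffineManifold_of_fderiv [IsManifold (𝓡 n) ∞ B] [T2Space B]
    [SecondCountableTopology B] (𝒞 : Set (OpenPartialHomeomorph B (EuclideanSpace ℝ (Fin n))))
    (h𝒞 : 𝒞 ⊆ IsManifold.maximalAtlas (𝓡 n) ∞ B) (hcov : ∀ b, ∃ e ∈ 𝒞, b ∈ e.source)
    (h : ∀ e ∈ 𝒞, ∀ e' ∈ 𝒞, ∀ x ∈ (e.symm.trans e').source,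
      ∃ A, fderiv ℝ (e.symm.trans e') x = integralLinear A) :
    IsIntegralAffineManifold n B := by
  have : LocallyCompactSpace B := ChartedSpace.locallyCompactSpace (EuclideanSpace ℝ (Fin n)) B
  have : TopologicalSpace.MetrizableSpace B := Manifold.metrizableSpace (𝓡 n) B
  let := TopologicalSpace.metrizableSpaceMetric B
  choose c hc hcs using hcov
  -- The factor `4` leaves room for the triangle inequality in `hnear`, where distances add up to
  -- less than `r a + r a + r b ≤ 3 * r b`.
  have hr : ∀ b, ∃ r > 0, Metric.ball b (4 * r) ⊆ (c b).source := by
    intro b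
    obtain ⟨ε, hε, hb⟩ := Metric.isOpen_iff.1 (c b).open_source b (hcs b)
    exact ⟨ε / 4, by positivity, by rwa [mul_div_cancel₀ _ (by norm_num)]⟩
  choose r hr hrs using hr
  have hδ : ∀ b, ∃ δ > 0, Metric.ball (c b b) δ ⊆
      (c b).target ∩ (c b).symm ⁻¹' Metric.ball b (r b) := by
    intro b
    refine Metric.isOpen_iff.1 ((c b).isOpen_inter_preimage_symm Metric.isOpen_ball) _
      ⟨(c b).map_source (hcs b), ?_⟩
    rw [mem_preimage, (c b).left_inv (hcs b)]
    exact Metric.mem_ball_self (hr b)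
  choose δ hδ hδs using hδ
  let V : B → Set B := fun b => (c b).symm '' Metric.ball (c b b) (δ b)
  have hVo : ∀ b, IsOpen (V b) := fun b =>
    (c b).isOpen_image_symm_of_subset_target Metric.isOpen_ball fun x hx => (hδs b hx).1
  have hVc : ∀ b, IsPreconnected (V b) := fun b =>
    (convex_ball _ _).isPreconnected.image _
      ((c b).continuousOn_symm.mono fun x hx => (hδs b hx).1)
  have hVball : ∀ b, V b ⊆ Metric.ball b (r b) := by
    rintro b _ ⟨x, hx, rfl⟩
    exact (hδs b hx).2
  have hVs : ∀ b, V b ⊆ (c b).source := fun b => (hVball b).trans <|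
    (Metric.ball_subset_ball (by linarith [hr b])).trans (hrs b)
  have hVself : ∀ b, b ∈ V b := fun b =>
    ⟨c b b, Metric.mem_ball_self (hδ b), (c b).left_inv (hcs b)⟩
  -- Of two small domains that meet, the one of smaller radius lies in the full chart domain of the
  -- other. The transition is thus defined on a connected set containing the overlap, which itself
  -- may be disconnected.
  have hnear : ∀ a b, (V a ∩ V b).Nonempty → r a ≤ r b → V a ⊆ (c b).source := by
    rintro a b ⟨z, hza, hzb⟩ hab w hw
    refine hrs b ?_
    have h1 := hVball a hza
    have h2 := hVball b hzb
    have h3 := hVball a hw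
    rw [Metric.mem_ball] at h1 h2 h3 ⊢
    have := dist_triangle w a b
    have := dist_triangle a z b
    rw [dist_comm a z] at this
    linarith [hr b]
  have haff : ∀ a b, ∀ W : Set B, IsOpen W → IsPreconnected W → W ⊆ (c a).source →
      W ⊆ (c b).source → ∃ A t, ∀ x ∈ c a '' W, ((c a).symm.trans (c b)) x =
        integralAffineMap A t x := by
    intro a b W hWo hWc ha hb
    have hsub : c a '' W ⊆ ((c a).symm.trans (c b)).source := by
      rintro _ ⟨w, hw, rfl⟩
      refine ⟨(c a).map_source (ha hw), ?_⟩
      change (c a).symm (c a w) ∈ (c b).source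
      rw [(c a).left_inv (ha hw)]
      exact hb hw
    exact exists_integralAffineMap_eq ((c a).isOpen_image_of_subset_source hWo ha)
      (hWc.image _ ((c a).continuousOn.mono ha))
      ((contDiffOn_transition (h𝒞 (hc a)) (h𝒞 (hc b))).mono hsub)
      fun x hx => h _ (hc a) _ (hc b) x (hsub hx)
  refine ⟨range fun b => (c b).restr (V b), ?_, fun b => ⟨_, mem_range_self b, ?_⟩, ?_⟩
  · rintro _ ⟨b, rfl⟩
    exact restr_mem_maximalAtlas _ (h𝒞 (hc b)) (hVo b)
  · rw [OpenPartialHomeomorph.restr_source' _ _ (hVo b)]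
    exact ⟨hcs b, hVself b⟩
  · rintro _ ⟨a, rfl⟩ _ ⟨b, rfl⟩
    have hsrc : ∀ x ∈ (((c a).restr (V a)).symm.trans ((c b).restr (V b))).source,
        x ∈ (c a).target ∧ (c a).symm x ∈ V a ∧ (c a).symm x ∈ V b := by
      rintro x ⟨hx1, hx2⟩
      have h1 : (c a).symm x ∈ ((c a).restr (V a)).source :=
        ((c a).restr (V a)).symm.map_source hx1
      rw [OpenPartialHomeomorph.restr_source' _ _ (hVo a)] at h1
      rw [OpenPartialHomeomorph.restr_source' _ _ (hVo b)] at hx2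
      exact ⟨hx1.1, h1.2, hx2.2⟩
    rcases (V a ∩ V b).eq_empty_or_nonempty with he | hne
    · refine ⟨1, 0, fun x hx => ?_⟩
      have := hsrc x hx
      exact absurd (show (c a).symm x ∈ V a ∩ V b from this.2) (by simp [he])
    rcases le_total (r a) (r b) with hab | hab
    · obtain ⟨A, t, hA⟩ := haff a b (V a) (hVo a) (hVc a) (hVs a) (hnear a b hne hab)
      exact ⟨A, t, fun x hx => hA x ⟨_, (hsrc x hx).2.1, (c a).right_inv (hsrc x hx).1⟩⟩
    · obtain ⟨A, t, hA⟩ := haff a b (V b) (hVo b) (hVc b)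
        (hnear b a (by rwa [inter_comm]) hab) (hVs b)
      exact ⟨A, t, fun x hx => hA x ⟨_, (hsrc x hx).2.2, (c a).right_inv (hsrc x hx).1⟩⟩

end Refinement

/-! ### From a Lagrangian fibration to an integral affine structure. -/

section Forward

open Set Topology

variable {n : ℕ} {B M F : Type*}
  [TopologicalSpace B] [ChartedSpace (EuclideanSpace ℝ (Fin n)) B]
  [TopologicalSpace M] [ChartedSpace (EuclideanSpace ℝ (Fin (2 * n))) M]
  [TopologicalSpace F] [ChartedSpace (EuclideanSpace ℝ (Fin n)) F]
  {π : M → B} {σ : TwoForm (2 * n) M}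

/-- Two action charts identify the same set of period covectors with `ℤⁿ`, so the derivative of
their transition preserves integrality of covectors in both directions. -/
theorem IsLagrangianFibration.isIntegralAffineManifold [IsManifold (𝓡 n) ∞ B] [T2Space B]
    [SecondCountableTopology B] [IsManifold (𝓡 (2 * n)) ∞ M] [IsManifold (𝓡 n) ∞ F] [T2Space F]
    (hL : IsLagrangianFibration (F := F) σ π) : IsIntegralAffineManifold n B := by
  refine isIntegralAffineManifold_of_fderiv
    {ψ | ψ ∈ IsManifold.maximalAtlas (𝓡 n) ∞ B ∧
      ∀ b ∈ ψ.source, ∀ l : EuclideanSpace ℝ (Fin n) →L[ℝ] ℝ,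
        IsPeriodCovector σ π b (l.comp (mfderiv (𝓡 n) (𝓡 n) ψ b)) ↔
          ∀ i, ∃ k : ℤ, (k : ℝ) = l (EuclideanSpace.single i 1)} (fun ψ hψ => hψ.1) ?_ ?_
  · intro b
    obtain ⟨ψ, hψ, hb, hp⟩ := hL.exists_action_chart b
    exact ⟨ψ, ⟨hψ, hp⟩, hb⟩
  rintro e ⟨he, hep⟩ e' ⟨he', hep'⟩ x ⟨hx, hx'⟩
  set b := e.symm x with hb
  have hbe : b ∈ e.source := e.map_target hx
  have hbx : e b = x := e.right_inv hx
  let K : EuclideanSpace ℝ (Fin n) →L[ℝ] EuclideanSpace ℝ (Fin n) := mfderiv (𝓡 n) (𝓡 n) e b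
  let K' : EuclideanSpace ℝ (Fin n) →L[ℝ] EuclideanSpace ℝ (Fin n) := mfderiv (𝓡 n) (𝓡 n) e' b
  let S : EuclideanSpace ℝ (Fin n) →L[ℝ] EuclideanSpace ℝ (Fin n) := mfderiv (𝓡 n) (𝓡 n) e.symm x
  let S' : EuclideanSpace ℝ (Fin n) →L[ℝ] EuclideanSpace ℝ (Fin n) :=
    mfderiv (𝓡 n) (𝓡 n) e'.symm (e' b)
  have hmd : ∀ {ψ}, ψ ∈ IsManifold.maximalAtlas (𝓡 n) ∞ B → ψ.MDifferentiable (𝓡 n) (𝓡 n) :=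
    fun {ψ} hψ => ⟨(contMDiffOn_of_mem_maximalAtlas hψ).mdifferentiableOn (by simp),
      (contMDiffOn_symm_of_mem_maximalAtlas hψ).mdifferentiableOn (by simp)⟩
  have hKS : ∀ v, K (S v) = v := fun v => DFunLike.congr_fun ((hmd he).comp_symm_deriv hx) v
  have hSK : ∀ v, S (K v) = v := by
    have := (hmd he).symm_comp_deriv hbe
    rw [hbx] at this
    exact fun v => DFunLike.congr_fun this v
  have hSK' : ∀ v, S' (K' v) = v := fun v =>
    DFunLike.congr_fun ((hmd he').symm_comp_deriv hx') v
  have hKS' : ∀ v, K' (S' v) = v := by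
    have := (hmd he').comp_symm_deriv (e'.map_source hx')
    rw [e'.left_inv hx'] at this
    exact fun v => DFunLike.congr_fun this v
  have hd : fderiv ℝ (e.symm.trans e') x = K'.comp S := by
    rw [← mfderiv_eq_fderiv]
    have h1 : HasMFDerivAt (𝓡 n) (𝓡 n) e.symm x S := ((hmd he).symm.mdifferentiableAt hx).hasMFDerivAt
    have h2 : HasMFDerivAt (𝓡 n) (𝓡 n) e' (e.symm x) K' :=
      ((hmd he').mdifferentiableAt hx').hasMFDerivAt
    exact (HasMFDerivAt.comp (g := e') (f := e.symm) x h2 h1).mfderiv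
  rw [hd]
  refine exists_integralLinear_eq (D' := K.comp S') (fun v => ?_) (fun v => ?_) fun l => ?_
  · change K' (S (K (S' v))) = v
    rw [hSK, hKS']
  · change K (S' (K' (S v))) = v
    rw [hSK', hKS]
  · have h1 := hep b hbe (l.comp (K'.comp S))
    have h2 := hep' b hx' l
    have h3 : ((l.comp (K'.comp S)).comp K : EuclideanSpace ℝ (Fin n) →L[ℝ] ℝ) = l.comp K' := by
      ext v
      change l (K' (S (K v))) = l (K' v)
      rw [hSK]
    refine h1.symm.trans (Iff.trans ?_ h2)
    exact iff_of_eq (congrArg (IsPeriodCovector σ π b) h3)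

theorem IsBaseOfLagrangianFibration.isIntegralAffineManifold (n : ℕ) (B : Type u)
    [TopologicalSpace B] [T2Space B] [SecondCountableTopology B]
    [ChartedSpace (EuclideanSpace ℝ (Fin n)) B] [IsManifold (𝓡 n) ∞ B]
    (h : IsBaseOfLagrangianFibration n B) : IsIntegralAffineManifold n B := by
  obtain ⟨M, _, _, F, _, _, ⟨_, _, _⟩, ⟨_, _, _⟩, σ, π, hL⟩ := h
  exact hL.isIntegralAffineManifold

end Forward

/-! ### Functoriality of integer matrices acting on `ℝⁿ`. -/

section IntegerLinear

variable {n : ℕ}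

theorem integerLinear_single (P : Matrix (Fin n) (Fin n) ℤ) (i j : Fin n) :
    integerLinear P (EuclideanSpace.single i 1) j = P j i := by
  simp [integerLinear_apply]

theorem integerLinear_one : integerLinear (1 : Matrix (Fin n) (Fin n) ℤ) = .id ℝ _ := by
  refine euclidean_clm_ext fun i j => ?_
  rw [integerLinear_single]
  simp [Matrix.one_apply]

theorem integerLinear_mul (P Q : Matrix (Fin n) (Fin n) ℤ) :
    integerLinear (P * Q) = (integerLinear P).comp (integerLinear Q) := by
  refine euclidean_clm_ext fun i j => ?_
  rw [integerLinear_single, ContinuousLinearMap.comp_apply, integerLinear_apply]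
  simp [integerLinear_single, Matrix.mul_apply]

theorem integerLinear_injective :
    Function.Injective (integerLinear : Matrix (Fin n) (Fin n) ℤ → _) := by
  intro P Q h
  ext j i
  have := congrArg (fun L => L (EuclideanSpace.single i 1) j) h
  simp only [integerLinear_single] at this
  exact_mod_cast this

open scoped RealInnerProductSpace in
theorem inner_integerLinear_transpose (P : Matrix (Fin n) (Fin n) ℤ)
    (v w : EuclideanSpace ℝ (Fin n)) :
    ⟪v, integerLinear P.transpose w⟫ = ⟪integerLinear P v, w⟫ := by
  simp only [PiLp.inner_apply, integerLinear_apply, Matrix.transpose_apply, RCLike.inner_apply,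
    conj_trivial, Finset.sum_mul, Finset.mul_sum, map_sum, map_mul]
  rw [Finset.sum_comm]
  exact Finset.sum_congr rfl fun i _ => Finset.sum_congr rfl fun j _ => by ring

end IntegerLinear

/-! ### The torus as a smooth manifold covered by `ℝⁿ`. -/

section Torus

open Set Topology Filter

/-- The torus `(ℝ/ℤ)ⁿ`, in an arbitrary universe. -/
abbrev Torus (n : ℕ) : Type u := ULift.{u} (Fin n) → AddCircle (1 : ℝ)

variable {n : ℕ}

/-- The universal covering of the torus. -/
def torusMk (v : EuclideanSpace ℝ (Fin n)) : Torus.{u} n := fun i => (v i.down : AddCircle (1 : ℝ))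

/-- The endomorphism of the torus given by an integer matrix. -/
def torusEnd (P : Matrix (Fin n) (Fin n) ℤ) (θ : Torus.{u} n) : Torus.{u} n :=
  fun i => ∑ j, P i.down j • θ ⟨j⟩

theorem continuous_torusEnd (P : Matrix (Fin n) (Fin n) ℤ) :
    Continuous (torusEnd.{u} P) := by
  unfold torusEnd
  fun_prop

theorem torusEnd_one (θ : Torus.{u} n) : torusEnd 1 θ = θ := by
  ext i
  simp [torusEnd, Matrix.one_apply]

theorem torusEnd_mul (P Q : Matrix (Fin n) (Fin n) ℤ) (θ : Torus.{u} n) :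
    torusEnd (P * Q) θ = torusEnd P (torusEnd Q θ) := by
  ext i
  simp only [torusEnd, Matrix.mul_apply, Finset.sum_smul, Finset.smul_sum, mul_smul]
  rw [Finset.sum_comm]

theorem torusEnd_torusMk (P : Matrix (Fin n) (Fin n) ℤ) (v : EuclideanSpace ℝ (Fin n)) :
    torusEnd P (torusMk.{u} v) = torusMk (integerLinear P v) := by
  ext i
  refine Eq.trans (Finset.sum_congr rfl fun j _ => ?_)
    (map_sum (QuotientAddGroup.mk' (AddSubgroup.zmultiples (1 : ℝ)))
      (fun j => (P i.down j : ℝ) * v j) Finset.univ).symm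
  rw [← zsmul_eq_mul]
  rfl

theorem isOpenQuotientMap_torusMk : IsOpenQuotientMap (torusMk.{u} (n := n)) := by
  have h := IsOpenQuotientMap.piMap (fun _ : ULift.{u} (Fin n) =>
    (AddCircle.isAddQuotientCoveringMap_coe (1 : ℝ)).isOpenQuotientMap)
  have h' : IsOpenQuotientMap (fun (v : EuclideanSpace ℝ (Fin n)) (i : ULift.{u} (Fin n)) =>
      v i.down) :=
    ((EuclideanSpace.equiv (Fin n) ℝ).toHomeomorph.trans
      (Homeomorph.piCongrLeft (Y := fun _ => ℝ) Equiv.ulift.{u}).symm).isOpenQuotientMap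
  exact h.comp h'

theorem torusMk_surjective : Function.Surjective (torusMk.{u} (n := n)) :=
  isOpenQuotientMap_torusMk.surjective

/-- Coordinates of the difference are integers of absolute value below `1`. -/
theorem eq_of_torusMk_eq {v w : EuclideanSpace ℝ (Fin n)} (h : torusMk.{u} v = torusMk w)
    (hd : dist v w < 1) : v = w := by
  ext i
  have h1 : ((v i : ℝ) : AddCircle (1 : ℝ)) = (w i : ℝ) := congrFun h ⟨i⟩
  obtain ⟨k, hk⟩ := (AddCircle.coe_eq_zero_iff (1 : ℝ) (x := v i - w i)).1
    (by rw [AddCircle.coe_sub, h1, sub_self] : ((v i - w i : ℝ) : AddCircle (1 : ℝ)) = 0)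
  have h2 : |v i - w i| < 1 := by
    rw [dist_eq_norm] at hd
    exact (PiLp.norm_apply_le (v - w) i).trans_lt hd
  have h3 : (k : ℝ) = v i - w i := by simpa using hk
  have h5 : |(k : ℝ)| < 1 := by rwa [h3]
  have h4 : k = 0 := Int.abs_lt_one_iff.1 (by exact_mod_cast h5)
  rw [h4, Int.cast_zero] at h3
  linarith

theorem isLocalHomeomorph_torusMk : IsLocalHomeomorph (torusMk.{u} (n := n)) := by
  rw [isLocalHomeomorph_iff_isOpenEmbedding_restrict]
  intro v
  refine ⟨Metric.ball v (1 / 2), Metric.ball_mem_nhds _ (by norm_num), ?_⟩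
  refine .of_continuous_injective_isOpenMap
    (isOpenQuotientMap_torusMk.continuous.comp continuous_subtype_val) ?_
    (isOpenQuotientMap_torusMk.isOpenMap.domRestrict Metric.isOpen_ball)
  intro a b hab
  refine Subtype.ext (eq_of_torusMk_eq hab ?_)
  have ha := a.2
  have hb := b.2
  rw [Metric.mem_ball] at ha hb
  have := dist_triangle_right a.1 b.1 v
  linarith

/-- Two continuous maps with the same projection to the torus differ by a locally constant map. -/
theorem eventuallyEq_of_torusMk_eq {X : Type*} [TopologicalSpace X] {S : Set X} (hS : IsOpen S)
    {f g : X → EuclideanSpace ℝ (Fin n)} (hf : ContinuousOn f S) (hg : ContinuousOn g S)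
    (h : ∀ x ∈ S, torusMk.{u} (f x) = torusMk (g x)) {x₀ : X} (hx₀ : x₀ ∈ S) :
    f =ᶠ[𝓝 x₀] fun x => g x + (f x₀ - g x₀) := by
  have hc : ContinuousAt (fun x => dist (f x) (g x + (f x₀ - g x₀))) x₀ :=
    ((hf.continuousAt (hS.mem_nhds hx₀)).dist
      ((hg.continuousAt (hS.mem_nhds hx₀)).add continuousAt_const))
  -- After correction by the difference at `x₀`, the two lifts are close near `x₀`; lifts of the
  -- same point at distance below `1` coincide.
  have h1 : ∀ᶠ x in 𝓝 x₀, dist (f x) (g x + (f x₀ - g x₀)) < 1 :=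
    hc.eventually_lt continuousAt_const (by simp)
  filter_upwards [h1, hS.mem_nhds hx₀] with x hx hxS
  refine eq_of_torusMk_eq.{u} ?_ hx
  have h2 := h x hxS
  have h3 := h x₀ hx₀
  ext i
  have h2i := congrFun h2 i
  have h3i := congrFun h3 i
  simp only [torusMk] at h2i h3i ⊢
  rw [h2i]
  simp [h3i]

noncomputable instance : ChartedSpace (EuclideanSpace ℝ (Fin n)) (Torus.{u} n) :=
  isLocalHomeomorph_torusMk.chartedSpace torusMk_surjective

theorem torusMk_chartAt {θ θ' : Torus.{u} n}
    (h : θ' ∈ (chartAt (EuclideanSpace ℝ (Fin n)) θ).source) :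
    torusMk (chartAt (EuclideanSpace ℝ (Fin n)) θ θ') = θ' :=
  isLocalHomeomorph_torusMk.apply_localInverseAt_of_mem h.1

theorem chartAt_torus_symm (θ : Torus.{u} n) :
    ⇑(chartAt (EuclideanSpace ℝ (Fin n)) θ).symm = torusMk :=
  isLocalHomeomorph_torusMk.localInverseAt_symm _

/-- Charts are local inverses of the covering, so transition functions are locally translations. -/
instance : IsManifold (𝓡 n) ∞ (Torus.{u} n) := by
  have key : ∀ θ θ' : Torus.{u} n, ContDiffOn ℝ ∞
      ((chartAt (EuclideanSpace ℝ (Fin n)) θ).symm.trans (chartAt (EuclideanSpace ℝ (Fin n)) θ'))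
      ((chartAt (EuclideanSpace ℝ (Fin n)) θ).symm.trans
        (chartAt (EuclideanSpace ℝ (Fin n)) θ')).source := by
    intro θ θ' x hx
    refine ContDiffAt.contDiffWithinAt ?_
    set G := (chartAt (EuclideanSpace ℝ (Fin n)) θ).symm.trans
      (chartAt (EuclideanSpace ℝ (Fin n)) θ') with hG
    have h := eventuallyEq_of_torusMk_eq.{u} G.open_source G.continuousOn continuousOn_id
      (fun y hy => (torusMk_chartAt hy.2).trans (congrFun (chartAt_torus_symm θ) y)) hx
    exact (contDiffAt_id.add contDiffAt_const).congr_of_eventuallyEq h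
  have : HasGroupoid (Torus.{u} n) (contDiffGroupoid ∞ (𝓡 n)) := by
    refine ⟨?_⟩
    rintro _ _ ⟨θ, rfl⟩ ⟨θ', rfl⟩
    exact mem_contDiffGroupoid_of_contDiffOn (key θ θ') (key θ' θ)
  exact IsManifold.mk' _ _ _

theorem contMDiff_torusMk : ContMDiff (𝓡 n) (𝓡 n) ∞ (torusMk.{u} (n := n)) := by
  intro v
  set c := chartAt (EuclideanSpace ℝ (Fin n)) (torusMk.{u} v) with hc
  have hcont : Continuous (torusMk.{u} (n := n)) := isOpenQuotientMap_torusMk.continuous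
  have hS : IsOpen (torusMk.{u} ⁻¹' c.source) := c.open_source.preimage hcont
  have hv : v ∈ torusMk.{u} ⁻¹' c.source :=
    mem_chart_source (EuclideanSpace ℝ (Fin n)) (torusMk.{u} v)
  have h := eventuallyEq_of_torusMk_eq.{u} hS
    (c.continuousOn.comp hcont.continuousOn fun x hx => hx) continuousOn_id
    (fun y hy => torusMk_chartAt hy) hv
  refine contMDiffAt_iff_target.2 ⟨hcont.continuousAt, ?_⟩
  rw [contMDiffAt_iff_contDiffAt]
  exact (contDiffAt_id.add contDiffAt_const).congr_of_eventuallyEq h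

end Torus

/-! ### Separation and countability of a total space. -/

section BundleTopology

open Set Topology

variable {B M F : Type*} [TopologicalSpace B] [TopologicalSpace M] [TopologicalSpace F] {π : M → B}

theorem t2Space_of_trivialization [T2Space B] [T2Space F] (hπ : Continuous π)
    (h : ∀ b, ∃ e : Bundle.Trivialization F π, b ∈ e.baseSet) : T2Space M := by
  refine ⟨fun x y hxy => ?_⟩
  by_cases hb : π x = π y
  · obtain ⟨e, he⟩ := h (π x)
    have hx : x ∈ e.source := e.mem_source.2 he
    have hy : y ∈ e.source := e.mem_source.2 (hb ▸ he)
    have hne : e x ≠ e y := fun h' => hxy (e.injOn hx hy h')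
    obtain ⟨U, V, hU, hV, hxU, hyV, hUV⟩ := t2_separation hne
    refine ⟨e.source ∩ e ⁻¹' U, e.source ∩ e ⁻¹' V,
      e.toOpenPartialHomeomorph.isOpen_inter_preimage hU,
      e.toOpenPartialHomeomorph.isOpen_inter_preimage hV, ⟨hx, hxU⟩, ⟨hy, hyV⟩, ?_⟩
    exact (hUV.preimage e).mono inter_subset_right inter_subset_right
  · obtain ⟨U, V, hU, hV, hxU, hyV, hUV⟩ := t2_separation hb
    exact ⟨_, _, hU.preimage hπ, hV.preimage hπ, hxU, hyV, hUV.preimage π⟩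

theorem secondCountableTopology_of_trivialization [SecondCountableTopology B]
    [SecondCountableTopology F] (h : ∀ b, ∃ e : Bundle.Trivialization F π, b ∈ e.baseSet) :
    SecondCountableTopology M := by
  choose e he using h
  obtain ⟨s, hs, hcov⟩ := TopologicalSpace.countable_cover_nhds
    fun b => (e b).open_baseSet.mem_nhds (he b)
  have := hs.to_subtype
  have hsc : ∀ b : s, SecondCountableTopology (e b).source := fun b =>
    (e b).toOpenPartialHomeomorph.toHomeomorphSourceTarget.secondCountableTopology
  refine TopologicalSpace.secondCountableTopology_of_countable_cover
    (U := fun b : s => (e b).source) (fun b => (e b).open_source) ?_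
  refine eq_univ_of_forall fun x => ?_
  have hx : π x ∈ ⋃ b ∈ s, (e b).baseSet := hcov ▸ mem_univ _
  obtain ⟨b, hb, hxb⟩ := mem_iUnion₂.1 hx
  exact mem_iUnion.2 ⟨⟨b, hb⟩, (e b).mem_source.2 hxb⟩

end BundleTopology

/-! ### The standard symplectic form. -/

section StandardForm

open scoped RealInnerProductSpace

variable {E : Type*} [NormedAddCommGroup E] [InnerProductSpace ℝ E]

/-- The standard symplectic form on `E × E`. -/
noncomputable def standardSymplecticForm (E : Type*) [NormedAddCommGroup E]
    [InnerProductSpace ℝ E] : (E × E) [⋀^Fin 2]→L[ℝ] ℝ where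
  toFun v := ⟪(v 0).1, (v 1).2⟫ - ⟪(v 1).1, (v 0).2⟫
  map_update_add' := by
    intro _ m i x y
    fin_cases i <;> simp [inner_add_left, inner_add_right] <;> ring
  map_update_smul' := by
    intro _ m i c x
    fin_cases i <;> simp [inner_smul_left, inner_smul_right] <;> ring
  cont := by fun_prop
  map_eq_zero_of_eq' := by
    intro v i j h hij
    fin_cases i <;> fin_cases j <;> simp_all

theorem standardSymplecticForm_apply (v w : E × E) :
    standardSymplecticForm E ![v, w] = ⟪v.1, w.2⟫ - ⟪w.1, v.2⟫ := rfl

theorem standardSymplecticForm_nondegenerate {v : E × E}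
    (h : ∀ w, standardSymplecticForm E ![v, w] = 0) : v = 0 := by
  have h1 := h (0, v.1)
  have h2 := h (v.2, 0)
  simp only [standardSymplecticForm_apply, inner_zero_left, inner_zero_right, sub_zero, zero_sub,
    neg_eq_zero, inner_self_eq_zero] at h1 h2
  exact Prod.ext h1 h2

end StandardForm

/-! ### The torus bundle of an integral affine atlas and its coordinates. -/

section AffineAtlas

open Set Topology Filter

/-- The data of an integral affine atlas. -/
structure IntegralAffineAtlas (n : ℕ) (B : Type u) [TopologicalSpace B]
    [ChartedSpace (EuclideanSpace ℝ (Fin n)) B] where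
  /-- The charts of the atlas. -/
  charts : Set (OpenPartialHomeomorph B (EuclideanSpace ℝ (Fin n)))
  subset_maximalAtlas : charts ⊆ IsManifold.maximalAtlas (𝓡 n) ∞ B
  /-- A chart around each point. -/
  indexAt : B → charts
  mem_source_indexAt : ∀ b, b ∈ (indexAt b).1.source
  /-- The linear parts of the transition functions. -/
  linearPart : charts → charts → Matrix.GeneralLinearGroup (Fin n) ℤ
  /-- The translation parts of the transition functions. -/
  translationPart : charts → charts → EuclideanSpace ℝ (Fin n)
  transition_eq : ∀ i j : charts, ∀ x ∈ (i.1.symm.trans j.1).source,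
    i.1.symm.trans j.1 x = integralAffineMap (linearPart i j) (translationPart i j) x

theorem IsIntegralAffineManifold.nonempty_integralAffineAtlas {n : ℕ} {B : Type u}
    [TopologicalSpace B] [ChartedSpace (EuclideanSpace ℝ (Fin n)) B]
    (h : IsIntegralAffineManifold n B) : Nonempty (IntegralAffineAtlas n B) := by
  obtain ⟨𝒜, h𝒜, hcov, haff⟩ := h
  choose i hi hib using hcov
  choose A c hA using haff
  exact ⟨⟨𝒜, h𝒜, fun b => ⟨i b, hi b⟩, hib, fun i j => A i i.2 j j.2, fun i j => c i i.2 j j.2,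
    fun i j => hA i i.2 j j.2⟩⟩

namespace IntegralAffineAtlas

variable {n : ℕ} {B : Type u} [TopologicalSpace B] [ChartedSpace (EuclideanSpace ℝ (Fin n)) B]
  (𝔞 : IntegralAffineAtlas n B)

theorem apply_eq {i j : 𝔞.charts} {b : B} (hi : b ∈ i.1.source) (hj : b ∈ j.1.source) :
    j.1 b = integerLinear (𝔞.linearPart i j).val (i.1 b) + 𝔞.translationPart i j := by
  have h := 𝔞.transition_eq i j (i.1 b) ⟨i.1.map_source hi, by
    change i.1.symm (i.1 b) ∈ j.1.source
    rwa [i.1.left_inv hi]⟩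
  change j.1 (i.1.symm (i.1 b)) = _ at h
  rwa [i.1.left_inv hi] at h

/-- Near `b` the composite of two affine transitions is the third one; differentiate at `i.1 b`. -/
theorem linearPart_mul {i j k : 𝔞.charts} {b : B} (hi : b ∈ i.1.source) (hj : b ∈ j.1.source)
    (hk : b ∈ k.1.source) :
    (𝔞.linearPart j k).val * (𝔞.linearPart i j).val = (𝔞.linearPart i k).val := by
  apply integerLinear_injective
  rw [integerLinear_mul]
  have hev : ∀ᶠ b' in 𝓝 b, b' ∈ i.1.source ∧ b' ∈ j.1.source ∧ b' ∈ k.1.source :=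
    (i.1.open_source.eventually_mem hi).and ((j.1.open_source.eventually_mem hj).and
      (k.1.open_source.eventually_mem hk))
  have hc : Tendsto i.1.symm (𝓝 (i.1 b)) (𝓝 b) := by
    have := i.1.continuousAt_symm (i.1.map_source hi)
    rwa [ContinuousAt, i.1.left_inv hi] at this
  have h1 : (fun x => integerLinear (𝔞.linearPart j k).val
      (integerLinear (𝔞.linearPart i j).val x + 𝔞.translationPart i j) +
        𝔞.translationPart j k) =ᶠ[𝓝 (i.1 b)]
      fun x => integerLinear (𝔞.linearPart i k).val x + 𝔞.translationPart i k := by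
    filter_upwards [hc.eventually hev, i.1.open_target.mem_nhds (i.1.map_source hi)]
      with x hx hxt
    obtain ⟨hxi, hxj, hxk⟩ := hx
    have e1 := 𝔞.apply_eq hxi hxj
    have e2 := 𝔞.apply_eq hxj hxk
    have e3 := 𝔞.apply_eq hxi hxk
    rw [i.1.right_inv hxt] at e1 e3
    rw [← e1, ← e2, e3]
  have d1 : HasFDerivAt (fun x => integerLinear (𝔞.linearPart i k).val x + 𝔞.translationPart i k)
      (integerLinear (𝔞.linearPart i k).val) (i.1 b) :=
    (ContinuousLinearMap.hasFDerivAt _).add_const _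
  have d2 : HasFDerivAt (fun x => integerLinear (𝔞.linearPart j k).val
      (integerLinear (𝔞.linearPart i j).val x + 𝔞.translationPart i j) + 𝔞.translationPart j k)
      ((integerLinear (𝔞.linearPart j k).val).comp (integerLinear (𝔞.linearPart i j).val))
      (i.1 b) :=
    ((ContinuousLinearMap.hasFDerivAt _).comp (i.1 b)
      ((ContinuousLinearMap.hasFDerivAt _).add_const _)).add_const _
  exact d2.unique (d1.congr_of_eventuallyEq h1)

/-- The cocycle identity makes it idempotent, and an idempotent in a group is trivial. -/
theorem linearPart_self {i : 𝔞.charts} {b : B} (hi : b ∈ i.1.source) :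
    (𝔞.linearPart i i).val = 1 := by
  have h := 𝔞.linearPart_mul hi hi hi
  have h2 : 𝔞.linearPart i i * 𝔞.linearPart i i = 𝔞.linearPart i i := Units.ext h
  rw [mul_eq_left] at h2
  rw [h2]
  rfl

/-- The bundle of tori `T*B / Λ`, where `Λ` is the lattice spanned by the differentials of the
affine coordinates. -/
noncomputable def bundleCore : FiberBundleCore 𝔞.charts B (Torus.{u} n) where
  baseSet i := i.1.source
  isOpen_baseSet i := i.1.open_source
  indexAt := 𝔞.indexAt
  mem_baseSet_at := 𝔞.mem_source_indexAt
  -- Fibre coordinates are covector coordinates: they change by the inverse transpose of the linear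
  -- part from `i` to `j`, which is the transpose of the one from `j` to `i`.
  coordChange i j _ θ := torusEnd (𝔞.linearPart j i).val.transpose θ
  coordChange_self i b hb θ := by
    rw [𝔞.linearPart_self hb, Matrix.transpose_one, torusEnd_one]
  continuousOn_coordChange i j :=
    ((continuous_torusEnd _).comp continuous_snd).continuousOn
  coordChange_comp i j k b hb θ := by
    rw [← torusEnd_mul, ← Matrix.transpose_mul, 𝔞.linearPart_mul hb.2 hb.1.2 hb.1.1]

/-- The total space of the torus bundle. -/
abbrev Total : Type u := 𝔞.bundleCore.TotalSpace

/-- The affine coordinates on the base and the linear coordinates on the universal cover of the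
fibre parametrize the total space. -/
noncomputable def param (i : 𝔞.charts) (w : EuclideanSpace ℝ (Fin n) × EuclideanSpace ℝ (Fin n)) :
    𝔞.Total :=
  (𝔞.bundleCore.localTriv i).toOpenPartialHomeomorph.symm (i.1.symm w.1, torusMk w.2)

theorem localTriv_param {i j : 𝔞.charts}
    {w : EuclideanSpace ℝ (Fin n) × EuclideanSpace ℝ (Fin n)} (hi : w.1 ∈ i.1.target)
    (hj : i.1.symm w.1 ∈ j.1.source) :
    𝔞.bundleCore.localTriv j (𝔞.param i w) =
      (i.1.symm w.1, torusMk (integerLinear (𝔞.linearPart j i).val.transpose w.2)) := by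
  rw [← torusEnd_torusMk]
  refine Prod.ext rfl ?_
  exact 𝔞.bundleCore.coordChange_comp i (𝔞.indexAt (i.1.symm w.1)) j (i.1.symm w.1)
    ⟨⟨i.1.map_target hi, 𝔞.mem_source_indexAt _⟩, hj⟩ (torusMk w.2)

theorem continuousOn_param (i : 𝔞.charts) :
    ContinuousOn (𝔞.param i) (Prod.fst ⁻¹' i.1.target) := by
  refine (𝔞.bundleCore.localTriv i).toOpenPartialHomeomorph.continuousOn_symm.comp
    (ContinuousOn.prodMk (i.1.continuousOn_symm.comp continuousOn_fst fun w hw => hw)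
      (isOpenQuotientMap_torusMk.continuous.comp continuous_snd).continuousOn) fun w hw => ?_
  exact (𝔞.bundleCore.mem_localTriv_target i _).2 (i.1.map_target hw)

/-- A linear identification of `ℝⁿ × ℝⁿ` with `ℝ²ⁿ`. -/
noncomputable def prodEuclidean (n : ℕ) :
    (EuclideanSpace ℝ (Fin n) × EuclideanSpace ℝ (Fin n)) ≃L[ℝ] EuclideanSpace ℝ (Fin (2 * n)) :=
  ContinuousLinearEquiv.ofFinrankEq (by simp [two_mul])

/-- The chart of the total space given by affine coordinates on the base and linear coordinates
on the fibre. -/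
noncomputable def totalChart (p : 𝔞.Total) :
    OpenPartialHomeomorph 𝔞.Total (EuclideanSpace ℝ (Fin (2 * n))) :=
  ((𝔞.bundleCore.localTriv (𝔞.indexAt p.1)).toOpenPartialHomeomorph.trans
    ((𝔞.indexAt p.1).1.prod (chartAt (EuclideanSpace ℝ (Fin n)) (show Torus.{u} n from p.2)))).trans
    (prodEuclidean n).toHomeomorph.toOpenPartialHomeomorph

theorem mem_totalChart_source {p q : 𝔞.Total} : q ∈ (𝔞.totalChart p).source ↔
    q.1 ∈ (𝔞.indexAt p.1).1.source ∧ (𝔞.bundleCore.localTriv (𝔞.indexAt p.1) q).2 ∈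
      (chartAt (EuclideanSpace ℝ (Fin n)) (show Torus.{u} n from p.2)).source := by
  simp only [totalChart, OpenPartialHomeomorph.trans_source, OpenPartialHomeomorph.prod_source,
    Homeomorph.toOpenPartialHomeomorph_source, preimage_univ, inter_univ, mem_inter_iff,
    mem_preimage, mem_prod]
  constructor
  · rintro ⟨h1, h2, h3⟩
    exact ⟨h2, h3⟩
  · rintro ⟨h2, h3⟩
    exact ⟨(𝔞.bundleCore.mem_localTriv_source _ _).2 h2, h2, h3⟩

theorem mem_totalChart_source_self (p : 𝔞.Total) : p ∈ (𝔞.totalChart p).source := by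
  rw [mem_totalChart_source]
  refine ⟨𝔞.mem_source_indexAt _, ?_⟩
  have : 𝔞.bundleCore.localTriv (𝔞.indexAt p.1) p = ⟨p.1, p.2⟩ :=
    𝔞.bundleCore.localTrivAt_apply p
  rw [this]
  exact mem_chart_source _ _

theorem totalChart_symm_apply (p : 𝔞.Total) (z : EuclideanSpace ℝ (Fin (2 * n))) :
    (𝔞.totalChart p).symm z = 𝔞.param (𝔞.indexAt p.1) ((prodEuclidean n).symm z) := by
  have h := congrFun (chartAt_torus_symm (show Torus.{u} n from p.2)) ((prodEuclidean n).symm z).2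
  rw [param, ← h]
  rfl

theorem totalChart_symm_fst_mem {p : 𝔞.Total} {z : EuclideanSpace ℝ (Fin (2 * n))}
    (hz : z ∈ (𝔞.totalChart p).target) :
    ((prodEuclidean n).symm z).1 ∈ (𝔞.indexAt p.1).1.target := by
  simp only [totalChart, OpenPartialHomeomorph.trans_target, OpenPartialHomeomorph.prod_target,
    mem_inter_iff, mem_preimage, mem_prod] at hz
  exact hz.2.1.1

theorem totalChart_fst (p q : 𝔞.Total) :
    ((prodEuclidean n).symm (𝔞.totalChart p q)).1 = (𝔞.indexAt p.1).1 q.1 := by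
  simp [totalChart]

theorem torusMk_totalChart_snd {p q : 𝔞.Total} (h : q ∈ (𝔞.totalChart p).source) :
    torusMk ((prodEuclidean n).symm (𝔞.totalChart p q)).2 =
      (𝔞.bundleCore.localTriv (𝔞.indexAt p.1) q).2 := by
  have h' := torusMk_chartAt (𝔞.mem_totalChart_source.1 h).2
  simpa [totalChart] using h'

/-- The linear part of the change of coordinates on the total space. -/
noncomputable def blockLinear (i j : 𝔞.charts) :
    (EuclideanSpace ℝ (Fin n) × EuclideanSpace ℝ (Fin n)) →L[ℝ]
      (EuclideanSpace ℝ (Fin n) × EuclideanSpace ℝ (Fin n)) :=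
  (integerLinear (𝔞.linearPart i j).val).prodMap
    (integerLinear (𝔞.linearPart j i).val.transpose)

/-- Moving the transpose across the inner product produces the product of the two linear parts,
which are inverse to each other. -/
theorem standardSymplecticForm_blockLinear {i j : 𝔞.charts} {b : B} (hi : b ∈ i.1.source)
    (hj : b ∈ j.1.source) :
    (standardSymplecticForm (EuclideanSpace ℝ (Fin n))).compContinuousLinearMap
      (𝔞.blockLinear i j) = standardSymplecticForm (EuclideanSpace ℝ (Fin n)) := by
  have h : ∀ v, integerLinear (𝔞.linearPart j i).val (integerLinear (𝔞.linearPart i j).val v) =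
      v := by
    intro v
    rw [← ContinuousLinearMap.comp_apply, ← integerLinear_mul, 𝔞.linearPart_mul hi hj hi,
      𝔞.linearPart_self hi, integerLinear_one]
    rfl
  ext v
  change inner ℝ (integerLinear (𝔞.linearPart i j).val (v 0).1)
      (integerLinear (𝔞.linearPart j i).val.transpose (v 1).2) -
    inner ℝ (integerLinear (𝔞.linearPart i j).val (v 1).1)
      (integerLinear (𝔞.linearPart j i).val.transpose (v 0).2) = _
  rw [inner_integerLinear_transpose, inner_integerLinear_transpose, h, h]
  rfl

/-- The base component is the affine transition. The fibre component and the block-linear expression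
are two lifts of the same torus point, so they differ by a locally constant vector. -/
theorem totalChart_param_eventuallyEq {p : 𝔞.Total} {i : 𝔞.charts}
    {w₀ : EuclideanSpace ℝ (Fin n) × EuclideanSpace ℝ (Fin n)} (hw₀ : w₀.1 ∈ i.1.target)
    (hp : 𝔞.param i w₀ ∈ (𝔞.totalChart p).source) :
    ∃ c, (fun w => 𝔞.totalChart p (𝔞.param i w)) =ᶠ[𝓝 w₀]
      fun w => prodEuclidean n (𝔞.blockLinear i (𝔞.indexAt p.1) w) + c := by
  set j := 𝔞.indexAt p.1 with hj
  set S := (Prod.fst ⁻¹' i.1.target) ∩ 𝔞.param i ⁻¹' (𝔞.totalChart p).source with hS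
  have hSo : IsOpen S := (𝔞.continuousOn_param i).isOpen_inter_preimage
    (i.1.open_target.preimage continuous_fst) (𝔞.totalChart p).open_source
  let f := fun w => (prodEuclidean n).symm (𝔞.totalChart p (𝔞.param i w))
  have hf : ContinuousOn f S :=
    (prodEuclidean n).symm.continuous.comp_continuousOn
      ((𝔞.totalChart p).continuousOn.comp ((𝔞.continuousOn_param i).mono inter_subset_left)
        fun w hw => hw.2)
  have hjs : ∀ w ∈ S, i.1.symm w.1 ∈ j.1.source := fun w hw =>
    (𝔞.mem_totalChart_source.1 hw.2).1
  have h1 : ∀ w ∈ S, (f w).1 = integerLinear (𝔞.linearPart i j).val w.1 +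
      𝔞.translationPart i j := by
    intro w hw
    have e := 𝔞.apply_eq (i.1.map_target hw.1) (hjs w hw)
    rw [i.1.right_inv hw.1] at e
    rw [← e]
    exact 𝔞.totalChart_fst p _
  have h2 : ∀ w ∈ S, torusMk.{u} (f w).2 =
      torusMk (integerLinear (𝔞.linearPart j i).val.transpose w.2) := by
    intro w hw
    rw [𝔞.torusMk_totalChart_snd hw.2, 𝔞.localTriv_param hw.1 (hjs w hw)]
  have h3 := eventuallyEq_of_torusMk_eq.{u} hSo (continuous_snd.comp_continuousOn hf)
    ((integerLinear (𝔞.linearPart j i).val.transpose).continuous.comp continuous_snd).continuousOn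
    h2 ⟨hw₀, hp⟩
  refine ⟨prodEuclidean n (𝔞.translationPart i j, (f w₀).2 -
    integerLinear (𝔞.linearPart j i).val.transpose w₀.2), ?_⟩
  filter_upwards [h3, hSo.mem_nhds ⟨hw₀, hp⟩] with w hw hwS
  rw [← map_add, ← ContinuousLinearEquiv.symm_apply_eq]
  exact Prod.ext (h1 w hwS) hw

end IntegralAffineAtlas

end AffineAtlas

/-! ### Smooth and symplectic structure on the torus bundle. -/

section TorusBundle

open Set Topology Filter

namespace IntegralAffineAtlas

variable {n : ℕ} {B : Type u} [TopologicalSpace B] [ChartedSpace (EuclideanSpace ℝ (Fin n)) B]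
  (𝔞 : IntegralAffineAtlas n B)

noncomputable instance : ChartedSpace (EuclideanSpace ℝ (Fin (2 * n))) 𝔞.Total where
  atlas := range 𝔞.totalChart
  chartAt := 𝔞.totalChart
  mem_chart_source := 𝔞.mem_totalChart_source_self
  chart_mem_atlas := mem_range_self

theorem totalChart_transition_eventuallyEq {p q : 𝔞.Total} {z : EuclideanSpace ℝ (Fin (2 * n))}
    (hz : z ∈ (𝔞.totalChart p).target)
    (hq : (𝔞.totalChart p).symm z ∈ (𝔞.totalChart q).source) :
    ∃ c, (fun z => 𝔞.totalChart q ((𝔞.totalChart p).symm z)) =ᶠ[𝓝 z] fun z =>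
      prodEuclidean n (𝔞.blockLinear (𝔞.indexAt p.1) (𝔞.indexAt q.1) ((prodEuclidean n).symm z)) +
        c := by
  rw [totalChart_symm_apply] at hq
  obtain ⟨c, hc⟩ := 𝔞.totalChart_param_eventuallyEq (𝔞.totalChart_symm_fst_mem hz) hq
  refine ⟨c, ?_⟩
  filter_upwards [(prodEuclidean n).symm.continuous.continuousAt.eventually hc] with y hy
  rw [totalChart_symm_apply]
  exact hy

instance : IsManifold (𝓡 (2 * n)) ∞ 𝔞.Total := by
  have key : ∀ p q : 𝔞.Total, ContDiffOn ℝ ∞ ((𝔞.totalChart p).symm.trans (𝔞.totalChart q))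
      ((𝔞.totalChart p).symm.trans (𝔞.totalChart q)).source := by
    intro p q z hz
    obtain ⟨c, hc⟩ := 𝔞.totalChart_transition_eventuallyEq hz.1 hz.2
    refine ContDiffAt.contDiffWithinAt (ContDiffAt.congr_of_eventuallyEq ?_ hc)
    fun_prop
  have : HasGroupoid 𝔞.Total (contDiffGroupoid ∞ (𝓡 (2 * n))) := by
    refine ⟨?_⟩
    rintro _ _ ⟨p, rfl⟩ ⟨q, rfl⟩
    exact mem_contDiffGroupoid_of_contDiffOn (key p q) (key q p)
  exact IsManifold.mk' _ _ _

theorem contMDiffOn_totalChart (p : 𝔞.Total) :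
    ContMDiffOn (𝓡 (2 * n)) (𝓡 (2 * n)) ∞ (𝔞.totalChart p) (𝔞.totalChart p).source :=
  contMDiffOn_chart (x := p)

theorem contMDiff_proj : ContMDiff (𝓡 (2 * n)) (𝓡 n) ∞ 𝔞.bundleCore.proj := by
  intro p
  have hs := 𝔞.mem_totalChart_source_self p
  have h1 : ContMDiffAt (𝓡 (2 * n)) (𝓡 n) ∞
      (fun q => ((prodEuclidean n).symm (𝔞.totalChart p q)).1) p := by
    have h2 : ContMDiff (𝓡 (2 * n)) (𝓡 n) ∞
        (fun z : EuclideanSpace ℝ (Fin (2 * n)) => ((prodEuclidean n).symm z).1) :=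
      contMDiff_iff_contDiff.2 (by fun_prop)
    exact h2.contMDiffAt.comp p ((𝔞.contMDiffOn_totalChart p).contMDiffAt
      ((𝔞.totalChart p).open_source.mem_nhds hs))
  have h3 : ContMDiffAt (𝓡 n) (𝓡 n) ∞ (𝔞.indexAt p.1).1.symm
      ((prodEuclidean n).symm (𝔞.totalChart p p)).1 := by
    rw [totalChart_fst]
    exact contMDiffAt_symm_of_mem_maximalAtlas (𝔞.subset_maximalAtlas (𝔞.indexAt p.1).2)
      ((𝔞.indexAt p.1).1.map_source (𝔞.mem_source_indexAt _))
  refine (h3.comp p h1).congr_of_eventuallyEq ?_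
  filter_upwards [(𝔞.totalChart p).open_source.mem_nhds hs] with q hq
  rw [Function.comp_apply, totalChart_fst,
    (𝔞.indexAt p.1).1.left_inv (𝔞.mem_totalChart_source.1 hq).1]

theorem contMDiffOn_param (i : 𝔞.charts) :
    ContMDiffOn ((𝓡 n).prod (𝓡 n)) (𝓡 (2 * n)) ∞ (𝔞.param i) (Prod.fst ⁻¹' i.1.target) := by
  intro w hw
  refine ContMDiffAt.contMDiffWithinAt ?_
  have hs := 𝔞.mem_totalChart_source_self (𝔞.param i w)
  obtain ⟨c, hc⟩ := 𝔞.totalChart_param_eventuallyEq hw hs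
  refine contMDiffAt_iff_target.2 ⟨(𝔞.continuousOn_param i).continuousAt
    ((i.1.open_target.preimage continuous_fst).mem_nhds hw), ?_⟩
  rw [← modelWithCornersSelf_prod, chartedSpaceSelf_prod, contMDiffAt_iff_contDiffAt]
  refine ContDiffAt.congr_of_eventuallyEq ?_ hc
  fun_prop

/-- In the chart at `p` the fibre component is a linear function followed by the smooth covering of
the torus. -/
theorem contMDiffOn_localTriv (i : 𝔞.charts) :
    ContMDiffOn (𝓡 (2 * n)) ((𝓡 n).prod (𝓡 n)) ∞ (𝔞.bundleCore.localTriv i)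
      (𝔞.bundleCore.localTriv i).source := by
  intro p hp
  refine ContMDiffAt.contMDiffWithinAt ?_
  have hpi : p.1 ∈ i.1.source := (𝔞.bundleCore.mem_localTriv_source i p).1 hp
  have hs := 𝔞.mem_totalChart_source_self p
  set j := 𝔞.indexAt p.1 with hj
  have h1 : ContMDiffAt (𝓡 (2 * n)) (𝓡 n) ∞ (fun q => torusMk.{u}
      (integerLinear (𝔞.linearPart i j).val.transpose
        ((prodEuclidean n).symm (𝔞.totalChart p q)).2)) p := by
    have h2 : ContMDiff (𝓡 (2 * n)) (𝓡 n) ∞ (fun z : EuclideanSpace ℝ (Fin (2 * n)) =>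
        integerLinear (𝔞.linearPart i j).val.transpose ((prodEuclidean n).symm z).2) :=
      contMDiff_iff_contDiff.2 (by fun_prop)
    exact (contMDiff_torusMk.comp h2).contMDiffAt.comp p ((𝔞.contMDiffOn_totalChart p).contMDiffAt
      ((𝔞.totalChart p).open_source.mem_nhds hs))
  refine ((𝔞.contMDiff_proj p).prodMk h1).congr_of_eventuallyEq ?_
  filter_upwards [(𝔞.totalChart p).open_source.mem_nhds hs,
    (𝔞.bundleCore.localTriv i).open_source.mem_nhds hp] with q hq hqi
  refine Prod.ext rfl ?_
  have hqi' : q.1 ∈ i.1.source := (𝔞.bundleCore.mem_localTriv_source i q).1 hqi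
  rw [← torusEnd_torusMk, 𝔞.torusMk_totalChart_snd hq]
  exact (𝔞.bundleCore.coordChange_comp (𝔞.indexAt q.1) j i q.1
    ⟨⟨𝔞.mem_source_indexAt _, (𝔞.mem_totalChart_source.1 hq).1⟩, hqi'⟩ q.2).symm

theorem contMDiffOn_localTriv_symm (i : 𝔞.charts) :
    ContMDiffOn ((𝓡 n).prod (𝓡 n)) (𝓡 (2 * n)) ∞
      (𝔞.bundleCore.localTriv i).toOpenPartialHomeomorph.symm
      (𝔞.bundleCore.localTriv i).target := by
  rintro ⟨b, θ⟩ hb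
  have hb' : b ∈ i.1.source := (𝔞.bundleCore.mem_localTriv_target i _).1 hb
  refine ContMDiffAt.contMDiffWithinAt ?_
  set c := chartAt (EuclideanSpace ℝ (Fin n)) θ with hc
  have hθ : θ ∈ c.source := mem_chart_source _ θ
  have h1 : ContMDiffAt ((𝓡 n).prod (𝓡 n)) ((𝓡 n).prod (𝓡 n)) ∞
      (fun x : B × Torus.{u} n => (i.1 x.1, c x.2)) (b, θ) := by
    refine ContMDiffAt.prodMk ?_ ?_
    · exact (contMDiffAt_of_mem_maximalAtlas (𝔞.subset_maximalAtlas i.2) hb').comp (b, θ)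
        contMDiffAt_fst
    · exact ((contMDiffOn_chart (x := θ)).contMDiffAt (c.open_source.mem_nhds hθ)).comp (b, θ)
        contMDiffAt_snd
  have h2 : ContMDiffAt ((𝓡 n).prod (𝓡 n)) (𝓡 (2 * n)) ∞ (𝔞.param i) (i.1 b, c θ) :=
    (𝔞.contMDiffOn_param i).contMDiffAt
      ((i.1.open_target.preimage continuous_fst).mem_nhds (i.1.map_source hb'))
  refine (h2.comp (b, θ) h1).congr_of_eventuallyEq ?_
  filter_upwards [prod_mem_nhds (i.1.open_source.mem_nhds hb') (c.open_source.mem_nhds hθ)]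
    with x hx
  simp only [Function.comp_apply, param]
  rw [i.1.left_inv hx.1, torusMk_chartAt hx.2]

/-- The standard symplectic form on `ℝ²ⁿ`. -/
noncomputable def euclideanSymplecticForm (n : ℕ) :
    EuclideanSpace ℝ (Fin (2 * n)) [⋀^Fin 2]→L[ℝ] ℝ :=
  (standardSymplecticForm (EuclideanSpace ℝ (Fin n))).compContinuousLinearMap
    ((prodEuclidean n).symm : EuclideanSpace ℝ (Fin (2 * n)) →L[ℝ]
      EuclideanSpace ℝ (Fin n) × EuclideanSpace ℝ (Fin n))

theorem euclideanSymplecticForm_apply (v w : EuclideanSpace ℝ (Fin (2 * n))) :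
    euclideanSymplecticForm n ![v, w] = standardSymplecticForm (EuclideanSpace ℝ (Fin n))
      ![(prodEuclidean n).symm v, (prodEuclidean n).symm w] := by
  rw [euclideanSymplecticForm, ContinuousAlternatingMap.compContinuousLinearMap_apply]
  congr 1
  ext i : 1
  fin_cases i <;> rfl

theorem euclideanSymplecticForm_nondegenerate {v : EuclideanSpace ℝ (Fin (2 * n))}
    (hv : ∀ w, euclideanSymplecticForm n ![v, w] = 0) : v = 0 := by
  have h := standardSymplecticForm_nondegenerate (v := (prodEuclidean n).symm v) fun w => by
    have := hv (prodEuclidean n w)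
    rwa [euclideanSymplecticForm_apply, ContinuousLinearEquiv.symm_apply_apply] at this
  exact (prodEuclidean n).symm.map_eq_zero_iff.1 h

/-- The linear part of the change of coordinates on the total space, on `ℝ²ⁿ`. -/
noncomputable def euclideanBlockLinear (i j : 𝔞.charts) :
    EuclideanSpace ℝ (Fin (2 * n)) →L[ℝ] EuclideanSpace ℝ (Fin (2 * n)) :=
  (prodEuclidean n).toContinuousLinearMap.comp
    ((𝔞.blockLinear i j).comp (prodEuclidean n).symm.toContinuousLinearMap)

theorem euclideanSymplecticForm_euclideanBlockLinear {i j : 𝔞.charts} {b : B}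
    (hi : b ∈ i.1.source) (hj : b ∈ j.1.source) :
    (euclideanSymplecticForm n).compContinuousLinearMap (𝔞.euclideanBlockLinear i j) =
      euclideanSymplecticForm n := by
  ext v
  have := DFunLike.congr_fun (𝔞.standardSymplecticForm_blockLinear hi hj)
    fun i => (prodEuclidean n).symm (v i)
  simp only [ContinuousAlternatingMap.compContinuousLinearMap_apply] at this
  simp only [euclideanSymplecticForm, ContinuousAlternatingMap.compContinuousLinearMap_apply]
  refine Eq.trans ?_ this
  congr 1
  ext k : 1
  exact (prodEuclidean n).symm_apply_apply _

/-- The canonical symplectic form on the torus bundle. In the preferred chart at each point it is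
the standard form. -/
noncomputable def symplecticForm : TwoForm (2 * n) 𝔞.Total := fun _ => euclideanSymplecticForm n

/-- The form is defined at each point through the preferred chart there. Comparing that chart with
the one at `p` brings in a block-linear derivative, which preserves the standard form, so the
coordinate expression is constant. -/
theorem symplecticForm_inChart {p : 𝔞.Total} {y : EuclideanSpace ℝ (Fin (2 * n))}
    (hy : y ∈ (𝔞.totalChart p).target) :
    𝔞.symplecticForm.inChart p y = euclideanSymplecticForm n := by
  set q := (𝔞.totalChart p).symm y with hq
  obtain ⟨c, hc⟩ := 𝔞.totalChart_transition_eventuallyEq hy (𝔞.mem_totalChart_source_self q)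
  have hD : HasFDerivAt (fun z => 𝔞.totalChart q ((𝔞.totalChart p).symm z))
      (𝔞.euclideanBlockLinear (𝔞.indexAt p.1) (𝔞.indexAt q.1)) y :=
    HasFDerivAt.congr_of_eventuallyEq ((ContinuousLinearMap.hasFDerivAt _).add_const c) hc
  have hm : HasMFDerivAt (𝓡 (2 * n)) (𝓡 (2 * n)) (extChartAt (𝓡 (2 * n)) p).symm y
      (𝔞.euclideanBlockLinear (𝔞.indexAt p.1) (𝔞.indexAt q.1)) :=
    ⟨(𝔞.totalChart p).continuousAt_symm hy, hD.hasFDerivWithinAt⟩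
  have hpb : q.1 ∈ (𝔞.indexAt p.1).1.source :=
    (𝔞.mem_totalChart_source.1 ((𝔞.totalChart p).map_target hy)).1
  rw [TwoForm.inChart, hm.mfderiv]
  exact 𝔞.euclideanSymplecticForm_euclideanBlockLinear hpb (𝔞.mem_source_indexAt q.1)

theorem extChartAt_total_target (p : 𝔞.Total) :
    (extChartAt (𝓡 (2 * n)) p).target = (𝔞.totalChart p).target := by
  rw [extChartAt_target]
  simp
  rfl

theorem isSymplecticForm : IsSymplecticForm 𝔞.symplecticForm where
  smooth p := by
    rw [extChartAt_total_target]
    exact contDiffOn_const.congr fun y hy => 𝔞.symplecticForm_inChart hy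
  closed p y hy := by
    rw [extChartAt_total_target] at hy
    have hev : 𝔞.symplecticForm.inChart p =ᶠ[𝓝 y] fun _ => euclideanSymplecticForm n := by
      filter_upwards [(𝔞.totalChart p).open_target.mem_nhds hy] with z hz
      exact 𝔞.symplecticForm_inChart hz
    rw [extDeriv, hev.fderiv_eq, fderiv_fun_const]
    exact map_zero (ContinuousAlternatingMap.alternatizeUncurryFinCLM ℝ _ ℝ)
  nondegenerate _ _ hv := euclideanSymplecticForm_nondegenerate hv

/-- The first coordinate on the total space is the base chart composed with the projection, so its
differential kills vertical vectors. -/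
theorem fst_eq_zero_of_mfderiv_proj_eq_zero [IsManifold (𝓡 n) ∞ B] {x : 𝔞.Total}
    {v : TangentSpace (𝓡 (2 * n)) x}
    (hv : mfderiv (𝓡 (2 * n)) (𝓡 n) 𝔞.bundleCore.proj x v = 0) :
    ((prodEuclidean n).symm v).1 = 0 := by
  let D : EuclideanSpace ℝ (Fin (2 * n)) →L[ℝ] EuclideanSpace ℝ (Fin n) :=
    (ContinuousLinearMap.fst ℝ _ _).comp (prodEuclidean n).symm.toContinuousLinearMap
  set i := 𝔞.indexAt x.1 with hi
  have hix : x.1 ∈ i.1.source := 𝔞.mem_source_indexAt x.1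
  have hxs := 𝔞.mem_totalChart_source_self x
  have h1 : HasMFDerivAt (𝓡 (2 * n)) (𝓡 n)
      (fun q : 𝔞.Total => ((prodEuclidean n).symm (𝔞.totalChart x q)).1) x D := by
    refine ⟨?_, ?_⟩
    · exact (continuous_fst.comp (prodEuclidean n).symm.continuous).continuousAt.comp
        ((𝔞.totalChart x).continuousAt hxs)
    · refine HasFDerivAt.hasFDerivWithinAt (D.hasFDerivAt.congr_of_eventuallyEq ?_)
      filter_upwards [(𝔞.totalChart x).open_target.mem_nhds ((𝔞.totalChart x).map_source hxs)]
        with z hz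
      exact congrArg D ((𝔞.totalChart x).right_inv hz)
  have hπ := ((𝔞.contMDiff_proj x).mdifferentiableAt (by simp)).hasMFDerivAt
  have hic := ((contMDiffAt_of_mem_maximalAtlas (𝔞.subset_maximalAtlas i.2)
    hix).mdifferentiableAt (by simp)).hasMFDerivAt
  have h2 := HasMFDerivAt.comp (g := i.1) (f := 𝔞.bundleCore.proj) x hic hπ
  have h3 : (fun q : 𝔞.Total => ((prodEuclidean n).symm (𝔞.totalChart x q)).1) =
      i.1 ∘ 𝔞.bundleCore.proj := funext fun q => 𝔞.totalChart_fst x q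
  rw [h3] at h1
  have h4 := DFunLike.congr_fun (hasMFDerivAt_unique h1 h2) v
  refine h4.trans ?_
  exact (congrArg (mfderiv (𝓡 n) (𝓡 n) i.1 x.1) hv).trans (map_zero _)

theorem isLagrangianFibration [IsManifold (𝓡 n) ∞ B] :
    IsLagrangianFibration (F := Torus.{u} n) 𝔞.symplecticForm 𝔞.bundleCore.proj where
  symplectic := 𝔞.isSymplecticForm
  compact_fibre := inferInstance
  connected_fibre := inferInstance
  smooth := 𝔞.contMDiff_proj
  locallyTrivial b := ⟨𝔞.bundleCore.localTriv (𝔞.indexAt b), 𝔞.mem_source_indexAt b,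
    𝔞.contMDiffOn_localTriv _, 𝔞.contMDiffOn_localTriv_symm _⟩
  lagrangian x v w hv hw := by
    refine (euclideanSymplecticForm_apply v w).trans ?_
    rw [standardSymplecticForm_apply,
      𝔞.fst_eq_zero_of_mfderiv_proj_eq_zero hv, 𝔞.fst_eq_zero_of_mfderiv_proj_eq_zero hw]
    simp

end IntegralAffineAtlas

theorem IsIntegralAffineManifold.isBaseOfLagrangianFibration (n : ℕ) (B : Type u)
    [TopologicalSpace B] [T2Space B] [SecondCountableTopology B]
    [ChartedSpace (EuclideanSpace ℝ (Fin n)) B] [IsManifold (𝓡 n) ∞ B]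
    (h : IsIntegralAffineManifold n B) : IsBaseOfLagrangianFibration n B := by
  obtain ⟨𝔞⟩ := h.nonempty_integralAffineAtlas
  have htriv : ∀ b, ∃ e : Bundle.Trivialization (Torus.{u} n) 𝔞.bundleCore.proj, b ∈ e.baseSet :=
    fun b => ⟨𝔞.bundleCore.localTriv (𝔞.indexAt b), 𝔞.mem_source_indexAt b⟩
  exact ⟨𝔞.Total, inferInstance, inferInstance, Torus.{u} n, inferInstance, inferInstance,
    ⟨inferInstance, t2Space_of_trivialization 𝔞.bundleCore.continuous_proj htriv,
      secondCountableTopology_of_trivialization htriv⟩,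
    ⟨inferInstance, inferInstance, inferInstance⟩,
    𝔞.symplecticForm, 𝔞.bundleCore.proj, 𝔞.isLagrangianFibration⟩

end TorusBundle

theorem lemma2p1 (n : ℕ) (B : Type u) [TopologicalSpace B] [T2Space B]
    [SecondCountableTopology B] [ConnectedSpace B]
    [ChartedSpace (EuclideanSpace ℝ (Fin n)) B] [IsManifold (𝓡 n) ∞ B] :
    IsBaseOfLagrangianFibration n B ↔ IsIntegralAffineManifold n B :=
  ⟨IsBaseOfLagrangianFibration.isIntegralAffineManifold n B,
    IsIntegralAffineManifold.isBaseOfLagrangianFibration n B⟩
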